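/- All functions are complex valued. Let $\dot H^1(\mathbb R^3)=\{\phi\in L^6(\mathbb R^3):\nabla\phi\in L^2(\mathbb R^3)\}$ (the completion of $C_0^\infty(\mathbb R^3)$ in the norm $\|\nabla\phi\|_{L^2}$), and for $(\phi,\psi)\in\dot H^1\times L^2$ put $$E(\phi,\psi)^2=\int_{\mathbb R^3}\left(|\nabla\phi|^2+|\psi|^2\right)dz .$$ For $k\ge 0$ let $H^k(\mathbb R^3)=\{\psi\in L^2:\partial^\alpha\psi\in L^2,\ |\alpha|\le k\}$ and $\tilde H^{k+1}(\mathbb R^3)=\{\phi\in\dot H^1:\partial^\alpha\phi\in L^2,\ 1\le|\alpha|\le k+1\}$, with weak derivatives; the subscript $\mathrm{rad}$ denotes the radial elements, i.e. those which depend on $|z|$ only. A function $f\in L^1(\mathbb R;L^2(\mathbb R^3))$ is called radial if $f(t,\cdot)$ is radial for almost every $t$. For $\phi,\psi\in C_0^\infty(\mathbb R^3)$ and $f\in C_0^\infty(\mathbb R\times\mathbb R^3)$ let $u$ be the solution of $$(\partial_t^2-\Delta)u=f\ \text{ in }(0,\infty)\times\mathbb R^3,\qquad u(0,\cdot)=\phi,\quad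 \partial_tu(0,\cdot)=\psi,$$ smooth up to $t=0$. Its forward radiation field is $$\mathcal R_+(\phi,\psi,f)(s,\theta)=\partial_s\Big(\lim_{r\to\infty}r\,u(s+r,r\theta)\Big),\qquad (s,\theta)\in\mathbb R\times\mathbb S^2 .$$ Denote by the same symbol the continuous extension $$\mathcal R_+:\dot H^1(\mathbb R^3)\times L^2(\mathbb R^3)\times L^1(\mathbb R;L^2(\mathbb R^3))\to L^2(\mathbb R\times\mathbb S^2),$$ where the space $\dot H^1\times L^2$ of initial data carries the norm $E$. **Proposition.** (i) For every $f\in L^1(\mathbb R;L^2(\mathbb R^3))$ there is a unique pair $(\phi,\psi)\in\dot H^1(\mathbb R^3)\times L^2(\mathbb R^3)$ with $\mathcal R_+(\phi,\psi,f)=0$, and for this pair $$E(\phi,\psi)\le\|f\|_{L^1(\mathbb R;L^2(\mathbb R^3))}.$$ (ii) Let $k\ge0$ be an integer. If $f\in L^1(\mathbb R;H^k(\mathbb R^3))$ is radial, then there is a unique pair $(\phi,\psi)\in\tilde H^{k+1}_{\mathrm{rad}}(\mathbb R^3)\times H^k_{\mathrm{rad}}(\mathbb R^3)$ with $\mathcal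 R_+(\phi,\psi,f)=0$. -/

import Mathlib

open MeasureTheory Filter Topology
open scoped ENNReal ContDiff SchwartzMap LineDeriv Laplacian

noncomputable section

namespace RadiationField

/-- Three-dimensional Euclidean space `ℝ³`. -/
abbrev E3 : Type := EuclideanSpace ℝ (Fin 3)

/-- The unit sphere `𝕊² ⊆ ℝ³`. -/
abbrev S2 : Type := Metric.sphere (0 : E3) 1

/-- The measure `ds dθ` on the cylinder `ℝ × 𝕊²`: Lebesgue measure times surface measure. -/
abbrev cylMeasure : Measure (ℝ × S2) :=
  (volume : Measure ℝ).prod (volume : Measure E3).toSphere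

instance fact_one_le_six : Fact ((1 : ℝ≥0∞) ≤ 6) := ⟨by norm_num⟩

/-- `L²(ℝ³)`, complex valued. -/
abbrev L2 : Type := Lp ℂ 2 (volume : Measure E3)

/-- `L⁶(ℝ³)`, complex valued. -/
abbrev L6 : Type := Lp ℂ 6 (volume : Measure E3)

/-- `L¹(ℝ; L²(ℝ³))`, with its norm `∫ ‖f(t)‖_{L²} dt`. -/
abbrev L1L2 : Type := Lp L2 1 (volume : Measure ℝ)

/-- `L²(ℝ × 𝕊²)`. -/
abbrev L2Cyl : Type := Lp ℂ 2 cylMeasure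

/-- The `i`-th standard basis vector of `ℝ³`. -/
def basisVec (i : Fin 3) : E3 := EuclideanSpace.single i 1

/-- `g ∈ L²` is the distributional derivative `∂_{α 0} ⋯ ∂_{α (n-1)} φ` of `φ ∈ Lᵖ`.
The multi-indices of length `n` are written as `n`-tuples of coordinate directions. -/
def IsWeakDeriv {p : ℝ≥0∞} [Fact (1 ≤ p)] {n : ℕ} (α : Fin n → Fin 3)
    (φ : Lp ℂ p (volume : Measure E3)) (g : L2) : Prop :=
  ∂^{fun j => basisVec (α j)} (φ : 𝓢'(E3, ℂ)) = (g : 𝓢'(E3, ℂ))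

/-- The homogeneous Sobolev space `Ḣ¹(ℝ³)`: the functions `φ` with `∇φ ∈ L²`, where additive
constants are fixed by `φ ∈ L⁶` (the completion of `C₀^∞` in the norm `‖∇φ‖_{L²}`). -/
def HDot1 : Submodule ℂ L6 where
  carrier := {φ | ∀ i : Fin 3, ∃ g : L2, ∂_{basisVec i} (φ : 𝓢'(E3, ℂ)) = (g : 𝓢'(E3, ℂ))}
  add_mem' := by
    intro a b ha hb i
    obtain ⟨g, hg⟩ := ha i
    obtain ⟨h, hh⟩ := hb i
    refine ⟨g + h, ?_⟩
    rw [← Lp.toTemperedDistributionCLM_apply (a + b), ← Lp.toTemperedDistributionCLM_apply (g + h),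
      map_add, map_add, LineDeriv.lineDerivOp_add]
    simp only [Lp.toTemperedDistributionCLM_apply, hg, hh]
  zero_mem' := by
    intro i
    refine ⟨0, ?_⟩
    rw [← Lp.toTemperedDistributionCLM_apply (0 : L6), ← Lp.toTemperedDistributionCLM_apply (0 : L2),
      map_zero, map_zero, LineDeriv.lineDerivOp_zero]
  smul_mem' := by
    intro c a ha i
    obtain ⟨g, hg⟩ := ha i
    refine ⟨c • g, ?_⟩
    rw [← Lp.toTemperedDistributionCLM_apply (c • a), ← Lp.toTemperedDistributionCLM_apply (c • g),
      map_smul, map_smul, LineDeriv.lineDerivOp_smul]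
    simp only [Lp.toTemperedDistributionCLM_apply, hg]

/-- The weak partial derivative `∂ᵢφ ∈ L²` of `φ ∈ Ḣ¹`. -/
def weakPartial (φ : HDot1) (i : Fin 3) : L2 := (φ.2 i).choose

theorem weakPartial_spec (φ : HDot1) (i : Fin 3) :
    ∂_{basisVec i} ((φ : L6) : 𝓢'(E3, ℂ)) = (weakPartial φ i : 𝓢'(E3, ℂ)) :=
  (φ.2 i).choose_spec

/-- The energy norm, `E(φ, ψ)² = ∫ |∇φ|² + |ψ|²`. -/
def energy (φ : HDot1) (ψ : L2) : ℝ :=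
  Real.sqrt (∑ i : Fin 3, ‖weakPartial φ i‖ ^ 2 + ‖ψ‖ ^ 2)

/-- `u` is smooth up to `t = 0`, `(∂ₜ² - Δ)u = f` in `(0,∞) × ℝ³`, and
`(u, ∂ₜu) = (φ, ψ)` at `t = 0`. -/
structure IsSmoothWave (φ ψ : E3 → ℂ) (f u : ℝ × E3 → ℂ) : Prop where
  smooth : ContDiff ℝ ∞ u
  wave : ∀ t : ℝ, 0 < t → ∀ z : E3,
    iteratedDeriv 2 (fun τ => u (τ, z)) t - (Δ (fun y : E3 => u (t, y))) z = f (t, z)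
  init : ∀ z : E3, u (0, z) = φ z
  init_deriv : ∀ z : E3, deriv (fun τ => u (τ, z)) 0 = ψ z

/-- `G` is Friedlander's forward radiation field of the solution `u`: with `x = 1/|z|` and
`v₊(x, s, θ) = x⁻¹ u(s + 1/x, θ/x)`, the boundary value `v₀ = v₊(0, ·, ·)` exists and
`G = ∂ₛ v₀`. Here `r = 1/x → ∞`. -/
def IsSmoothRadiationField (u : ℝ × E3 → ℂ) (G : ℝ × S2 → ℂ) : Prop :=
  ∃ v₀ : ℝ → S2 → ℂ,
    (∀ (s : ℝ) (θ : S2),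
      Tendsto (fun r : ℝ => (r : ℂ) * u (s + r, r • (θ : E3))) atTop (𝓝 (v₀ s θ))) ∧
    ∀ (s : ℝ) (θ : S2), HasDerivAt (fun σ => v₀ σ θ) (G (s, θ)) s

/-- `G = 𝓡₊(φ, ψ, f)` for `φ, ψ ∈ C₀^∞(ℝ³)`, `f ∈ C₀^∞(ℝ × ℝ³)` (as elements of `Ḣ¹`, `L²`,
`L¹L²`, `L²(ℝ × 𝕊²)`), defined through the smooth solution of the wave equation. -/
def IsTestRadiationField (φ : HDot1) (ψ : L2) (f : L1L2) (G : L2Cyl) : Prop :=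
  ∃ (φ' ψ' : E3 → ℂ) (f' u : ℝ × E3 → ℂ) (G' : ℝ × S2 → ℂ),
    (ContDiff ℝ ∞ φ' ∧ HasCompactSupport φ') ∧ (ContDiff ℝ ∞ ψ' ∧ HasCompactSupport ψ') ∧
    (ContDiff ℝ ∞ f' ∧ HasCompactSupport f') ∧
    ((φ : L6) : E3 → ℂ) =ᵐ[volume] φ' ∧
    (ψ : E3 → ℂ) =ᵐ[volume] ψ' ∧
    (∀ᵐ t : ℝ, (f t : E3 → ℂ) =ᵐ[volume] fun z => f' (t, z)) ∧
    (G : ℝ × S2 → ℂ) =ᵐ[cylMeasure] G' ∧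
    IsSmoothWave φ' ψ' f' u ∧ IsSmoothRadiationField u G'

/-- `(φₙ, ψₙ, fₙ)` is a sequence of test data with radiation fields `Gₙ` that converges to
`(φ, ψ, f)` in `Ḣ¹ × L² × L¹(ℝ; L²)`. -/
structure IsApproximation (φ : HDot1) (ψ : L2) (f : L1L2)
    (φn : ℕ → HDot1) (ψn : ℕ → L2) (fn : ℕ → L1L2) (Gn : ℕ → L2Cyl) : Prop where
  test : ∀ n, IsTestRadiationField (φn n) (ψn n) (fn n) (Gn n)
  tendsto_data : Tendsto (fun n => energy (φn n - φ) (ψn n - ψ)) atTop (𝓝 0)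
  tendsto_force : Tendsto fn atTop (𝓝 f)

/-- `G = 𝓡₊(φ, ψ, f)`, where `𝓡₊ : Ḣ¹ × L² × L¹(ℝ; L²) → L²(ℝ × 𝕊²)` is the continuous extension
of the radiation field from test data: approximating test data exist, and along all of them the
radiation fields converge to `G`. -/
def IsRadiationField (φ : HDot1) (ψ : L2) (f : L1L2) (G : L2Cyl) : Prop :=
  (∃ φn ψn fn Gn, IsApproximation φ ψ f φn ψn fn Gn) ∧
  ∀ φn ψn fn Gn, IsApproximation φ ψ f φn ψn fn Gn → Tendsto Gn atTop (𝓝 G)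

/-- `Hᵏ(ℝ³)`: all weak derivatives of order at most `k` are in `L²`. -/
def MemH (k : ℕ) (ψ : L2) : Prop :=
  ∀ n ≤ k, ∀ α : Fin n → Fin 3, ∃ g : L2, IsWeakDeriv α ψ g

/-- `H̃ᵏ(ℝ³)`, for `k ≥ 1`: all weak derivatives of order between `1` and `k` are in `L²`. -/
def MemHTilde (k : ℕ) (φ : HDot1) : Prop :=
  ∀ n, 1 ≤ n → n ≤ k → ∀ α : Fin n → Fin 3, ∃ g : L2, IsWeakDeriv α (φ : L6) g

/-- `f ∈ L¹(ℝ; Hᵏ(ℝ³))`: the weak space derivatives of `f(t)` of order at most `k` are in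
`L¹(ℝ; L²)`. -/
def MemL1H (k : ℕ) (f : L1L2) : Prop :=
  ∀ n ≤ k, ∀ α : Fin n → Fin 3, ∃ g : L1L2, ∀ᵐ t : ℝ, IsWeakDeriv α (f t) (g t)

/-- A function on `ℝ³` (up to null sets) is radial if it depends on `|z|` only. -/
def IsRadial (g : E3 → ℂ) : Prop :=
  ∃ h : ℝ → ℂ, g =ᵐ[volume] fun z => h ‖z‖

end RadiationField

end

noncomputable section

namespace RadiationField

section ParametricIntegrals

/-! ### Parametric integrals and rotations of the sphere -/

section Parametric

variable {E P F K : Type} [NormedAddCommGroup E] [NormedSpace ℝ E]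
  [NormedAddCommGroup P] [NormedSpace ℝ P]
  [NormedAddCommGroup F] [NormedSpace ℝ F]
  [TopologicalSpace K] [CompactSpace K] [SecondCountableTopology K]
  [MeasurableSpace K] [OpensMeasurableSpace K]

/-! Everything rests on one identity for test data. For ε = ±1 put Z_ε = 𝓕ψ + iε2π|ξ|𝓕φ + F_ε, where
F_ε = ∫_0^∞ e^{-iε2π|ξ|t} 𝓕f(t) dt. Then 4‖𝓡₊(φ,ψ,f)‖² = ‖Z₁‖² + ‖Z₋₁‖²
(`IsSmoothWave.integral_norm_sq_radiationField`, restated for L² classes in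
`IsTestRadiationField.exists_schwartz`).

The identity comes from the half waves ∂ₜ𝓕u ± i2π|ξ|𝓕u, which evolve by a phase and Duhamel's
integral; finite propagation speed, read off Kirchhoff's formula, makes their Fourier transforms
legitimate. After the forcing has stopped at time T, u(t,z) is a superposition over w ∈ 𝕊² of plane
waves p(t - T + z·w, w). Far out along the ray in direction θ the sphere integral concentrates at w
= -θ, by Archimedes' theorem on the axial projection of the sphere, and the radiation field is -2π
p(s - T, -θ). Plancherel on each line through the origin and polar coordinates give half the energy
at time T as its squared norm, and the parallelogram law splits this energy into Z₁ and Z₋₁.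

The identity passes to limits of test data. Among these, 𝓡₊ = 0 holds exactly when Z₁ = Z₋₁ = 0,
that is when 𝓕ψ = -½(F₁ + F₋₁) and i2π|ξ|𝓕φ = -½(F₁ - F₋₁). So f determines the data; ‖F_ε‖ ≤ ‖f‖
and the parallelogram law bound the energy; and F_ε commutes with multiplication by the symbols of
derivatives, which gives the regularity. The extension 𝓡₊ is never constructed: only its zero set
matters, and there the identity alone forces convergence of the fields along every approximating
sequence.

For existence, a test forcing has an advanced potential, the average of f over forward light cones,
which vanishes for large times. Cut off in the past it has compact support in space-time, so its
radiation field is zero, and its traces at t = 0 are test data, rotation invariant if f is. Test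
forcings are dense in L¹(ℝ;L²), the radial ones among the radial f. The formulas above make ψ and ∇φ
converge, and the Gagliardo-Nirenberg-Sobolev inequality supplies the limit of φ in L⁶. -/

omit [NormedSpace ℝ F] in
theorem integrable_of_continuous_of_compactSpace {μ : Measure K} [IsFiniteMeasure μ] {f : K → F}
    (hf : Continuous f) : Integrable f μ := by
  obtain ⟨C, hC⟩ := isCompact_univ.exists_bound_of_continuousOn hf.continuousOn
  exact Integrable.of_bound hf.aestronglyMeasurable C (.of_forall fun x => hC x (Set.mem_univ x))

/-- Differentiation of a smooth integrand under an integral over a compact space. -/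
theorem hasFDerivAt_integral_of_contDiff [FiniteDimensional ℝ E] (μ : Measure K) [IsFiniteMeasure μ]
    {k : K → P} (hk : Continuous k) {G : E × P → F} (hG : ContDiff ℝ 1 G) (x₀ : E) :
    HasFDerivAt (fun x => ∫ a, G (x, k a) ∂μ)
      (∫ a, (fderiv ℝ G (x₀, k a)).comp (ContinuousLinearMap.inl ℝ E P) ∂μ) x₀ := by
  have hG' : Continuous (fderiv ℝ G) := hG.continuous_fderiv (by simp)
  have hcont : Continuous fun q : E × K =>
      (fderiv ℝ G (q.1, k q.2)).comp (ContinuousLinearMap.inl ℝ E P) := by fun_prop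
  have hK : IsCompact (Metric.closedBall x₀ 1 ×ˢ (Set.univ : Set K)) :=
    (isCompact_closedBall x₀ 1).prod isCompact_univ
  obtain ⟨C, hC⟩ := hK.exists_bound_of_continuousOn hcont.continuousOn
  have hGc := hG.continuous
  refine hasFDerivAt_integral_of_dominated_of_fderiv_le (s := Metric.closedBall x₀ 1)
    (bound := fun _ => C) (F' := fun x a => (fderiv ℝ G (x, k a)).comp
      (ContinuousLinearMap.inl ℝ E P)) (Metric.closedBall_mem_nhds x₀ one_pos)
    (.of_forall fun x => Continuous.aestronglyMeasurable (by fun_prop))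
    (integrable_of_continuous_of_compactSpace (by fun_prop))
    (Continuous.aestronglyMeasurable (by fun_prop))
    (.of_forall fun a x hx => hC (x, a) ⟨hx, Set.mem_univ a⟩)
    (integrable_const C) (.of_forall fun a x _ => ?_)
  have h1 : HasFDerivAt G (fderiv ℝ G (x, k a)) (x, k a) :=
    (hG.differentiable (by simp) _).hasFDerivAt
  exact h1.comp x (hasFDerivAt_prodMk_left x (k a))

theorem contDiff_integral_of_contDiff [FiniteDimensional ℝ E] (μ : Measure K) [IsFiniteMeasure μ]
    {k : K → P} (hk : Continuous k) {G : E × P → F} (hG : ContDiff ℝ ∞ G) :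
    ContDiff ℝ ∞ (fun x => ∫ a, G (x, k a) ∂μ) := by
  -- The codomain must vary in the induction: the derivative is again an integral of the same form,
  -- but with values in `E →L[ℝ] F`.
  have key : ∀ (n : ℕ) (F : Type) [NormedAddCommGroup F] [NormedSpace ℝ F] (G : E × P → F),
      ContDiff ℝ ∞ G → ContDiff ℝ n (fun x => ∫ a, G (x, k a) ∂μ) := by
    intro n
    induction n with
    | zero =>
      intro F _ _ G hG
      refine contDiff_zero.2 (continuous_iff_continuousAt.2 fun x => ?_)
      exact (hasFDerivAt_integral_of_contDiff μ hk (hG.of_le (by simp)) x).continuousAt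
    | succ n ih =>
      intro F _ _ G hG
      have h1 : ContDiff ℝ 1 G := hG.of_le (by simp)
      have hd := hasFDerivAt_integral_of_contDiff μ hk h1
      push_cast
      rw [contDiff_succ_iff_fderiv]
      refine ⟨fun x => (hd x).differentiableAt, by simp, ?_⟩
      rw [show fderiv ℝ (fun x => ∫ a, G (x, k a) ∂μ) = _ from funext fun x => (hd x).fderiv]
      refine ih _ (fun q => (fderiv ℝ G q).comp (ContinuousLinearMap.inl ℝ E P)) ?_
      exact (hG.fderiv_right (by simp)).clm_comp contDiff_const
  exact contDiff_infty.2 fun n => key n F G hG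

/-- One-variable form of differentiation under the integral sign. -/
theorem hasDerivAt_integral_of_contDiff (μ : Measure K) [IsFiniteMeasure μ]
    {k : K → P} (hk : Continuous k) {G : ℝ × P → F} (hG : ContDiff ℝ 1 G) (x₀ : ℝ) :
    HasDerivAt (fun x => ∫ a, G (x, k a) ∂μ) (∫ a, fderiv ℝ G (x₀, k a) (1, 0) ∂μ) x₀ := by
  have h := (hasFDerivAt_integral_of_contDiff μ hk hG x₀).hasDerivAt
  have hG' : Continuous (fderiv ℝ G) := hG.continuous_fderiv (by simp)
  rw [ContinuousLinearMap.integral_apply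
    (integrable_of_continuous_of_compactSpace (by fun_prop))] at h
  simpa using h

end Parametric

/-- The surface measure on `𝕊²`. -/
abbrev sphereMeasure : Measure S2 := (volume : Measure E3).toSphere

-- By definition the surface measure of `s` is three times the volume of the cone over `s`, and a
-- linear isometry carries cones to cones and preserves volume.
open scoped Pointwise in
theorem map_sphere_toSphere (L : E3 ≃ₗᵢ[ℝ] E3) :
    MeasurePreserving (fun w : S2 => (⟨L w, by simp⟩ : S2)) sphereMeasure sphereMeasure := by
  have hm : Measurable (fun w : S2 => (⟨L w, by simp⟩ : S2)) := by
    refine Measurable.subtype_mk ?_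
    exact (L.continuous.comp continuous_subtype_val).measurable
  refine ⟨hm, Measure.ext fun s hs => ?_⟩
  rw [Measure.map_apply hm hs, Measure.toSphere_apply' _ (hm hs), Measure.toSphere_apply' _ hs]
  congr 1
  have : (Set.Ioo (0 : ℝ) 1 • ((↑) '' s) : Set E3) = L '' (Set.Ioo (0 : ℝ) 1 •
      ((↑) '' ((fun w : S2 => (⟨L w, by simp⟩ : S2)) ⁻¹' s) : Set E3)) := by
    ext x
    simp only [Set.mem_smul, Set.mem_image, Set.mem_preimage]
    constructor
    · rintro ⟨r, hr, _, ⟨w, hw, rfl⟩, rfl⟩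
      refine ⟨r • L.symm w, ⟨r, hr, L.symm w, ⟨⟨L.symm w, by simp⟩, by simpa using hw, rfl⟩, rfl⟩,
        by simp⟩
    · rintro ⟨_, ⟨r, hr, _, ⟨w, hw, rfl⟩, rfl⟩, rfl⟩
      exact ⟨r, hr, L w, ⟨_, hw, rfl⟩, by simp⟩
  rw [this]
  exact (congrArg volume (Set.preimage_image_eq _ L.injective)).symm.trans
    (L.measurePreserving.measure_preimage_equiv (f := L.toHomeomorph.toMeasurableEquiv) _)

theorem integral_sphere_comp {F : Type} [NormedAddCommGroup F] [NormedSpace ℝ F]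
    (L : E3 ≃ₗᵢ[ℝ] E3) (g : E3 → F) :
    ∫ w : S2, g (L w) ∂sphereMeasure = ∫ w : S2, g w ∂sphereMeasure := by
  have hme : MeasurableEmbedding (fun w : S2 => (⟨L w, by simp⟩ : S2)) := by
    let e : S2 ≃ S2 := ⟨fun w => ⟨L w, by simp⟩, fun w => ⟨L.symm w, by simp⟩,
      fun w => by simp, fun w => by simp⟩
    exact MeasurableEquiv.measurableEmbedding
      ⟨e, (map_sphere_toSphere L).measurable, (map_sphere_toSphere L.symm).measurable⟩
  exact (map_sphere_toSphere L).integral_comp hme (fun w : S2 => g w)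

/-- The infinitesimal rotation `e_i ↦ e_j`, `e_j ↦ -e_i`. -/
def rotGen (i j : Fin 3) : E3 →L[ℝ] E3 :=
  (EuclideanSpace.proj i : E3 →L[ℝ] ℝ).smulRight (basisVec j) -
    (EuclideanSpace.proj j : E3 →L[ℝ] ℝ).smulRight (basisVec i)

/-- The projection onto the plane spanned by `e_i` and `e_j`. -/
def planeProj (i j : Fin 3) : E3 →L[ℝ] E3 :=
  (EuclideanSpace.proj i : E3 →L[ℝ] ℝ).smulRight (basisVec i) +
    (EuclideanSpace.proj j : E3 →L[ℝ] ℝ).smulRight (basisVec j)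

theorem norm_rotation {i j : Fin 3} (hij : i ≠ j) (ε : ℝ) (x : E3) :
    ‖x + (Real.cos ε - 1) • planeProj i j x + Real.sin ε • rotGen i j x‖ = ‖x‖ := by
  have h := Real.sin_sq_add_cos_sq ε
  rw [EuclideanSpace.norm_eq, EuclideanSpace.norm_eq]
  congr 1
  simp only [Fin.sum_univ_three, Real.norm_eq_abs, sq_abs]
  fin_cases i <;> fin_cases j <;> simp [rotGen, planeProj, basisVec] at hij ⊢ <;>
    · rw [Real.sin_sq] at h
      ring_nf
      simp only [Real.sin_sq]
      ring

/-- The rotation by the angle `ε` in the plane spanned by `e_i` and `e_j`. -/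
def rotation {i j : Fin 3} (hij : i ≠ j) (ε : ℝ) : E3 ≃ₗᵢ[ℝ] E3 :=
  LinearIsometry.toLinearIsometryEquiv
    { toLinearMap := (ContinuousLinearMap.id ℝ E3 + (Real.cos ε - 1) • planeProj i j +
        Real.sin ε • rotGen i j : E3 →L[ℝ] E3).toLinearMap
      norm_map' := norm_rotation hij ε } rfl

/-- The integral over the sphere does not change when `h` is composed with the rotation by the angle
ε; differentiate at ε = 0. -/
theorem integral_fderiv_rotGen {i j : Fin 3} (hij : i ≠ j) {h : E3 → ℂ} (hh : ContDiff ℝ 1 h) :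
    ∫ w : S2, fderiv ℝ h w (rotGen i j w) ∂sphereMeasure = 0 := by
  have hG : ContDiff ℝ 1 (fun q : ℝ × E3 =>
      h (q.2 + (Real.cos q.1 - 1) • planeProj i j q.2 + Real.sin q.1 • rotGen i j q.2)) := by
    refine hh.comp ?_
    fun_prop
  have h1 := hasDerivAt_integral_of_contDiff sphereMeasure (k := fun w : S2 => (w : E3))
    continuous_subtype_val hG 0
  have h2 : (fun x : ℝ => ∫ w : S2, h ((w : E3) + (Real.cos x - 1) • planeProj i j w +
      Real.sin x • rotGen i j w) ∂sphereMeasure) = fun _ => ∫ w : S2, h w ∂sphereMeasure := by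
    funext x
    exact integral_sphere_comp (rotation hij x) h
  simp only at h1
  rw [h2] at h1
  have h3 := h1.unique (hasDerivAt_const 0 _)
  rw [← h3]
  congr 1
  funext w
  have hd : HasDerivAt (fun x : ℝ => (w : E3) + (Real.cos x - 1) • planeProj i j w +
      Real.sin x • rotGen i j w) (rotGen i j w) 0 := by
    have ha := ((Real.hasDerivAt_cos 0).sub_const 1).smul_const (planeProj i j (w : E3))
    have hb := (Real.hasDerivAt_sin 0).smul_const (rotGen i j (w : E3))
    exact ((ha.const_add (w : E3)).add hb).congr_deriv (by simp)
  have hd2 := (hG.differentiable (by simp) ((0 : ℝ), (w : E3))).hasFDerivAt.comp_hasDerivAt (0 : ℝ)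
    ((hasDerivAt_id (0 : ℝ)).prodMk (hasDerivAt_const (0 : ℝ) (w : E3)))
  have hx0 : (w : E3) = (w : E3) + (Real.cos 0 - 1) • planeProj i j w +
      Real.sin 0 • rotGen i j w := by simp
  have hd3 := (hh.differentiable (by simp) ((w : E3) + (Real.cos 0 - 1) • planeProj i j w +
      Real.sin 0 • rotGen i j w)).hasFDerivAt.comp_hasDerivAt (0 : ℝ) hd
  rw [← hx0] at hd3
  exact hd3.unique hd2

theorem sum_basisVec (x : E3) : x = ∑ i, x i • basisVec i := by
  ext j
  simp [basisVec, Finset.sum_apply, Pi.single_apply]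

/-- Integral form of the decomposition of the Laplacian into radial and angular derivatives. -/
theorem integral_sphere_laplacian {h : E3 → ℂ} (hh : ContDiff ℝ 2 h) :
    ∫ w : S2, (2 * fderiv ℝ h w w + fderiv ℝ (fderiv ℝ h) w w w) ∂sphereMeasure =
      ∫ w : S2, ∑ i, fderiv ℝ (fderiv ℝ h) w (basisVec i) (basisVec i) ∂sphereMeasure := by
  have hd1 : ContDiff ℝ 1 (fderiv ℝ h) := hh.fderiv_right (by norm_num)
  have hc1 : Continuous (fderiv ℝ h) := hd1.continuous
  have hc2 : Continuous (fderiv ℝ (fderiv ℝ h)) := hd1.continuous_fderiv (by simp)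
  -- The second rotation derivative of `h` also integrates to zero: apply `integral_fderiv_rotGen`
  -- to the first one.
  have key : ∀ i j : Fin 3, i ≠ j → ∫ w : S2, (fderiv ℝ (fderiv ℝ h) w (rotGen i j w) (rotGen i j w)
      + fderiv ℝ h w (rotGen i j (rotGen i j w))) ∂sphereMeasure = 0 := by
    intro i j hij
    rw [← integral_fderiv_rotGen hij (h := fun x => fderiv ℝ h x (rotGen i j x))
      (hd1.clm_apply (rotGen i j).contDiff)]
    congr 1
    funext w
    have h1 : HasFDerivAt (fderiv ℝ h) (fderiv ℝ (fderiv ℝ h) w) w :=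
      (hd1.differentiable (by simp) _).hasFDerivAt
    rw [(h1.clm_apply (rotGen i j).hasFDerivAt).fderiv]
    simp [add_comm]
  have e1 := key 0 1 (by decide)
  have e2 := key 1 2 (by decide)
  have e3 := key 2 0 (by decide)
  have hi : ∀ i j : Fin 3, Integrable (fun w : S2 => fderiv ℝ (fderiv ℝ h) w (rotGen i j w)
      (rotGen i j w) + fderiv ℝ h w (rotGen i j (rotGen i j w))) sphereMeasure := fun i j =>
    integrable_of_continuous_of_compactSpace (by fun_prop)
  -- The sum of the three squared rotation derivatives is the spherical Laplacian.
  have e4 : ∫ w : S2, ((fderiv ℝ (fderiv ℝ h) w (rotGen 0 1 w) (rotGen 0 1 w)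
      + fderiv ℝ h w (rotGen 0 1 (rotGen 0 1 w))) + (fderiv ℝ (fderiv ℝ h) w (rotGen 1 2 w)
      (rotGen 1 2 w) + fderiv ℝ h w (rotGen 1 2 (rotGen 1 2 w))) + (fderiv ℝ (fderiv ℝ h) w
      (rotGen 2 0 w) (rotGen 2 0 w) + fderiv ℝ h w (rotGen 2 0 (rotGen 2 0 w))))
      ∂sphereMeasure = 0 := by
    have := integral_add ((hi 0 1).add (hi 1 2)) (hi 2 0)
    have h' := integral_add (hi 0 1) (hi 1 2)
    simp only [Pi.add_apply] at this h'
    rw [this, h', e1, e2, e3]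
    simp
  rw [eq_comm, ← sub_eq_zero, ← integral_sub
    (integrable_of_continuous_of_compactSpace (by fun_prop))
    (integrable_of_continuous_of_compactSpace (by fun_prop)), ← e4]
  congr 1
  funext w
  have hn : ((w : E3) 0) ^ 2 + ((w : E3) 1) ^ 2 + ((w : E3) 2) ^ 2 = 1 := by
    have := EuclideanSpace.norm_sq_eq (w : E3)
    simpa [Fin.sum_univ_three] using this.symm
  have hw : (w : E3) = (w : E3) 0 • basisVec 0 + (w : E3) 1 • basisVec 1 +
      (w : E3) 2 • basisVec 2 := by
    conv_lhs => rw [sum_basisVec (w : E3), Fin.sum_univ_three]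
  generalize fderiv ℝ (fderiv ℝ h) w = B
  generalize fderiv ℝ h w = A
  generalize (w : E3) = x at *
  have hnc : ((x 0 : ℝ) : ℂ) ^ 2 + ((x 1 : ℝ) : ℂ) ^ 2 + ((x 2 : ℝ) : ℂ) ^ 2 = 1 := by
    have := congrArg (fun t : ℝ => (t : ℂ)) hn
    push_cast at this
    exact this
  have hr : ∀ i j, rotGen i j x = x i • basisVec j - x j • basisVec i := fun i j => by
    simp [rotGen]
  have hrb : ∀ i j k, rotGen i j (basisVec k) =
      (if i = k then (1 : ℝ) else 0) • basisVec j - (if j = k then (1 : ℝ) else 0) • basisVec i := by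
    intro i j k
    simp [rotGen, basisVec]
  have hB : B x x = B (x 0 • basisVec 0 + x 1 • basisVec 1 + x 2 • basisVec 2)
    (x 0 • basisVec 0 + x 1 • basisVec 1 + x 2 • basisVec 2) := by rw [← hw]
  have hA : A x = A (x 0 • basisVec 0 + x 1 • basisVec 1 + x 2 • basisVec 2) := by rw [← hw]
  rw [hB, hA]
  simp only [hr, map_sub, map_smul, hrb, map_add, _root_.add_apply,
    _root_.sub_apply, _root_.smul_apply, Complex.real_smul,
    Fin.sum_univ_three, smul_add, smul_sub]
  simp
  -- At any point x the squared rotation derivatives add up to |x|²Δh - D²h(x,x) - 2Dh(x); on the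
  -- sphere |x|² = 1.
  linear_combination (-(B (basisVec 0) (basisVec 0)) - B (basisVec 1) (basisVec 1) -
    B (basisVec 2) (basisVec 2)) * hnc

end ParametricIntegrals

section Archimedes

/-! ### Moments of the surface measure -/

theorem sphereMeasure_real_univ : sphereMeasure.real Set.univ = 4 * Real.pi := by
  rw [Measure.toSphere_real_apply_univ]
  simp [Measure.real, EuclideanSpace.volume_ball_fin_three]
  rw [ENNReal.toReal_ofReal (by positivity)]
  ring

/-- With ℓ(x) = θ·x, `integral_sphere_laplacian` applied to ℓⁿ compares the radial part n(n+1)ℓⁿ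
with the Laplacian n(n-1)ℓⁿ⁻². This is a two-step recursion for the moments, started by the total
area 4π and the vanishing first moment. -/
theorem integral_sphere_inner_pow (θ : S2) (n : ℕ) :
    ∫ w : S2, ((inner ℝ (θ : E3) (w : E3) : ℝ) : ℂ) ^ n ∂sphereMeasure =
      2 * Real.pi * ∫ x in (-1 : ℝ)..1, (x : ℂ) ^ n := by
  set ℓ : E3 →L[ℝ] ℂ := Complex.ofRealCLM.comp (innerSL ℝ (θ : E3)) with hℓ
  have hℓa : ∀ x, ℓ x = ((inner ℝ (θ : E3) x : ℝ) : ℂ) := fun x => rfl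
  have hsum : ∑ i, ℓ (basisVec i) * ℓ (basisVec i) = 1 := by
    have h1 : ∀ i, ℓ (basisVec i) = (((θ : E3) i : ℝ) : ℂ) := fun i => by
      rw [hℓa]
      simp [basisVec, EuclideanSpace.inner_single_right]
    have := EuclideanSpace.norm_sq_eq (θ : E3)
    simp only [norm_eq_of_mem_sphere, Real.norm_eq_abs, sq_abs] at this
    simp only [h1, ← pow_two]
    have h2 := congrArg (fun t : ℝ => (t : ℂ)) this
    push_cast at h2
    simpa using h2.symm
  have hrec : ∀ n : ℕ, ((n : ℂ) * 2 + n * (n - 1 : ℕ)) * ∫ w : S2, ℓ w ^ n ∂sphereMeasure =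
      (n * (n - 1 : ℕ)) * ∫ w : S2, ℓ w ^ (n - 2) ∂sphereMeasure := by
    intro n
    have h1 : ∀ x : E3, HasFDerivAt (fun x => ℓ x ^ n) ((n * ℓ x ^ (n - 1)) • ℓ) x := fun x => by
      simpa using ℓ.hasFDerivAt.pow n (x := x)
    have h2 : ∀ x : E3, HasFDerivAt (fun x => ((n : ℂ) * ℓ x ^ (n - 1)) • ℓ)
        ((((n : ℂ) * ((n - 1 : ℕ) * ℓ x ^ (n - 2))) • ℓ).smulRight ℓ) x := fun x => by
      have := ((ℓ.hasFDerivAt.pow (n - 1) (x := x)).const_mul (n : ℂ)).smul_const ℓ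
      simpa [Nat.sub_sub, smul_smul] using this
    have h := integral_sphere_laplacian (h := fun x => ℓ x ^ n) (ℓ.contDiff.pow n)
    have hf : fderiv ℝ (fun x => ℓ x ^ n) = fun x => (n * ℓ x ^ (n - 1)) • ℓ :=
      funext fun x => (h1 x).fderiv
    simp only [hf, fun x => (h2 x).fderiv] at h
    rw [← integral_const_mul, ← integral_const_mul]
    refine Eq.trans (integral_congr_ae (.of_forall fun w => ?_))
      (h.trans (integral_congr_ae (.of_forall fun w => ?_)))
    · rcases n with _ | _ | n
      · simp
      · simp
      · simp
        ring
    · simp only [ContinuousLinearMap.smulRight_apply, _root_.smul_apply, smul_eq_mul]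
      rw [Finset.sum_congr rfl (fun i _ => show _ = (n : ℂ) * ((n - 1 : ℕ) * ℓ w ^ (n - 2)) *
        (ℓ (basisVec i) * ℓ (basisVec i)) by ring), ← Finset.mul_sum, hsum]
      ring
  simp only [← hℓa]
  have hI : ∀ n : ℕ, ∫ x in (-1 : ℝ)..1, (x : ℂ) ^ n = (1 - (-1) ^ (n + 1)) / (n + 1) := by
    intro n
    have : ∀ x : ℝ, (x : ℂ) ^ n = ((x ^ n : ℝ) : ℂ) := fun x => by push_cast; rfl
    simp only [this]
    rw [intervalIntegral.integral_ofReal, integral_pow]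
    push_cast
    simp
  rw [hI]
  induction n using Nat.twoStepInduction with
  | zero =>
    simp only [pow_zero, integral_const, sphereMeasure_real_univ]
    simp
    ring
  | one =>
    have := hrec 1
    simp at this
    simp [this]
  | more n ih _ =>
    have := hrec (n + 2)
    simp only [Nat.add_sub_cancel, show n + 2 - 1 = n + 1 by rfl] at this
    rw [ih] at this
    have hn1 : (n : ℂ) + 1 ≠ 0 := by exact_mod_cast Nat.succ_ne_zero n
    have hn2 : (n : ℂ) + 2 ≠ 0 := by exact_mod_cast Nat.succ_ne_zero (n + 1)
    have hn3 : (n : ℂ) + 3 ≠ 0 := by exact_mod_cast Nat.succ_ne_zero (n + 2)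
    push_cast at this ⊢
    have h3 : ((n : ℂ) + 2) * (n + 3) * ∫ w : S2, ℓ w ^ (n + 2) ∂sphereMeasure =
        (n + 2) * (2 * Real.pi * (1 - (-1) ^ (n + 1))) := by
      rw [show ((n : ℂ) + 2) * (n + 3) = ((n : ℂ) + 2) * 2 + (n + 2) * (n + 1) by ring, this]
      field_simp
    have h4 : ((n : ℂ) + 3) * ∫ w : S2, ℓ w ^ (n + 2) ∂sphereMeasure =
        (2 * Real.pi * (1 - (-1) ^ (n + 1))) := mul_left_cancel₀ hn2 (by linear_combination h3)
    rw [show (n : ℂ) + 2 + 1 = n + 3 by ring, eq_comm, ← mul_div_assoc, div_eq_iff hn3,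
      mul_comm _ ((n : ℂ) + 3), h4, pow_succ _ (n + 2), pow_succ _ (n + 1)]
    ring

/-- Archimedes: the axial projection of the surface measure is uniform. -/
theorem map_inner_sphereMeasure (θ : S2) :
    sphereMeasure.map (fun w : S2 => (inner ℝ (θ : E3) (w : E3) : ℝ)) =
      ENNReal.ofReal (2 * Real.pi) • volume.restrict (Set.Ioc (-1 : ℝ) 1) := by
  have hpi := Real.pi_pos
  have hc : Continuous fun w : S2 => (inner ℝ (θ : E3) (w : E3) : ℝ) := by fun_prop
  have : IsFiniteMeasure (sphereMeasure.map (fun w : S2 => (inner ℝ (θ : E3) (w : E3) : ℝ))) :=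
    Measure.isFiniteMeasure_map _ _
  have hmem : ∀ w : S2, (inner ℝ (θ : E3) (w : E3) : ℝ) ∈ Set.Icc (-1 : ℝ) 1 := fun w => by
    have := abs_real_inner_le_norm (θ : E3) (w : E3)
    simpa [abs_le] using this
  have hpoly : ∀ p : Polynomial ℝ, ∫ w : S2, p.eval (inner ℝ (θ : E3) (w : E3) : ℝ) ∂sphereMeasure
      = 2 * Real.pi * ∫ x in (-1 : ℝ)..1, p.eval x := by
    intro p
    induction p using Polynomial.induction_on' with
    | add p q hp hq =>
      simp only [Polynomial.eval_add]
      rw [integral_add, intervalIntegral.integral_add, hp, hq]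
      · ring
      · exact (p.continuous).intervalIntegrable _ _
      · exact (q.continuous).intervalIntegrable _ _
      · exact integrable_of_continuous_of_compactSpace (p.continuous.comp hc)
      · exact integrable_of_continuous_of_compactSpace (q.continuous.comp hc)
    | monomial n a =>
      simp only [Polynomial.eval_monomial]
      rw [integral_const_mul, intervalIntegral.integral_const_mul]
      have h := integral_sphere_inner_pow θ n
      have e1 : ∀ x : ℝ, (x : ℂ) ^ n = ((x ^ n : ℝ) : ℂ) := fun x => by push_cast; rfl
      simp only [e1] at h
      rw [intervalIntegral.integral_ofReal, integral_complex_ofReal] at h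
      have h' : ∫ w : S2, (inner ℝ (θ : E3) (w : E3) : ℝ) ^ n ∂sphereMeasure =
        2 * Real.pi * ∫ x in (-1 : ℝ)..1, x ^ n := by exact_mod_cast h
      rw [h']
      ring
  have hfin : IsFiniteMeasure (ENNReal.ofReal (2 * Real.pi) •
      volume.restrict (Set.Ioc (-1 : ℝ) 1)) := Measure.smul_finite _ ENNReal.ofReal_ne_top
  refine ext_of_forall_integral_eq_of_IsFiniteMeasure fun f => ?_
  rw [integral_map hc.aemeasurable f.continuous.aestronglyMeasurable, integral_smul_measure,
    ENNReal.toReal_ofReal (by positivity), ← intervalIntegral.integral_of_le (by norm_num)]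
  refine eq_of_forall_dist_le fun ε hε => ?_
  -- Both measures have total mass 4π, so an error of ε/(8π) in the integrand costs ε/2 on each
  -- side.
  obtain ⟨p, hp⟩ := exists_polynomial_near_of_continuousOn (-1) 1 f f.continuous.continuousOn
    (ε / (8 * Real.pi)) (by positivity)
  have h1 : ‖(∫ w : S2, f (inner ℝ (θ : E3) (w : E3) : ℝ) ∂sphereMeasure) -
      ∫ w : S2, p.eval (inner ℝ (θ : E3) (w : E3) : ℝ) ∂sphereMeasure‖ ≤ ε / 2 := by
    rw [← integral_sub (f := fun w : S2 => f (inner ℝ (θ : E3) (w : E3)))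
      (g := fun w : S2 => p.eval (inner ℝ (θ : E3) (w : E3)))
      (integrable_of_continuous_of_compactSpace (f.continuous.comp hc))
      (integrable_of_continuous_of_compactSpace (p.continuous.comp hc))]
    refine (norm_integral_le_of_norm_le_const (C := ε / (8 * Real.pi))
      (.of_forall fun w => ?_)).trans ?_
    · rw [norm_sub_rev]
      exact (hp _ (hmem w)).le
    · rw [sphereMeasure_real_univ]
      refine le_of_eq ?_
      field_simp
      norm_num
  have h2 : ‖(∫ x in (-1 : ℝ)..1, p.eval x) - ∫ x in (-1 : ℝ)..1, f x‖ ≤ ε / (8 * Real.pi) * 2 := by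
    rw [← intervalIntegral.integral_sub (p.continuous.intervalIntegrable _ _)
      (f.continuous.intervalIntegrable _ _)]
    refine (intervalIntegral.norm_integral_le_of_norm_le_const (C := ε / (8 * Real.pi))
      fun x hx => (hp x ?_).le).trans (le_of_eq ?_)
    · rw [Set.uIoc_of_le (by norm_num)] at hx
      exact ⟨hx.1.le, hx.2⟩
    · norm_num
  rw [hpoly] at h1
  rw [dist_eq_norm, smul_eq_mul]
  calc _ ≤ _ := norm_sub_le_norm_sub_add_norm_sub _
        (2 * Real.pi * ∫ x in (-1 : ℝ)..1, p.eval x) _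
    _ ≤ ε / 2 + 2 * Real.pi * (ε / (8 * Real.pi) * 2) := by
      refine add_le_add h1 ?_
      rw [← mul_sub, norm_mul, Real.norm_of_nonneg (by positivity)]
      exact mul_le_mul_of_nonneg_left h2 (by positivity)
    _ = ε := by
      field_simp
      norm_num

end Archimedes

section KirchhoffFormula

/-! ### Kirchhoff's formula and finite propagation speed -/

theorem two_le_infty : (2 : WithTop ℕ∞) ≤ ((⊤ : ℕ∞) : WithTop ℕ∞) :=
  WithTop.coe_le_coe.2 (le_top : (2 : ℕ∞) ≤ ⊤)

/-- The d'Alembertian `(∂ₜ² - Δ)u`, written with the second Fréchet derivative. -/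
def waveOp (u : ℝ × E3 → ℂ) (p : ℝ × E3) : ℂ :=
  fderiv ℝ (fderiv ℝ u) p (1, 0) (1, 0) -
    ∑ i, fderiv ℝ (fderiv ℝ u) p (0, basisVec i) (0, basisVec i)

/-- The Laplacian in the space variables, as a sum of second Fréchet derivatives. -/
theorem laplacian_slice {u : ℝ × E3 → ℂ} (hu : ContDiff ℝ 2 u) (t : ℝ) (z : E3) :
    (Δ (fun y : E3 => u (t, y))) z =
      ∑ i, fderiv ℝ (fderiv ℝ u) (t, z) (0, basisVec i) (0, basisVec i) := by
  have hd1 : ContDiff ℝ 1 (fderiv ℝ u) := hu.fderiv_right (by norm_num)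
  rw [InnerProductSpace.laplacian_eq_iteratedFDeriv_orthonormalBasis _ (EuclideanSpace.basisFun (Fin 3) ℝ)]
  refine Finset.sum_congr rfl fun i _ => ?_
  rw [iteratedFDeriv_two_apply]
  have hb : (EuclideanSpace.basisFun (Fin 3) ℝ) i = basisVec i := by simp [basisVec]
  simp only [Matrix.cons_val_zero, Matrix.cons_val_one, hb]
  have h1 : fderiv ℝ (fun y : E3 => u (t, y)) =
      fun y => (fderiv ℝ u (t, y)).comp (ContinuousLinearMap.inr ℝ ℝ E3) := funext fun y =>
    ((hu.differentiable (by simp) (t, y)).hasFDerivAt.comp y (hasFDerivAt_prodMk_right t y)).fderiv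
  rw [h1]
  have h2 : HasFDerivAt (fun y => fderiv ℝ u (t, y)) _ z :=
    (hd1.differentiable (by simp) (t, z)).hasFDerivAt.comp z (hasFDerivAt_prodMk_right t z)
  rw [(h2.clm_comp (hasFDerivAt_const _ _)).fderiv]
  simp

theorem hasDerivAt_time {u : ℝ × E3 → ℂ} (hu : ContDiff ℝ 1 u) (t : ℝ) (z : E3) :
    HasDerivAt (fun τ => u (τ, z)) (fderiv ℝ u (t, z) (1, 0)) t :=
  (hu.differentiable (by simp) (t, z)).hasFDerivAt.comp_hasDerivAt t
    ((hasDerivAt_id t).prodMk (hasDerivAt_const t z))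

theorem hasDerivAt_time_two {u : ℝ × E3 → ℂ} (hu : ContDiff ℝ 2 u) (t : ℝ) (z : E3) :
    HasDerivAt (fun τ => fderiv ℝ u (τ, z) (1, 0)) (fderiv ℝ (fderiv ℝ u) (t, z) (1, 0) (1, 0)) t := by
  have hd1 : ContDiff ℝ 1 (fderiv ℝ u) := hu.fderiv_right (by norm_num)
  have h1 : HasDerivAt (fun τ => fderiv ℝ u (τ, z)) _ t :=
    (hd1.differentiable (by simp) (t, z)).hasFDerivAt.comp_hasDerivAt t
      ((hasDerivAt_id t).prodMk (hasDerivAt_const t z))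
  simpa using h1.clm_apply (hasDerivAt_const t ((1 : ℝ), (0 : E3)))

theorem iteratedDeriv_two_time {u : ℝ × E3 → ℂ} (hu : ContDiff ℝ 2 u) (t : ℝ) (z : E3) :
    iteratedDeriv 2 (fun τ => u (τ, z)) t = fderiv ℝ (fderiv ℝ u) (t, z) (1, 0) (1, 0) := by
  rw [iteratedDeriv_succ, iteratedDeriv_one,
    funext fun τ => (hasDerivAt_time (hu.of_le (by norm_num)) τ z).deriv]
  exact (hasDerivAt_time_two hu t z).deriv

theorem waveOp_eq {u : ℝ × E3 → ℂ} (hu : ContDiff ℝ 2 u) (t : ℝ) (z : E3) :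
    iteratedDeriv 2 (fun τ => u (τ, z)) t - (Δ (fun y : E3 => u (t, y))) z = waveOp u (t, z) := by
  rw [iteratedDeriv_two_time hu, laplacian_slice hu, waveOp]

/-- The integrand of Kirchhoff's formula on the light cone with vertex `(t, z)`. -/
def coneIntegrand (u : ℝ × E3 → ℂ) (ε t : ℝ) (z : E3) (q : ℝ × E3) : ℂ :=
  u (t + ε * q.1, z + q.1 • q.2) + q.1 • fderiv ℝ u (t + ε * q.1, z + q.1 • q.2) (-ε, q.2)

/-- Kirchhoff's spherical integral. -/
def coneIntegral (u : ℝ × E3 → ℂ) (ε t : ℝ) (z : E3) (ρ : ℝ) : ℂ :=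
  ∫ w : S2, coneIntegrand u ε t z (ρ, w) ∂sphereMeasure

theorem contDiff_coneIntegrand {u : ℝ × E3 → ℂ} (hu : ContDiff ℝ ∞ u) (ε t : ℝ) (z : E3) :
    ContDiff ℝ ∞ (coneIntegrand u ε t z) := by
  have hd1 : ContDiff ℝ ∞ (fderiv ℝ u) := hu.fderiv_right (by simp)
  have hp : ContDiff ℝ ∞ fun q : ℝ × E3 => (t + ε * q.1, z + q.1 • q.2) := by fun_prop
  exact (hu.comp hp).add (contDiff_fst.smul ((hd1.comp hp).clm_apply
    (contDiff_const.prodMk contDiff_snd)))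

theorem continuous_waveOp {u : ℝ × E3 → ℂ} (hu : ContDiff ℝ ∞ u) : Continuous (waveOp u) := by
  have hd1 : ContDiff ℝ ∞ (fderiv ℝ u) := hu.fderiv_right (by simp)
  have hc2 : Continuous (fderiv ℝ (fderiv ℝ u)) := hd1.continuous_fderiv (by simp)
  unfold waveOp
  fun_prop

/-- The base point moves along (ε, w) while the derivative is sampled along (-ε, w). By symmetry of
the second derivative the mixed terms cancel, and by ε² = 1 the time terms reduce to -∂ₜ². -/
theorem coneIntegrand_deriv_aux (A : ℝ × E3 →L[ℝ] ℂ) (B : ℝ × E3 →L[ℝ] ℝ × E3 →L[ℝ] ℂ) {ε : ℝ}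
    (hε : ε ^ 2 = 1) (ρ : ℝ) (w : E3) (hs : B (1, 0) (0, w) = B (0, w) (1, 0)) :
    A (ε, w) + (ρ • (B (ε, w) (-ε, w) + A 0) + (1 : ℝ) • A (-ε, w)) =
      2 * A (0, w) + ρ * (B (0, w) (0, w) - B (1, 0) (1, 0)) := by
  have e1 : (ε, w) = ε • ((1 : ℝ), (0 : E3)) + (0, w) := by simp
  have e2 : (-ε, w) = (-ε) • ((1 : ℝ), (0 : E3)) + (0, w) := by simp
  have hεc : (ε : ℂ) ^ 2 = 1 := by
    have := congrArg (fun x : ℝ => (x : ℂ)) hε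
    push_cast at this
    exact this
  rw [e1, e2]
  generalize ((1 : ℝ), (0 : E3)) = a at *
  generalize ((0 : ℝ), w) = b at *
  simp only [map_add, map_smul, _root_.add_apply, _root_.smul_apply, Complex.real_smul, hs,
    map_zero, Complex.ofReal_neg, Complex.ofReal_one]
  linear_combination (-(ρ : ℂ) * B a a) * hεc

theorem fderiv_coneIntegrand {u : ℝ × E3 → ℂ} (hu : ContDiff ℝ ∞ u) {ε : ℝ} (hε : ε ^ 2 = 1)
    (t : ℝ) (z : E3) (ρ : ℝ) (w : E3) :
    fderiv ℝ (coneIntegrand u ε t z) (ρ, w) (1, 0) =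
      2 * fderiv ℝ u (t + ε * ρ, z + ρ • w) (0, w) +
      ρ * (fderiv ℝ (fderiv ℝ u) (t + ε * ρ, z + ρ • w) (0, w) (0, w) -
        fderiv ℝ (fderiv ℝ u) (t + ε * ρ, z + ρ • w) (1, 0) (1, 0)) := by
  have hd1 : ContDiff ℝ ∞ (fderiv ℝ u) := hu.fderiv_right (by simp)
  have hG := contDiff_coneIntegrand hu ε t z
  have hp : HasDerivAt (fun ρ : ℝ => (t + ε * ρ, z + ρ • w)) (ε, w) ρ := by
    refine HasDerivAt.prodMk ?_ ?_
    · simpa using ((hasDerivAt_id ρ).const_mul ε).const_add t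
    · simpa using ((hasDerivAt_id ρ).smul_const w).const_add z
  have h1 : HasDerivAt (fun ρ : ℝ => coneIntegrand u ε t z (ρ, w))
      (fderiv ℝ (coneIntegrand u ε t z) (ρ, w) (1, 0)) ρ := by
    have h0 := (hG.differentiable (by simp) (ρ, w)).hasFDerivAt
    exact h0.comp_hasDerivAt (f := fun ρ : ℝ => (ρ, w)) ρ
      ((hasDerivAt_id ρ).prodMk (hasDerivAt_const ρ w))
  have h2 : HasDerivAt (fun ρ : ℝ => u (t + ε * ρ, z + ρ • w))
      (fderiv ℝ u (t + ε * ρ, z + ρ • w) (ε, w)) ρ :=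
    (hu.differentiable (by simp) (t + ε * ρ, z + ρ • w)).hasFDerivAt.comp_hasDerivAt ρ hp
  have h3 : HasDerivAt (fun ρ : ℝ => fderiv ℝ u (t + ε * ρ, z + ρ • w))
      (fderiv ℝ (fderiv ℝ u) (t + ε * ρ, z + ρ • w) (ε, w)) ρ :=
    (hd1.differentiable (by simp) (t + ε * ρ, z + ρ • w)).hasFDerivAt.comp_hasDerivAt ρ hp
  have h4 := h2.add ((hasDerivAt_id ρ).smul (h3.clm_apply (hasDerivAt_const ρ ((-ε : ℝ), w))))
  have hsymm : IsSymmSndFDerivAt ℝ u (t + ε * ρ, z + ρ • w) :=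
    (hu.contDiffAt).isSymmSndFDerivAt (by simpa using two_le_infty)
  exact (h1.unique h4).trans (coneIntegrand_deriv_aux _ _ hε ρ w (hsymm (1, 0) (0, w)))

/-- After `fderiv_coneIntegrand` only radial space derivatives remain next to ∂ₜ². Under the sphere
integral they become the Laplacian, by `integral_sphere_laplacian` for x ↦ u(t + ερ, z + ρx). The
chain rule produces a factor ρ that has to be cancelled, whence ρ ≠ 0. -/
theorem hasDerivAt_coneIntegral {u : ℝ × E3 → ℂ} (hu : ContDiff ℝ ∞ u) {ε : ℝ} (hε : ε ^ 2 = 1)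
    (t : ℝ) (z : E3) {ρ : ℝ} (hρ : ρ ≠ 0) :
    HasDerivAt (coneIntegral u ε t z)
      (-ρ * ∫ w : S2, waveOp u (t + ε * ρ, z + ρ • (w : E3)) ∂sphereMeasure) ρ := by
  have hd1 : ContDiff ℝ ∞ (fderiv ℝ u) := hu.fderiv_right (by simp)
  have hc1 : Continuous (fderiv ℝ u) := hd1.continuous
  have hc2 : Continuous (fderiv ℝ (fderiv ℝ u)) := hd1.continuous_fderiv (by simp)
  have hG := contDiff_coneIntegrand hu ε t z
  refine (hasDerivAt_integral_of_contDiff sphereMeasure (k := fun w : S2 => (w : E3))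
    continuous_subtype_val (hG.of_le (by simp)) ρ).congr_deriv ?_
  simp only [fderiv_coneIntegrand hu hε]
  set h : E3 → ℂ := fun x => u (t + ε * ρ, z + ρ • x) with hh
  have hhc : ContDiff ℝ 2 h := (hu.of_le two_le_infty).comp (by fun_prop)
  have hq : ∀ x : E3, HasFDerivAt (fun x : E3 => (t + ε * ρ, z + ρ • x))
      (ρ • ContinuousLinearMap.inr ℝ ℝ E3) x := fun x => by
    have h2 : HasFDerivAt (fun x : E3 => z + ρ • x) (ρ • ContinuousLinearMap.id ℝ E3) x :=
      ((hasFDerivAt_id x).const_smul ρ).const_add z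
    refine ((hasFDerivAt_const (t + ε * ρ) x).prodMk h2).congr_fderiv ?_
    ext v <;> simp
  have hf1 : fderiv ℝ h = fun x => (fderiv ℝ u (t + ε * ρ, z + ρ • x)).comp
      (ρ • ContinuousLinearMap.inr ℝ ℝ E3) := funext fun x =>
    ((hu.differentiable (by simp) (t + ε * ρ, z + ρ • x)).hasFDerivAt.comp x (hq x)).fderiv
  have hf2 : ∀ x v v', fderiv ℝ (fderiv ℝ h) x v v' =
      ρ ^ 2 * fderiv ℝ (fderiv ℝ u) (t + ε * ρ, z + ρ • x) (0, v) (0, v') := by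
    intro x v v'
    rw [hf1]
    have h2 : HasFDerivAt (fun x => fderiv ℝ u (t + ε * ρ, z + ρ • x)) _ x :=
      (hd1.differentiable (by simp) (t + ε * ρ, z + ρ • x)).hasFDerivAt.comp x (hq x)
    rw [(h2.clm_comp (hasFDerivAt_const _ _)).fderiv]
    simp
    ring
  have hlap := integral_sphere_laplacian hhc
  simp only [hf2] at hlap
  have hρc : (ρ : ℂ) ≠ 0 := by exact_mod_cast hρ
  have i1 : Integrable (fun w : S2 => 2 * fderiv ℝ u (t + ε * ρ, z + ρ • (w : E3)) (0, (w : E3)) +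
      ρ * fderiv ℝ (fderiv ℝ u) (t + ε * ρ, z + ρ • (w : E3)) (0, (w : E3)) (0, (w : E3)))
      sphereMeasure := integrable_of_continuous_of_compactSpace (by fun_prop)
  have i2 : Integrable (fun w : S2 => ρ * fderiv ℝ (fderiv ℝ u) (t + ε * ρ, z + ρ • (w : E3))
      (1, 0) (1, 0)) sphereMeasure := integrable_of_continuous_of_compactSpace (by fun_prop)
  have i3 : Integrable (fun w : S2 => ∑ i, fderiv ℝ (fderiv ℝ u) (t + ε * ρ, z + ρ • (w : E3))
      (0, basisVec i) (0, basisVec i)) sphereMeasure :=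
    integrable_of_continuous_of_compactSpace (by fun_prop)
  have i4 : Integrable (fun w : S2 => fderiv ℝ (fderiv ℝ u) (t + ε * ρ, z + ρ • (w : E3))
      (1, 0) (1, 0)) sphereMeasure := integrable_of_continuous_of_compactSpace (by fun_prop)
  have key : ∫ w : S2, (2 * fderiv ℝ u (t + ε * ρ, z + ρ • (w : E3)) (0, (w : E3)) +
      ρ * fderiv ℝ (fderiv ℝ u) (t + ε * ρ, z + ρ • (w : E3)) (0, (w : E3)) (0, (w : E3)))
      ∂sphereMeasure = ρ * ∫ w : S2, ∑ i, fderiv ℝ (fderiv ℝ u) (t + ε * ρ, z + ρ • (w : E3))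
      (0, basisVec i) (0, basisVec i) ∂sphereMeasure := by
    refine mul_left_cancel₀ hρc ?_
    simp only [← Finset.mul_sum] at hlap
    rw [integral_const_mul] at hlap
    rw [← mul_assoc, ← pow_two, ← hlap, ← integral_const_mul]
    refine integral_congr_ae (.of_forall fun w => ?_)
    simp only [hf1]
    simp
    ring
  have e : ∀ w : S2, 2 * fderiv ℝ u (t + ε * ρ, z + ρ • (w : E3)) (0, (w : E3)) +
      ρ * (fderiv ℝ (fderiv ℝ u) (t + ε * ρ, z + ρ • (w : E3)) (0, (w : E3)) (0, (w : E3)) -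
        fderiv ℝ (fderiv ℝ u) (t + ε * ρ, z + ρ • (w : E3)) (1, 0) (1, 0)) =
      (2 * fderiv ℝ u (t + ε * ρ, z + ρ • (w : E3)) (0, (w : E3)) +
      ρ * fderiv ℝ (fderiv ℝ u) (t + ε * ρ, z + ρ • (w : E3)) (0, (w : E3)) (0, (w : E3))) -
      ρ * fderiv ℝ (fderiv ℝ u) (t + ε * ρ, z + ρ • (w : E3)) (1, 0) (1, 0) := fun w => by ring
  simp only [e]
  rw [integral_sub i1 i2, key, integral_const_mul]
  unfold waveOp
  rw [integral_sub i4 i3]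
  ring

theorem continuous_coneIntegral {u : ℝ × E3 → ℂ} (hu : ContDiff ℝ ∞ u) (ε t : ℝ) (z : E3) :
    Continuous (coneIntegral u ε t z) :=
  (contDiff_integral_of_contDiff sphereMeasure (k := fun w : S2 => (w : E3))
    continuous_subtype_val (contDiff_coneIntegrand hu ε t z)).continuous

theorem coneIntegral_zero (u : ℝ × E3 → ℂ) (ε t : ℝ) (z : E3) :
    coneIntegral u ε t z 0 = 4 * Real.pi * u (t, z) := by
  unfold coneIntegral coneIntegrand
  simp only [mul_zero, add_zero, zero_smul, integral_const, sphereMeasure_real_univ]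
  simp

/-- Kirchhoff's formula. -/
theorem coneIntegral_sub {u : ℝ × E3 → ℂ} (hu : ContDiff ℝ ∞ u) {ε : ℝ} (hε : ε ^ 2 = 1)
    (t : ℝ) (z : E3) {M : ℝ} (hM : 0 ≤ M) :
    ∫ ρ in (0 : ℝ)..M, -ρ * ∫ w : S2, waveOp u (t + ε * ρ, z + ρ • (w : E3)) ∂sphereMeasure =
      coneIntegral u ε t z M - 4 * Real.pi * u (t, z) := by
  rw [← coneIntegral_zero u ε]
  refine intervalIntegral.integral_eq_sub_of_hasDerivAt_of_le hM
    (continuous_coneIntegral hu ε t z).continuousOn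
    (fun ρ hρ => hasDerivAt_coneIntegral hu hε t z hρ.1.ne') ?_
  refine Continuous.intervalIntegrable ?_ _ _
  have hc := continuous_waveOp hu
  have : Continuous fun ρ : ℝ => ∫ w : S2, waveOp u (t + ε * ρ, z + ρ • (w : E3)) ∂sphereMeasure := by
    have := continuous_parametric_integral_of_continuous (μ := sphereMeasure)
      (s := (Set.univ : Set S2)) (f := fun (ρ : ℝ) (w : S2) => waveOp u (t + ε * ρ, z + ρ • (w : E3)))
      (by unfold Function.uncurry; fun_prop) isCompact_univ
    simpa using this
  fun_prop

/-- Finite speed of propagation. -/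
theorem IsSmoothWave.eq_zero {φ ψ : E3 → ℂ} {f u : ℝ × E3 → ℂ} (h : IsSmoothWave φ ψ f u) {R : ℝ}
    (hφ : ∀ z, R < ‖z‖ → φ z = 0) (hψ : ∀ z, R < ‖z‖ → ψ z = 0)
    (hf : ∀ t z, R < ‖z‖ → f (t, z) = 0) {t : ℝ} (ht : 0 ≤ t) {z : E3} (hz : R + t < ‖z‖) :
    u (t, z) = 0 := by
  have hu := h.smooth
  have hnorm : ∀ (w : S2) (ρ : ℝ), 0 ≤ ρ → ρ ≤ t → R < ‖z + ρ • (w : E3)‖ := fun w ρ h0 h1 => by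
    have := norm_sub_norm_le z (-(ρ • (w : E3)))
    rw [norm_neg, norm_smul, Real.norm_of_nonneg h0, norm_eq_of_mem_sphere, sub_neg_eq_add] at this
    linarith
  -- The backward cone of height exactly t ends on the initial plane, at points with |z| > R, where
  -- the data vanish.
  have key := coneIntegral_sub hu (ε := -1) (by norm_num) t z ht
  have h0 : coneIntegral u (-1) t z t = 0 := by
    unfold coneIntegral coneIntegrand
    rw [show (0 : ℂ) = ∫ _ : S2, 0 ∂sphereMeasure by simp]
    refine integral_congr_ae (.of_forall fun w => ?_)
    have hn := hnorm w t ht le_rfl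
    have e1 : t + -1 * t = 0 := by ring
    simp only [e1]
    rw [h.init, hφ _ hn, neg_neg]
    have d1 : fderiv ℝ u (0, z + t • (w : E3)) (1, 0) = 0 := by
      rw [← (hasDerivAt_time (hu.of_le (by simp)) 0 _).deriv, h.init_deriv, hψ _ hn]
    have d2 : fderiv ℝ u (0, z + t • (w : E3)) (0, (w : E3)) = 0 := by
      have h1 : HasFDerivAt (fun y : E3 => u (0, y)) _ (z + t • (w : E3)) :=
        (hu.differentiable (by simp) (0, z + t • (w : E3))).hasFDerivAt.comp _
          (hasFDerivAt_prodMk_right 0 _)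
      have h2 : HasFDerivAt (fun y : E3 => u (0, y)) (0 : E3 →L[ℝ] ℂ) (z + t • (w : E3)) := by
        refine (hasFDerivAt_const (0 : ℂ) _).congr_of_eventuallyEq ?_
        filter_upwards [(isOpen_lt continuous_const continuous_norm).mem_nhds hn] with y hy
        rw [h.init, hφ _ hy]
      simpa using DFunLike.congr_fun (h1.unique h2) (w : E3)
    rw [show ((1 : ℝ), (w : E3)) = (1, 0) + (0, (w : E3)) by simp, map_add, d1, d2]
    simp
  have h1 : ∫ ρ in (0 : ℝ)..t, -ρ * ∫ w : S2, waveOp u (t + -1 * ρ, z + ρ • (w : E3)) ∂sphereMeasure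
      = 0 := by
    refine intervalIntegral.integral_zero_ae ?_
    -- At ρ = t the cone is at time 0, where the wave equation is not assumed.
    have : ∀ᵐ ρ : ℝ, ρ ≠ t := by simp [ae_iff, measure_singleton]
    filter_upwards [this] with ρ hρt hρ
    rw [Set.uIoc_of_le ht] at hρ
    have : ∀ w : S2, waveOp u (t + -1 * ρ, z + ρ • (w : E3)) = 0 := fun w => by
      rw [← waveOp_eq (hu.of_le two_le_infty), h.wave _ (by linarith [lt_of_le_of_ne hρ.2 hρt]),
        hf _ _ (hnorm w ρ hρ.1.le hρ.2)]
    simp only [this, integral_zero, mul_zero]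
  rw [h1, h0] at key
  have hpi : (Real.pi : ℂ) ≠ 0 := by exact_mod_cast Real.pi_ne_zero
  simpa [hpi] using key.symm

end KirchhoffFormula

section RetardedPotential

/-! ### Compactly supported solutions -/

/-- Lebesgue measure on `[0, M]`. -/
def iccMeasure (M : ℝ) : Measure (Set.Icc (0 : ℝ) M) :=
  Measure.comap Subtype.val volume

instance isFiniteMeasure_iccMeasure (M : ℝ) : IsFiniteMeasure (iccMeasure M) := by
  refine ⟨?_⟩
  rw [iccMeasure, comap_subtype_coe_apply measurableSet_Icc, Set.image_univ, Subtype.range_coe]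
  exact measure_Icc_lt_top

/-- Average of `F` over the truncated forward light cone with weight `ρ dρ dω`. -/
def coneAverage {V : Type} [NormedAddCommGroup V] [NormedSpace ℝ V] (M : ℝ) (F : ℝ × E3 → V)
    (x : ℝ × E3) : V :=
  ∫ a : Set.Icc (0 : ℝ) M × S2, (a.1 : ℝ) • F (x + ((a.1 : ℝ), (a.1 : ℝ) • (a.2 : E3)))
    ∂((iccMeasure M).prod sphereMeasure)

section

variable {V : Type} [NormedAddCommGroup V] [NormedSpace ℝ V]

theorem contDiff_coneAverage (M : ℝ) {F : ℝ × E3 → V} (hF : ContDiff ℝ ∞ F) :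
    ContDiff ℝ ∞ (coneAverage M F) := by
  have hG : ContDiff ℝ ∞ (fun q : (ℝ × E3) × (ℝ × E3) =>
      q.2.1 • F (q.1 + (q.2.1, q.2.1 • q.2.2))) :=
    (contDiff_fst.comp contDiff_snd).smul (hF.comp (by fun_prop))
  exact contDiff_integral_of_contDiff (K := Set.Icc (0 : ℝ) M × S2)
    ((iccMeasure M).prod sphereMeasure)
    (k := fun a => ((a.1 : ℝ), (a.2 : E3))) (by fun_prop) hG

theorem fderiv_coneAverage (M : ℝ) {F : ℝ × E3 → V} (hF : ContDiff ℝ ∞ F) :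
    fderiv ℝ (coneAverage M F) = coneAverage M (fderiv ℝ F) := by
  funext x
  have hG : ContDiff ℝ ∞ (fun q : (ℝ × E3) × (ℝ × E3) =>
      q.2.1 • F (q.1 + (q.2.1, q.2.1 • q.2.2))) :=
    (contDiff_fst.comp contDiff_snd).smul (hF.comp (by fun_prop))
  have h := hasFDerivAt_integral_of_contDiff (K := Set.Icc (0 : ℝ) M × S2)
    ((iccMeasure M).prod sphereMeasure)
    (k := fun a => ((a.1 : ℝ), (a.2 : E3))) (by fun_prop) (hG.of_le (by simp)) x
  refine h.fderiv.trans ?_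
  unfold coneAverage
  congr 1
  funext a
  have h1 := (hG.differentiable (by simp) (x, ((a.1 : ℝ), (a.2 : E3)))).hasFDerivAt.comp x
    (f := fun y => (y, ((a.1 : ℝ), (a.2 : E3)))) (hasFDerivAt_prodMk_left x ((a.1 : ℝ), (a.2 : E3)))
  have h2 : HasFDerivAt (fun y => (a.1 : ℝ) • F (y + ((a.1 : ℝ), (a.1 : ℝ) • (a.2 : E3))))
      ((a.1 : ℝ) • fderiv ℝ F (x + ((a.1 : ℝ), (a.1 : ℝ) • (a.2 : E3)))) x := by
    have h3 := (hF.differentiable (by simp) (x + ((a.1 : ℝ), (a.1 : ℝ) • (a.2 : E3)))).hasFDerivAt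
    exact ((hasFDerivAt_comp_add_right ((a.1 : ℝ), (a.1 : ℝ) • (a.2 : E3))).2 h3).const_smul _
  exact h1.unique h2

theorem integrable_coneAverage (M : ℝ) {F : ℝ × E3 → V} (hF : Continuous F) (x : ℝ × E3) :
    Integrable (fun a : Set.Icc (0 : ℝ) M × S2 =>
      (a.1 : ℝ) • F (x + ((a.1 : ℝ), (a.1 : ℝ) • (a.2 : E3))))
      ((iccMeasure M).prod sphereMeasure) :=
  integrable_of_continuous_of_compactSpace (by fun_prop)

theorem coneAverage_eq (M : ℝ) (hM : 0 ≤ M) {F : ℝ × E3 → V} (hF : Continuous F) (x : ℝ × E3) :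
    coneAverage M F x = ∫ ρ in (0 : ℝ)..M,
      ρ • ∫ w : S2, F (x.1 + ρ, x.2 + ρ • (w : E3)) ∂sphereMeasure := by
  unfold coneAverage
  rw [integral_prod _ (integrable_coneAverage M hF x), intervalIntegral.integral_of_le hM,
    ← integral_Icc_eq_integral_Ioc, ← integral_subtype_comap measurableSet_Icc
      (fun ρ => ρ • ∫ w : S2, F (x.1 + ρ, x.2 + ρ • (w : E3)) ∂sphereMeasure)]
  refine integral_congr_ae (.of_forall fun ρ => ?_)
  simp only
  rw [← integral_smul]
  rfl

end

theorem waveOp_coneAverage (M : ℝ) {F : ℝ × E3 → ℂ} (hF : ContDiff ℝ ∞ F) (x : ℝ × E3) :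
    waveOp (coneAverage M F) x = coneAverage M (waveOp F) x := by
  have hd1 : ContDiff ℝ ∞ (fderiv ℝ F) := hF.fderiv_right (by simp)
  have hc2 : Continuous (fderiv ℝ (fderiv ℝ F)) := hd1.continuous_fderiv (by simp)
  have hi := integrable_coneAverage (V := ℝ × E3 →L[ℝ] ℝ × E3 →L[ℝ] ℂ) M hc2 x
  have key : ∀ v v', coneAverage M (fderiv ℝ (fderiv ℝ F)) x v v' =
      coneAverage M (fun y => fderiv ℝ (fderiv ℝ F) y v v') x := by
    intro v v'
    unfold coneAverage
    rw [ContinuousLinearMap.integral_apply hi, ContinuousLinearMap.integral_apply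
      (hi.apply_continuousLinearMap v)]
    rfl
  unfold waveOp
  rw [fderiv_coneAverage M hF, fderiv_coneAverage M hd1]
  simp only [key]
  unfold coneAverage
  rw [← integral_finsetSum, ← integral_sub]
  · refine integral_congr_ae (.of_forall fun a => ?_)
    simp only [smul_sub, Finset.smul_sum]
  · exact integrable_coneAverage (V := ℂ) M (F := fun y => fderiv ℝ (fderiv ℝ F) y (1, 0) (1, 0))
      (by fun_prop) x
  · exact integrable_finsetSum _ fun i _ => integrable_coneAverage (V := ℂ) M
      (F := fun y => fderiv ℝ (fderiv ℝ F) y (0, basisVec i) (0, basisVec i)) (by fun_prop) x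
  · exact fun i _ => integrable_coneAverage (V := ℂ) M
      (F := fun y => fderiv ℝ (fderiv ℝ F) y (0, basisVec i) (0, basisVec i)) (by fun_prop) x

/-- For compactly supported forcing there is a solution which vanishes for large times. -/
theorem waveOp_coneAverage_eq {F : ℝ × E3 → ℂ} (hF : ContDiff ℝ ∞ F) {R M : ℝ} (hM : 0 ≤ M)
    (hFR : ∀ t z, R < t → F (t, z) = 0) {t : ℝ} (ht : R < t + M) (z : E3) :
    waveOp (coneAverage M F) (t, z) = 4 * Real.pi * F (t, z) := by
  rw [waveOp_coneAverage M hF, coneAverage_eq M hM (continuous_waveOp hF)]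
  -- Kirchhoff's formula for `F` itself on the forward cone. Its top lies after the support of `F`,
  -- so the average of `waveOp F` over the cone is 4πF at the vertex.
  have h := coneIntegral_sub hF (ε := 1) (by norm_num) t z hM
  have h0 : coneIntegral F 1 t z M = 0 := by
    unfold coneIntegral coneIntegrand
    rw [show (0 : ℂ) = ∫ _ : S2, 0 ∂sphereMeasure by simp]
    refine integral_congr_ae (.of_forall fun w => ?_)
    have hd : fderiv ℝ F (t + M, z + M • (w : E3)) = 0 := by
      have : F =ᶠ[𝓝 (t + M, z + M • (w : E3))] fun _ => 0 := by
        have ho : IsOpen {q : ℝ × E3 | R < q.1} := isOpen_lt continuous_const continuous_fst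
        filter_upwards [ho.mem_nhds (show R < t + M from ht)] with q hq
        exact hFR q.1 q.2 hq
      rw [this.fderiv_eq]
      simp
    simp only [one_mul, hd]
    simp [hFR _ _ ht]
  rw [h0, zero_sub] at h
  have h2 := congrArg Neg.neg h
  rw [neg_neg, ← intervalIntegral.integral_neg] at h2
  rw [← h2]
  refine intervalIntegral.integral_congr fun ρ _ => ?_
  simp

theorem coneAverage_comp (M : ℝ) (hM : 0 ≤ M) {F : ℝ × E3 → ℂ} (hF : Continuous F)
    (L : E3 ≃ₗᵢ[ℝ] E3) (hL : ∀ t z, F (t, L z) = F (t, z)) (t : ℝ) (z : E3) :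
    coneAverage M F (t, L z) = coneAverage M F (t, z) := by
  rw [coneAverage_eq M hM hF, coneAverage_eq M hM hF]
  refine intervalIntegral.integral_congr fun ρ _ => ?_
  simp only
  rw [← integral_sphere_comp L (fun w => F (t + ρ, L z + ρ • w))]
  refine congrArg (ρ • ·) (integral_congr_ae (.of_forall fun w => ?_))
  simp only
  rw [← map_smul, ← map_add, hL]

theorem coneAverage_eq_zero (M : ℝ) {F : ℝ × E3 → ℂ} (x : ℝ × E3)
    (h : ∀ ρ ∈ Set.Icc 0 M, ∀ w : S2, F (x.1 + ρ, x.2 + ρ • (w : E3)) = 0) :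
    coneAverage M F x = 0 := by
  unfold coneAverage
  rw [show (0 : ℂ) = ∫ _ : Set.Icc (0 : ℝ) M × S2, 0
    ∂((iccMeasure M).prod sphereMeasure) by simp]
  refine integral_congr_ae (.of_forall fun a => ?_)
  have := h a.1 a.1.2 a.2
  simp only [smul_eq_zero]
  exact Or.inr this

/-- Solution of the wave equation with compact support in space-time, for given compactly supported
forcing in `t > 0`. -/
theorem exists_compactSupport_wave {F : ℝ × E3 → ℂ} (hF : ContDiff ℝ ∞ F) (hFc : HasCompactSupport F) :
    ∃ u : ℝ × E3 → ℂ, ContDiff ℝ ∞ u ∧ HasCompactSupport u ∧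
      (∀ t z, 0 < t → waveOp u (t, z) = F (t, z)) ∧
      ∀ L : E3 ≃ₗᵢ[ℝ] E3, (∀ t z, F (t, L z) = F (t, z)) → ∀ t z, u (t, L z) = u (t, z) := by
  obtain ⟨R, hR⟩ := hFc.isCompact.isBounded.subset_closedBall 0
  have hFR : ∀ t z, R < |t| ∨ R < ‖z‖ → F (t, z) = 0 := by
    intro t z h
    by_contra hne
    have := hR (subset_tsupport F hne)
    rw [mem_closedBall_zero_iff, Prod.norm_def, max_le_iff, Real.norm_eq_abs] at this
    rcases h with h | h
    · exact absurd this.1 (not_le.2 h)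
    · exact absurd this.2 (not_le.2 h)
  -- A forward cone of height M starting at any t > 0 outlasts the support of `F`. The absolute
  -- value keeps M nonnegative; the 2 is slack.
  set M := |R| + 2 with hMdef
  have hM : 0 ≤ M := by positivity
  have hRM : R + 2 ≤ M := by linarith [le_abs_self R]
  set v : ℝ × E3 → ℂ := fun x => (4 * Real.pi : ℂ)⁻¹ * coneAverage M F x with hv
  have hvs : ContDiff ℝ ∞ v := contDiff_const.mul (contDiff_coneAverage M hF)
  -- The cutoff is 1 for t ≥ 0 and 0 for t ≤ -1. It makes the support compact in the past and leaves
  -- the solution unchanged for t > 0, the only range where the equation is required.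
  set u : ℝ × E3 → ℂ := fun x => (Real.smoothTransition (x.1 + 1) : ℂ) * v x with hu
  have hus : ContDiff ℝ ∞ u := by
    refine ContDiff.mul ?_ hvs
    exact Complex.ofRealCLM.contDiff.comp
      (Real.smoothTransition.contDiff.comp (contDiff_fst.add contDiff_const))
  have huz : ∀ t z, u (t, z) ≠ 0 → t ∈ Set.Icc (-1) M ∧ z ∈ Metric.closedBall (0 : E3) (R + M) := by
    intro t z hne
    have h1 : -1 < t := by
      by_contra hle
      exact hne (by simp [hu, Real.smoothTransition.zero_of_nonpos (show t + 1 ≤ 0 by linarith)])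
    have h2 : ¬ ∀ ρ ∈ Set.Icc 0 M, ∀ w : S2, F (t + ρ, z + ρ • (w : E3)) = 0 := fun h =>
      hne (by simp [hu, hv, coneAverage_eq_zero M (t, z) h])
    push Not at h2
    obtain ⟨ρ, hρ, w, hw⟩ := h2
    have h3 : |t + ρ| ≤ R := by
      by_contra h
      exact hw (hFR _ _ (Or.inl (not_le.1 h)))
    have h4 : ‖z + ρ • (w : E3)‖ ≤ R := by
      by_contra h
      exact hw (hFR _ _ (Or.inr (not_le.1 h)))
    have h5 := norm_sub_norm_le z (-(ρ • (w : E3)))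
    rw [norm_neg, norm_smul, Real.norm_of_nonneg hρ.1, norm_eq_of_mem_sphere, sub_neg_eq_add] at h5
    refine ⟨⟨h1.le, ?_⟩, ?_⟩
    · linarith [(abs_le.1 h3).2, hρ.1]
    · rw [mem_closedBall_zero_iff]
      linarith [hρ.2]
  refine ⟨u, hus, ?_, ?_, ?_⟩
  · refine HasCompactSupport.intro ((isCompact_Icc (a := (-1 : ℝ)) (b := M)).prod
      (isCompact_closedBall (0 : E3) (R + M))) fun x hx => ?_
    by_contra hne
    exact hx (huz x.1 x.2 hne)
  · intro t z ht
    have heq : u =ᶠ[𝓝 (t, z)] v := by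
      have ho : IsOpen {q : ℝ × E3 | 0 < q.1} := isOpen_lt continuous_const continuous_fst
      filter_upwards [ho.mem_nhds (show 0 < t from ht)] with q hq
      have hq' : 0 < q.1 := hq
      simp [hu, Real.smoothTransition.one_of_one_le (show 1 ≤ q.1 + 1 by linarith)]
    have h1 : waveOp u (t, z) = waveOp v (t, z) := by
      unfold waveOp
      rw [heq.fderiv.fderiv_eq]
    have hcs := contDiff_coneAverage M hF
    have hcd : ContDiff ℝ ∞ (fderiv ℝ (coneAverage M F)) := hcs.fderiv_right (by simp)
    have h2 : waveOp v (t, z) = (4 * Real.pi : ℂ)⁻¹ * waveOp (coneAverage M F) (t, z) := by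
      have e1 : fderiv ℝ v = fun x => (4 * Real.pi : ℂ)⁻¹ • fderiv ℝ (coneAverage M F) x :=
        funext fun x => (((hcs.differentiable (by simp) x).hasFDerivAt).const_mul _).fderiv
      have e2 : fderiv ℝ (fderiv ℝ v) (t, z) =
          (4 * Real.pi : ℂ)⁻¹ • fderiv ℝ (fderiv ℝ (coneAverage M F)) (t, z) := by
        rw [e1]
        exact (((hcd.differentiable (by simp) (t, z)).hasFDerivAt).const_smul (4 * Real.pi : ℂ)⁻¹).fderiv
      unfold waveOp
      rw [e2]
      simp only [_root_.smul_apply, smul_eq_mul, ← Finset.mul_sum, mul_sub]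
    have hpi : (Real.pi : ℂ) ≠ 0 := by exact_mod_cast Real.pi_ne_zero
    rw [h1, h2, waveOp_coneAverage_eq hF hM (R := R)
      (fun t z h => hFR t z (Or.inl (lt_of_lt_of_le h (le_abs_self t)))) (by linarith)]
    field_simp
  · intro L hL t z
    simp only [hu, hv, coneAverage_comp M hM hF.continuous L hL]

end RetardedPotential

section PolarCoordinates

/-! ### Polar coordinates and spherical means -/

/-- Integration in polar coordinates. -/
theorem lintegral_polar {g : E3 → ℝ≥0∞} (hg : Measurable g) :
    ∫⁻ x, g x = ∫⁻ w : S2, ∫⁻ σ in Set.Ioi (0 : ℝ), ENNReal.ofReal (σ ^ 2) * g (σ • (w : E3))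
      ∂volume ∂sphereMeasure := by
  have h0 : ∫⁻ x, g x = ∫⁻ x : ({0}ᶜ : Set E3), g x ∂(Measure.comap Subtype.val volume) := by
    rw [lintegral_subtype_comap (measurableSet_singleton _).compl, restrict_compl_singleton]
  have hmp := (volume : Measure E3).measurePreserving_homeomorphUnitSphereProd
  have h1 := hmp.lintegral_comp (f := fun p => g ((homeomorphUnitSphereProd E3).symm p)) (by
    exact hg.comp (measurable_subtype_coe.comp (homeomorphUnitSphereProd E3).symm.measurable))
  simp only [Homeomorph.symm_apply_apply] at h1
  rw [h0, h1]
  have hm : Measurable fun p : S2 × Set.Ioi (0 : ℝ) => g ((homeomorphUnitSphereProd E3).symm p) :=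
    hg.comp (measurable_subtype_coe.comp (homeomorphUnitSphereProd E3).symm.measurable)
  rw [lintegral_prod _ hm.aemeasurable]
  refine lintegral_congr fun w => ?_
  have hw : Measurable fun y : Set.Ioi (0 : ℝ) => g ((homeomorphUnitSphereProd E3).symm (w, y)) :=
    hm.comp measurable_prodMk_left
  rw [Measure.volumeIoiPow, lintegral_withDensity_eq_lintegral_mul _ (by fun_prop) hw,
    ← lintegral_subtype_comap measurableSet_Ioi]
  refine lintegral_congr fun y => ?_
  simp

/-- The push-forward form transfers integrability (`integral_polar`) as well as almost everywhere
statements (`IsRadial.exists_direction`). -/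
theorem map_polar : Measure.map (fun q : S2 × ℝ => q.2 • (q.1 : E3))
    ((sphereMeasure.prod (volume.restrict (Set.Ioi (0 : ℝ)))).withDensity
      fun q => ENNReal.ofReal (q.2 ^ 2)) = volume := by
  refine Measure.ext_of_lintegral _ fun g hg => ?_
  have hc : Continuous fun q : S2 × ℝ => q.2 • (q.1 : E3) := by fun_prop
  rw [lintegral_map hg hc.measurable, lintegral_withDensity_eq_lintegral_mul _ (by fun_prop)
    (g := fun q : S2 × ℝ => g (q.2 • (q.1 : E3))) (hg.comp hc.measurable), lintegral_polar hg,
    lintegral_prod]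
  · rfl
  · exact Measurable.aemeasurable ((Measurable.mul (by fun_prop) (hg.comp hc.measurable)))

theorem integral_polar {F : Type} [NormedAddCommGroup F] [NormedSpace ℝ F] {g : E3 → F}
    (hg : Integrable g) :
    Integrable (fun q : S2 × ℝ => q.2 ^ 2 • g (q.2 • (q.1 : E3)))
      (sphereMeasure.prod (volume.restrict (Set.Ioi (0 : ℝ)))) ∧
    ∫ x, g x = ∫ w : S2, ∫ σ in Set.Ioi (0 : ℝ), σ ^ 2 • g (σ • (w : E3)) ∂volume
      ∂sphereMeasure := by
  have hc : Continuous fun q : S2 × ℝ => q.2 • (q.1 : E3) := by fun_prop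
  have hg' : Integrable g (Measure.map (fun q : S2 × ℝ => q.2 • (q.1 : E3))
    ((sphereMeasure.prod (volume.restrict (Set.Ioi (0 : ℝ)))).withDensity
      fun q => ENNReal.ofReal (q.2 ^ 2))) := by rwa [map_polar]
  have h1 := (integrable_map_measure hg'.aestronglyMeasurable hc.aemeasurable).1 hg'
  rw [integrable_withDensity_iff_integrable_smul' (by fun_prop) (by simp)] at h1
  have e : ∀ q : S2 × ℝ, (ENNReal.ofReal (q.2 ^ 2)).toReal • g (q.2 • (q.1 : E3)) =
      q.2 ^ 2 • g (q.2 • (q.1 : E3)) := fun q => by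
    rw [ENNReal.toReal_ofReal (sq_nonneg _)]
  have h2 : Integrable (fun q : S2 × ℝ => q.2 ^ 2 • g (q.2 • (q.1 : E3)))
      (sphereMeasure.prod (volume.restrict (Set.Ioi (0 : ℝ)))) :=
    h1.congr (.of_forall e)
  refine ⟨h2, ?_⟩
  rw [← integral_prod _ h2]
  conv_lhs => rw [← map_polar]
  rw [integral_map hc.aemeasurable hg'.aestronglyMeasurable,
    integral_withDensity_eq_integral_toReal_smul (by fun_prop) (by simp)]
  exact integral_congr_ae (.of_forall e)

theorem integral_one_add_sq_le (a b : ℝ) : ∫ y in a..b, (1 + y ^ 2)⁻¹ ≤ Real.pi := by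
  rw [integral_inv_one_add_sq]
  linarith [Real.arctan_lt_pi_div_two b, Real.neg_pi_div_two_lt_arctan a]

/-- Concentration on the axis: the integral of a profile over plane waves at large distance. -/
theorem integral_sphere_scaled {k : ℝ → ℂ} (hk : Continuous k) (τ : S2) (s : ℝ) {r : ℝ} (hr : 0 < r) :
    (r : ℂ) * ∫ w : S2, k (s + r * (1 - inner ℝ (τ : E3) (w : E3))) ∂sphereMeasure =
      2 * Real.pi * ∫ y in s..(s + 2 * r), k y := by
  have hc : Continuous fun w : S2 => (inner ℝ (τ : E3) (w : E3) : ℝ) := by fun_prop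
  have h1 : ∫ w : S2, k (s + r * (1 - inner ℝ (τ : E3) (w : E3))) ∂sphereMeasure =
      ∫ x, k (s + r * (1 - x)) ∂(sphereMeasure.map (fun w : S2 => (inner ℝ (τ : E3) (w : E3) : ℝ))) := by
    rw [integral_map hc.aemeasurable
      (Continuous.aestronglyMeasurable (f := fun x : ℝ => k (s + r * (1 - x))) (by fun_prop))]
  rw [h1, map_inner_sphereMeasure, integral_smul_measure,
    ENNReal.toReal_ofReal (by positivity), ← intervalIntegral.integral_of_le (by norm_num)]
  have h2 := intervalIntegral.integral_comp_sub_mul (a := (-1 : ℝ)) (b := 1) k hr.ne' (s + r)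
  have h3 : ∀ x : ℝ, s + r * (1 - x) = s + r - r * x := fun x => by ring
  simp only [h3]
  rw [h2, Complex.real_smul, Complex.real_smul]
  have h4 : s + r - r * 1 = s := by ring
  have h5 : s + r - r * -1 = s + 2 * r := by ring
  rw [h4, h5]
  have hr' : (r : ℂ) ≠ 0 := by exact_mod_cast hr.ne'
  push_cast
  field_simp

/-- Freezing the second argument at `τ` gives the limit directly from `integral_sphere_scaled`. In
the error, directions near `τ` are controlled by the smallness of `m`, and away from `τ` the
quadratic decay of the profile beats the factor r. -/
theorem tendsto_integral_sphere_scaled {h : ℝ → S2 → ℂ} (τ : S2) {C : ℝ}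
    (hcj : Continuous fun q : ℝ × S2 => h q.1 q.2)
    (hC : ∀ s w, ‖h s w‖ ≤ C * (1 + s ^ 2)⁻¹) {m : S2 → ℝ} (hm : Continuous m) (hm0 : m τ = 0)
    (hhm : ∀ s w, ‖h s w - h s τ‖ ≤ m w * (1 + s ^ 2)⁻¹) (s : ℝ) :
    Tendsto (fun r : ℝ => (r : ℂ) * ∫ w : S2, h (s + r * (1 - inner ℝ (τ : E3) (w : E3))) w
      ∂sphereMeasure) atTop (𝓝 (2 * Real.pi * ∫ y in Set.Ioi s, h y τ)) := by
  have hpi := Real.pi_pos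
  have hcτ : Continuous fun s => h s τ := hcj.comp (f := fun s => (s, τ)) (by fun_prop)
  have hmain : Tendsto (fun r : ℝ => (r : ℂ) * ∫ w : S2,
      h (s + r * (1 - inner ℝ (τ : E3) (w : E3))) τ ∂sphereMeasure) atTop
      (𝓝 (2 * Real.pi * ∫ y in Set.Ioi s, h y τ)) := by
    have hint : IntegrableOn (fun y => h y τ) (Set.Ioi s) := by
      refine Integrable.integrableOn ?_
      exact (integrable_inv_one_add_sq.const_mul C).mono' hcτ.aestronglyMeasurable
        (.of_forall fun y => hC y τ)
    have h1 : Tendsto (fun r : ℝ => s + 2 * r) atTop atTop :=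
      tendsto_atTop_add_const_left _ _ (tendsto_id.const_mul_atTop (by norm_num))
    have h2 := (intervalIntegral_tendsto_integral_Ioi s hint h1).const_mul (2 * Real.pi : ℂ)
    refine h2.congr' ?_
    filter_upwards [eventually_gt_atTop 0] with r hr
    exact (integral_sphere_scaled hcτ τ s hr).symm
  obtain ⟨Mx, hMx⟩ := (isCompact_univ (X := S2)).exists_bound_of_continuousOn hm.continuousOn
  have hMx0 : 0 ≤ Mx := (norm_nonneg _).trans (hMx τ (Set.mem_univ _))
  have herr : Tendsto (fun r : ℝ => (r : ℂ) * ∫ w : S2,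
      (h (s + r * (1 - inner ℝ (τ : E3) (w : E3))) w -
        h (s + r * (1 - inner ℝ (τ : E3) (w : E3))) τ) ∂sphereMeasure) atTop (𝓝 0) := by
    rw [Metric.tendsto_atTop]
    intro ε hε
    -- The near part has total weight at most 2π·π, hence contributes at most ε/4; the far part will
    -- be below ε/2.
    have hε' : 0 < ε / (8 * Real.pi ^ 2) := by positivity
    obtain ⟨δ, hδ, hδm⟩ := Metric.continuousAt_iff.1 (hm.continuousAt (x := τ)) _ hε'
    have hlim : Tendsto (fun r : ℝ => Mx * (4 * Real.pi) * (r * (1 + (s + r * (δ ^ 2 / 2)) ^ 2)⁻¹))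
        atTop (𝓝 0) := by
      have hd : 0 < δ ^ 2 / 2 := by positivity
      rw [show (0 : ℝ) = Mx * (4 * Real.pi) * ((δ ^ 2 / 2)⁻¹ * 0) by ring]
      refine Tendsto.const_mul _ ?_
      have e1 : Tendsto (fun r : ℝ => s + r * (δ ^ 2 / 2)) atTop atTop :=
        tendsto_atTop_add_const_left _ _ (tendsto_id.atTop_mul_const hd)
      have e2 : Tendsto (fun y : ℝ => (y - s) * (1 + y ^ 2)⁻¹) atTop (𝓝 0) := by
        have hb : Tendsto (fun y : ℝ => 2 * y⁻¹) atTop (𝓝 0) := by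
          simpa using tendsto_inv_atTop_zero.const_mul (2 : ℝ)
        refine squeeze_zero' (g := fun y : ℝ => 2 * y⁻¹) ?_ ?_ hb
        · filter_upwards [eventually_ge_atTop s] with y hy
          exact mul_nonneg (by linarith) (by positivity)
        · filter_upwards [eventually_ge_atTop (|s| + 1)] with y hy
          have hy0 : 0 < y := by linarith [abs_nonneg s]
          rw [← div_eq_mul_inv, ← div_eq_mul_inv, div_le_div_iff₀ (by positivity) hy0]
          nlinarith [neg_abs_le s, abs_nonneg s]
      refine ((e2.comp e1).const_mul (δ ^ 2 / 2)⁻¹).congr fun r => ?_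
      simp only [Function.comp_apply]
      field_simp
      ring
    have hev := hlim.eventually (gt_mem_nhds (half_pos hε))
    have hev2 : ∀ᶠ r : ℝ in atTop, 0 ≤ s + r * (δ ^ 2 / 2) :=
      (tendsto_atTop_add_const_left _ s (tendsto_id.atTop_mul_const
        (by positivity : 0 < δ ^ 2 / 2))).eventually (eventually_ge_atTop 0)
    obtain ⟨r₀, hr₀⟩ := eventually_atTop.1 ((hev.and hev2).and (eventually_gt_atTop 0))
    refine ⟨r₀, fun r hr => ?_⟩
    obtain ⟨⟨hr1, hr2⟩, hr3⟩ := hr₀ r hr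
    rw [dist_zero_right, norm_mul, Complex.norm_of_nonneg hr3.le]
    have hpt : ∀ w : S2, ‖h (s + r * (1 - inner ℝ (τ : E3) (w : E3))) w -
        h (s + r * (1 - inner ℝ (τ : E3) (w : E3))) τ‖ ≤
        ε / (8 * Real.pi ^ 2) * (1 + (s + r * (1 - inner ℝ (τ : E3) (w : E3))) ^ 2)⁻¹ +
        Mx * (1 + (s + r * (δ ^ 2 / 2)) ^ 2)⁻¹ := by
      intro w
      have hp1 : 0 < (1 + (s + r * (1 - inner ℝ (τ : E3) (w : E3))) ^ 2) := by positivity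
      refine (hhm _ w).trans ?_
      rcases lt_or_ge (dist w τ) δ with hd | hd
      · have := hδm hd
        rw [hm0, Real.dist_eq, sub_zero] at this
        have h1 := mul_le_mul_of_nonneg_right ((le_abs_self _).trans this.le) (inv_nonneg.2 hp1.le)
        have h2 : 0 ≤ Mx * (1 + (s + r * (δ ^ 2 / 2)) ^ 2)⁻¹ := by positivity
        linarith
      -- For unit vectors 1 - τ·w = |w - τ|²/2.
      · have h1 : δ ^ 2 / 2 ≤ 1 - inner ℝ (τ : E3) (w : E3) := by
          rw [Subtype.dist_eq, dist_eq_norm] at hd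
          have h2 := norm_sub_sq_real (w : E3) (τ : E3)
          rw [norm_eq_of_mem_sphere, norm_eq_of_mem_sphere, real_inner_comm] at h2
          have h3 := pow_le_pow_left₀ hδ.le hd 2
          linarith
        have h2 : s + r * (δ ^ 2 / 2) ≤ s + r * (1 - inner ℝ (τ : E3) (w : E3)) := by
          linarith [mul_le_mul_of_nonneg_left h1 hr3.le]
        have h3 : (1 + (s + r * (1 - inner ℝ (τ : E3) (w : E3))) ^ 2)⁻¹ ≤
            (1 + (s + r * (δ ^ 2 / 2)) ^ 2)⁻¹ := by
          refine inv_anti₀ (by positivity) ?_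
          linarith [pow_le_pow_left₀ hr2 h2 2]
        have h4 : m w * (1 + (s + r * (1 - inner ℝ (τ : E3) (w : E3))) ^ 2)⁻¹ ≤
            Mx * (1 + (s + r * (δ ^ 2 / 2)) ^ 2)⁻¹ :=
          mul_le_mul ((le_abs_self _).trans (hMx w (Set.mem_univ _))) h3 (by positivity) hMx0
        have h5 : 0 ≤ ε / (8 * Real.pi ^ 2) *
          (1 + (s + r * (1 - inner ℝ (τ : E3) (w : E3))) ^ 2)⁻¹ := by positivity
        linarith
    have hbc : Continuous fun w : S2 => (1 + (s + r * (1 - inner ℝ (τ : E3) (w : E3))) ^ 2)⁻¹ :=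
      Continuous.inv₀ (by fun_prop) fun w => by positivity
    have hi : Integrable (fun w : S2 => ε / (8 * Real.pi ^ 2) *
        (1 + (s + r * (1 - inner ℝ (τ : E3) (w : E3))) ^ 2)⁻¹) sphereMeasure :=
      (integrable_of_continuous_of_compactSpace hbc).const_mul _
    have hI := norm_integral_le_of_norm_le (hi.add (integrable_const
      (Mx * (1 + (s + r * (δ ^ 2 / 2)) ^ 2)⁻¹))) (.of_forall hpt)
    simp only [Pi.add_apply] at hI
    rw [integral_add hi (integrable_const _), integral_const, integral_const_mul,
      sphereMeasure_real_univ, smul_eq_mul] at hI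
    have hscale : r * ∫ w : S2, (1 + (s + r * (1 - inner ℝ (τ : E3) (w : E3))) ^ 2)⁻¹ ∂sphereMeasure
        ≤ 2 * Real.pi * Real.pi := by
      have hk : Continuous fun y : ℝ => (((1 + y ^ 2)⁻¹ : ℝ) : ℂ) :=
        Complex.continuous_ofReal.comp (Continuous.inv₀ (by fun_prop) fun y => by positivity)
      have := integral_sphere_scaled hk τ s hr3
      rw [intervalIntegral.integral_ofReal, integral_complex_ofReal] at this
      have h' : r * ∫ w : S2, (1 + (s + r * (1 - inner ℝ (τ : E3) (w : E3))) ^ 2)⁻¹ ∂sphereMeasure =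
        2 * Real.pi * ∫ y in s..(s + 2 * r), (1 + y ^ 2)⁻¹ := by exact_mod_cast this
      rw [h']
      exact mul_le_mul_of_nonneg_left (integral_one_add_sq_le _ _) (by positivity)
    have hfin := mul_le_mul_of_nonneg_left hI hr3.le
    have h8 : ε / (8 * Real.pi ^ 2) * (2 * Real.pi * Real.pi) = ε / 4 := by
      field_simp
      norm_num
    have h9 := mul_le_mul_of_nonneg_left hscale hε'.le
    rw [h8] at h9
    nlinarith [hfin, h9, hr1]
  have hsum := hmain.add herr
  rw [add_zero] at hsum
  refine hsum.congr fun r => ?_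
  have i1 : Integrable (fun w : S2 => h (s + r * (1 - inner ℝ (τ : E3) (w : E3))) w) sphereMeasure :=
    integrable_of_continuous_of_compactSpace
      (hcj.comp (f := fun w : S2 => (s + r * (1 - inner ℝ (τ : E3) (w : E3)), w)) (by fun_prop))
  have i2 : Integrable (fun w : S2 => h (s + r * (1 - inner ℝ (τ : E3) (w : E3))) τ) sphereMeasure :=
    integrable_of_continuous_of_compactSpace (hcτ.comp
      (f := fun w : S2 => s + r * (1 - inner ℝ (τ : E3) (w : E3))) (by fun_prop))
  rw [integral_sub i1 i2]
  ring

end PolarCoordinates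

section Profiles

/-! ### Profiles of plane waves -/

open FourierTransform

/-- Uniformly decaying profiles of superpositions of plane waves. -/
structure IsProfile (h : ℝ → S2 → ℂ) : Prop where
  cont : Continuous fun q : ℝ × S2 => h q.1 q.2
  bound : ∃ C, ∀ s w, ‖h s w‖ ≤ C * (1 + s ^ 2)⁻¹
  modulus : ∀ τ, ∃ m : S2 → ℝ, Continuous m ∧ m τ = 0 ∧
    ∀ s w, ‖h s w - h s τ‖ ≤ m w * (1 + s ^ 2)⁻¹

theorem IsProfile.add {h k : ℝ → S2 → ℂ} (hh : IsProfile h) (hk : IsProfile k) :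
    IsProfile fun s w => h s w + k s w := by
  refine ⟨hh.cont.add hk.cont, ?_, fun τ => ?_⟩
  · obtain ⟨C, hC⟩ := hh.bound
    obtain ⟨D, hD⟩ := hk.bound
    refine ⟨C + D, fun s w => (norm_add_le _ _).trans ?_⟩
    rw [add_mul]
    exact add_le_add (hC s w) (hD s w)
  · obtain ⟨m, hm, hm0, hmb⟩ := hh.modulus τ
    obtain ⟨n, hn, hn0, hnb⟩ := hk.modulus τ
    refine ⟨fun w => m w + n w, hm.add hn, by simp [hm0, hn0], fun s w => ?_⟩
    rw [add_sub_add_comm, add_mul]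
    exact (norm_add_le _ _).trans (add_le_add (hmb s w) (hnb s w))

theorem IsProfile.mul_left {h : ℝ → S2 → ℂ} (hh : IsProfile h) {c : S2 → ℂ} (hc : Continuous c) :
    IsProfile fun s w => c w * h s w := by
  obtain ⟨C, hC⟩ := hh.bound
  obtain ⟨D, hD⟩ := (isCompact_univ (X := S2)).exists_bound_of_continuousOn hc.continuousOn
  have hD' : ∀ w, ‖c w‖ ≤ D := fun w => hD w (Set.mem_univ _)
  refine ⟨(hc.comp continuous_snd).mul hh.cont, ⟨D * C, fun s w => ?_⟩, fun τ => ?_⟩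
  · rw [norm_mul, mul_assoc]
    exact mul_le_mul (hD' w) (hC s w) (norm_nonneg _) ((norm_nonneg _).trans (hD' w))
  · obtain ⟨m, hm, hm0, hmb⟩ := hh.modulus τ
    refine ⟨fun w => ‖c w‖ * m w + ‖c w - c τ‖ * C, by fun_prop, by simp [hm0], fun s w => ?_⟩
    rw [show c w * h s w - c τ * h s τ = c w * (h s w - h s τ) + (c w - c τ) * h s τ by ring,
      add_mul, mul_assoc, mul_assoc]
    refine (norm_add_le _ _).trans (add_le_add ?_ ?_)
    · rw [norm_mul]
      exact mul_le_mul_of_nonneg_left (hmb s w) (norm_nonneg _)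
    · rw [norm_mul]
      exact mul_le_mul_of_nonneg_left (hC s τ) (norm_nonneg _)

/-- (1 + s²)h is an inverse Fourier integral of a function with an integrable majorant independent
of w, which gives the uniform decay. The modulus at `τ` is the L¹ distance of `L(·, w)` and `L(·,
τ)`, continuous by dominated convergence. -/
theorem isProfile_of_integral {L : ℝ × S2 → ℂ} (hL : Continuous L) {C : ℝ}
    (hC : ∀ σ w, ‖L (σ, w)‖ ≤ C * (1 + σ ^ 2)⁻¹) {h : ℝ → S2 → ℂ}
    (hh : ∀ s w, (1 + s ^ 2 : ℝ) * h s w =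
      ∫ σ : ℝ, Complex.exp (((2 * Real.pi * (σ * s) : ℝ) : ℂ) * Complex.I) * L (σ, w)) :
    IsProfile h := by
  have hi : Integrable (fun σ : ℝ => C * (1 + σ ^ 2)⁻¹) := integrable_inv_one_add_sq.const_mul C
  have hLi : ∀ w, Integrable fun σ => L (σ, w) := fun w =>
    hi.mono' (Continuous.aestronglyMeasurable (by fun_prop)) (.of_forall fun σ => hC σ w)
  have hexp : ∀ σ s : ℝ, ‖Complex.exp (((2 * Real.pi * (σ * s) : ℝ) : ℂ) * Complex.I)‖ = 1 :=
    fun σ s => Complex.norm_exp_ofReal_mul_I _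
  have hLe : ∀ s w, Integrable fun σ : ℝ =>
      Complex.exp (((2 * Real.pi * (σ * s) : ℝ) : ℂ) * Complex.I) * L (σ, w) := fun s w =>
    hi.mono' (Continuous.aestronglyMeasurable (by fun_prop))
      (.of_forall fun σ => by rw [norm_mul, hexp, one_mul]; exact hC σ w)
  have hpos : ∀ s : ℝ, 0 < 1 + s ^ 2 := fun s => by positivity
  have hne : ∀ s : ℝ, ((1 + s ^ 2 : ℝ) : ℂ) ≠ 0 := fun s => by exact_mod_cast (hpos s).ne'
  have heq : ∀ s w, h s w = (∫ σ : ℝ, Complex.exp (((2 * Real.pi * (σ * s) : ℝ) : ℂ) * Complex.I) *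
      L (σ, w)) * ((1 + s ^ 2 : ℝ) : ℂ)⁻¹ := fun s w => by
    rw [← hh, mul_comm, inv_mul_cancel_left₀ (hne s)]
  have hn : ∀ s : ℝ, ‖((1 + s ^ 2 : ℝ) : ℂ)⁻¹‖ = (1 + s ^ 2)⁻¹ := fun s => by
    rw [norm_inv, Complex.norm_of_nonneg (hpos s).le]
  refine ⟨?_, ⟨∫ σ, C * (1 + σ ^ 2)⁻¹, fun s w => ?_⟩, fun τ => ⟨fun w => ∫ σ, ‖L (σ, w) - L (σ, τ)‖,
    ?_, by simp, fun s w => ?_⟩⟩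
  · simp only [heq]
    refine Continuous.mul ?_ (Continuous.inv₀ (by fun_prop) fun q => hne q.1)
    exact continuous_of_dominated (bound := fun σ => C * (1 + σ ^ 2)⁻¹)
      (fun q => Continuous.aestronglyMeasurable (by fun_prop))
      (fun q => .of_forall fun σ => by rw [norm_mul, hexp, one_mul]; exact hC σ q.2) hi
      (.of_forall fun σ => by fun_prop)
  · rw [heq, norm_mul, hn]
    refine mul_le_mul_of_nonneg_right ?_ (inv_nonneg.2 (hpos s).le)
    exact norm_integral_le_of_norm_le hi
      (.of_forall fun σ => by rw [norm_mul, hexp, one_mul]; exact hC σ w)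
  · refine continuous_of_dominated (bound := fun σ => C * (1 + σ ^ 2)⁻¹ + C * (1 + σ ^ 2)⁻¹)
      (fun q => Continuous.aestronglyMeasurable (by fun_prop))
      (fun w => .of_forall fun σ => ?_) (hi.add hi) (.of_forall fun σ => by fun_prop)
    rw [norm_norm]
    exact (norm_sub_le _ _).trans (add_le_add (hC σ w) (hC σ τ))
  · rw [heq, heq, ← sub_mul, norm_mul, hn, ← integral_sub (hLe s w) (hLe s τ)]
    refine mul_le_mul_of_nonneg_right ?_ (inv_nonneg.2 (hpos s).le)
    refine norm_integral_le_of_norm_le ((hLi w).sub (hLi τ)).norm (.of_forall fun σ => ?_)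
    rw [← mul_sub, norm_mul, hexp, one_mul]

theorem SchwartzMap.exists_one_add_sq_bound {F : Type} [NormedAddCommGroup F] [NormedSpace ℝ F]
    (η : 𝓢(E3, F)) : ∃ C, 0 ≤ C ∧ ∀ x, ‖η x‖ ≤ C * (1 + ‖x‖ ^ 2)⁻¹ := by
  obtain ⟨C₀, hC₀⟩ := η.decay 0 0
  obtain ⟨C₂, hC₂⟩ := η.decay 2 0
  have h0 : 0 ≤ C₀ + C₂ := add_nonneg hC₀.1.le hC₂.1.le
  refine ⟨C₀ + C₂, h0, fun x => ?_⟩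
  have h1 := hC₀.2 x
  have h2 := hC₂.2 x
  rw [norm_iteratedFDeriv_zero] at h1 h2
  rw [← div_eq_mul_inv, le_div_iff₀ (by positivity)]
  linarith

theorem line_hasTemperateGrowth (w : S2) : (fun σ : ℝ => σ • (w : E3)).HasTemperateGrowth := by
  exact (ContinuousLinearMap.toSpanSingleton ℝ (w : E3)).hasTemperateGrowth

theorem line_antilipschitz (w : S2) : AntilipschitzWith 1 (fun σ : ℝ => σ • (w : E3)) := by
  refine AntilipschitzWith.of_le_mul_dist fun a b => ?_
  rw [dist_eq_norm, dist_eq_norm, ← sub_smul, norm_smul, norm_eq_of_mem_sphere]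
  simp

/-- Restriction of a Schwartz function to the line through the origin in direction `w`. -/
def restrictLine (w : S2) : 𝓢(E3, ℂ) →L[ℂ] 𝓢(ℝ, ℂ) :=
  SchwartzMap.compCLMOfAntilipschitz ℂ (line_hasTemperateGrowth w) (line_antilipschitz w)

@[simp]
theorem restrictLine_apply (w : S2) (η : 𝓢(E3, ℂ)) (σ : ℝ) :
    restrictLine w η σ = η (σ • (w : E3)) := rfl

theorem lineDeriv_restrictLine (w : S2) (η : 𝓢(E3, ℂ)) :
    ∂_{(1 : ℝ)} (restrictLine w η) = restrictLine w (∂_{(w : E3)} η) := by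
  ext σ
  rw [restrictLine_apply, SchwartzMap.lineDerivOp_apply_eq_fderiv,
    SchwartzMap.lineDerivOp_apply_eq_fderiv]
  have h1 : HasFDerivAt (fun σ : ℝ => σ • (w : E3))
      (ContinuousLinearMap.toSpanSingleton ℝ (w : E3)) σ :=
    (ContinuousLinearMap.toSpanSingleton ℝ (w : E3)).hasFDerivAt
  have h2 : HasFDerivAt (restrictLine w η) ((fderiv ℝ η (σ • (w : E3))).comp
      (ContinuousLinearMap.toSpanSingleton ℝ (w : E3))) σ :=
    HasFDerivAt.comp (g := η) (f := fun σ : ℝ => σ • (w : E3)) σ (η.hasFDerivAt (σ • (w : E3))) h1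
  rw [h2.fderiv]
  simp

theorem fourierInv_restrictLine_two (w : S2) (η : 𝓢(E3, ℂ)) (s : ℝ) :
    𝓕⁻ (restrictLine w (∂_{(w : E3)} (∂_{(w : E3)} η))) s =
      -(4 * Real.pi ^ 2 * s ^ 2) * 𝓕⁻ (restrictLine w η) s := by
  have hg : (fun x : ℝ => inner ℝ x (1 : ℝ)).HasTemperateGrowth := by fun_prop
  rw [← lineDeriv_restrictLine, ← lineDeriv_restrictLine, SchwartzMap.fourierInv_lineDerivOp_eq,
    SchwartzMap.fourierInv_lineDerivOp_eq]
  rw [_root_.smul_apply, SchwartzMap.smulLeftCLM_apply_apply hg, _root_.smul_apply,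
    SchwartzMap.smulLeftCLM_apply_apply hg]
  have h1 : inner ℝ s (1 : ℝ) = s := by simp
  rw [h1, smul_eq_mul, smul_eq_mul, Complex.real_smul, Complex.real_smul]
  linear_combination (4 * Real.pi ^ 2 * s ^ 2 * 𝓕⁻ (restrictLine w η) s) * Complex.I_sq

/-- Multiplication by s² corresponds to -(4π²)⁻¹ times the second derivative of `η` along w, so
`isProfile_of_integral` applies with η - (4π²)⁻¹∂_w²η. Schwartz bounds for `η` and for its full
second derivative are uniform in the direction. -/
theorem isProfile_restrictLine (η : 𝓢(E3, ℂ)) :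
    IsProfile fun s w => 𝓕⁻ (restrictLine w η) s := by
  set D2 := SchwartzMap.fderivCLM ℝ E3 (E3 →L[ℝ] ℂ) (SchwartzMap.fderivCLM ℝ E3 ℂ η) with hD2
  have hD : ∀ (v x : E3), (∂_{v} (∂_{v} η) : 𝓢(E3, ℂ)) x = D2 x v v := by
    intro v x
    rw [SchwartzMap.lineDerivOp_apply_eq_fderiv]
    have h1 : (fun y => (∂_{v} η : 𝓢(E3, ℂ)) y) =
        fun y => SchwartzMap.fderivCLM ℝ E3 ℂ η y v := funext fun y => by
      rw [SchwartzMap.lineDerivOp_apply_eq_fderiv]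
      rfl
    have h2 := ((SchwartzMap.fderivCLM ℝ E3 ℂ η).hasFDerivAt x).clm_apply (hasFDerivAt_const v x)
    rw [← h1] at h2
    have h3 := h2.fderiv
    rw [show fderiv ℝ (⇑(∂_{v} η : 𝓢(E3, ℂ))) x = _ from h3]
    simp [hD2]
  obtain ⟨C, hC0, hC⟩ := SchwartzMap.exists_one_add_sq_bound η
  obtain ⟨D, hD0, hDb⟩ := SchwartzMap.exists_one_add_sq_bound D2
  have hηc := η.continuous
  have hD2c := D2.continuous
  have hns : ∀ (σ : ℝ) (w : S2), ‖σ • (w : E3)‖ ^ 2 = σ ^ 2 := fun σ w => by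
    rw [norm_smul, norm_eq_of_mem_sphere, mul_one, Real.norm_eq_abs, sq_abs]
  have hpi : (Real.pi : ℂ) ≠ 0 := by exact_mod_cast Real.pi_ne_zero
  refine isProfile_of_integral (L := fun q => η (q.1 • (q.2 : E3)) -
    (4 * Real.pi ^ 2 : ℂ)⁻¹ * D2 (q.1 • (q.2 : E3)) q.2 q.2)
    (C := C + ‖(4 * Real.pi ^ 2 : ℂ)⁻¹‖ * D) (by fun_prop) (fun σ w => ?_) fun s w => ?_
  · rw [add_mul, mul_assoc]
    refine (norm_sub_le _ _).trans (add_le_add ?_ ?_)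
    · simpa [hns] using hC (σ • (w : E3))
    · rw [norm_mul]
      refine mul_le_mul_of_nonneg_left ?_ (norm_nonneg _)
      have h1 := (D2 (σ • (w : E3)) w).le_opNorm (w : E3)
      have h2 := (D2 (σ • (w : E3))).le_opNorm (w : E3)
      rw [norm_eq_of_mem_sphere, mul_one] at h1 h2
      have h3 := hDb (σ • (w : E3))
      rw [hns] at h3
      exact h1.trans (h2.trans h3)
  · have e1 : ∀ f : 𝓢(ℝ, ℂ), 𝓕⁻ f s =
        ∫ σ : ℝ, Complex.exp (((2 * Real.pi * (σ * s) : ℝ) : ℂ) * Complex.I) * f σ := fun f => by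
      rw [SchwartzMap.fourierInv_coe, Real.fourierInv_eq']
      simp [mul_comm s]
    have e2 : (1 + s ^ 2 : ℝ) * 𝓕⁻ (restrictLine w η) s = 𝓕⁻ (restrictLine w η) s -
        (4 * Real.pi ^ 2 : ℂ)⁻¹ * 𝓕⁻ (restrictLine w (∂_{(w : E3)} (∂_{(w : E3)} η))) s := by
      rw [fourierInv_restrictLine_two]
      field_simp
      push_cast
      ring
    have hn : ∀ σ : ℝ, ‖Complex.exp (((2 * Real.pi * (σ * s) : ℝ) : ℂ) * Complex.I)‖ ≤ 1 :=
      fun σ => (Complex.norm_exp_ofReal_mul_I _).le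
    have hi : ∀ f : 𝓢(ℝ, ℂ), Integrable fun σ : ℝ =>
        Complex.exp (((2 * Real.pi * (σ * s) : ℝ) : ℂ) * Complex.I) * f σ := fun f =>
      f.integrable.bdd_mul (Continuous.aestronglyMeasurable (by fun_prop)) (.of_forall hn)
    rw [e2, e1, e1, ← integral_const_mul, ← integral_sub (hi _) ((hi _).const_mul _)]
    refine integral_congr_ae (.of_forall fun σ => ?_)
    simp only [restrictLine_apply, hD]
    ring

end Profiles

section PlaneWaves

/-! ### Plane wave decomposition -/

open FourierTransform

/-- Full lines in all directions cover every point twice, as (σ, w) and as (-σ, -w), and the surface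
measure is invariant under the antipodal map. -/
theorem integral_sphere_fold {F : Type} [NormedAddCommGroup F] [NormedSpace ℝ F]
    {k : ℝ × E3 → F} (hk : Continuous k) {C : ℝ}
    (hC : ∀ (σ : ℝ) (w : S2), ‖k (σ, w)‖ ≤ C * (1 + σ ^ 2)⁻¹) :
    ∫ w : S2, ∫ σ in Set.Ioi (0 : ℝ), (k (σ, w) + k (-σ, -w)) ∂volume ∂sphereMeasure =
      ∫ w : S2, ∫ σ : ℝ, k (σ, w) ∂volume ∂sphereMeasure := by
  have hi : Integrable (fun σ : ℝ => C * (1 + σ ^ 2)⁻¹) := integrable_inv_one_add_sq.const_mul C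
  have hki : ∀ w : S2, Integrable fun σ => k (σ, (w : E3)) := fun w =>
    hi.mono' (Continuous.aestronglyMeasurable (by fun_prop)) (.of_forall fun σ => hC σ w)
  have hc1 : Continuous fun w : S2 => ∫ σ in Set.Ioi (0 : ℝ), k (σ, (w : E3)) :=
    continuous_of_dominated (bound := fun σ => C * (1 + σ ^ 2)⁻¹)
      (fun q => Continuous.aestronglyMeasurable (by fun_prop))
      (fun w => .of_forall fun σ => hC σ w) hi.integrableOn (.of_forall fun σ => by fun_prop)
  have hc2 : Continuous fun w : S2 => ∫ σ in Set.Ioi (0 : ℝ), k (-σ, (w : E3)) :=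
    continuous_of_dominated (bound := fun σ => C * (1 + σ ^ 2)⁻¹)
      (fun q => Continuous.aestronglyMeasurable (by fun_prop))
      (fun w => .of_forall fun σ => by simpa using hC (-σ) w) hi.integrableOn
      (.of_forall fun σ => by fun_prop)
  have hki2 : ∀ w : S2, Integrable fun σ => k (-σ, (w : E3)) := fun w => (hki w).comp_neg
  have hneg := integral_sphere_comp (LinearIsometryEquiv.neg ℝ)
    (fun w : E3 => ∫ σ in Set.Ioi (0 : ℝ), k (-σ, w))
  have hc3 : Continuous fun w : S2 => ∫ σ in Set.Ioi (0 : ℝ), k (-σ, -(w : E3)) :=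
    hc2.comp (f := fun w : S2 => -w) continuous_neg
  have e1 : ∀ w : S2, ∫ σ in Set.Ioi (0 : ℝ), (k (σ, (w : E3)) + k (-σ, -(w : E3))) =
      (∫ σ in Set.Ioi (0 : ℝ), k (σ, (w : E3))) + ∫ σ in Set.Ioi (0 : ℝ), k (-σ, -(w : E3)) :=
    fun w => integral_add (hki w).integrableOn (hki2 (-w)).integrableOn
  have e2 : ∀ w : S2, ∫ σ : ℝ, k (σ, (w : E3)) =
      (∫ σ in Set.Ioi (0 : ℝ), k (σ, (w : E3))) + ∫ σ in Set.Ioi (0 : ℝ), k (-σ, (w : E3)) := by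
    intro w
    rw [integral_comp_neg_Ioi (0 : ℝ) (fun σ => k (σ, (w : E3))), neg_zero, add_comm]
    exact (intervalIntegral.integral_Iic_add_Ioi (hki w).integrableOn (hki w).integrableOn).symm
  simp only [e1, e2]
  rw [integral_add (integrable_of_continuous_of_compactSpace hc1)
    (integrable_of_continuous_of_compactSpace hc2),
    integral_add (integrable_of_continuous_of_compactSpace hc1)
    (integrable_of_continuous_of_compactSpace hc3)]
  congr 1

/-- Frequency content of the plane wave decomposition of the free wave whose initial data have
Fourier transforms `A`, `B`. -/
def planeKernel (A B : 𝓢(E3, ℂ)) (q : ℝ × E3) : ℂ :=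
  2⁻¹ * (q.1 ^ 2 * A (q.1 • q.2) + (2 * Real.pi * Complex.I)⁻¹ * (q.1 * B (q.1 • q.2)))

theorem continuous_planeKernel (A B : 𝓢(E3, ℂ)) : Continuous (planeKernel A B) := by
  have hA := A.continuous
  have hB := B.continuous
  unfold planeKernel
  fun_prop

/-- The restriction of `planeKernel` to a direction, as a Schwartz function. -/
def lineKernel (A B : 𝓢(E3, ℂ)) (w : S2) : 𝓢(ℝ, ℂ) :=
  (2⁻¹ : ℂ) • (restrictLine w (SchwartzMap.smulLeftCLM ℂ (fun x : E3 => ‖x‖ ^ 2) A) +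
    (2 * Real.pi * Complex.I : ℂ)⁻¹ • ∑ j : Fin 3, (((w : E3) j : ℝ) : ℂ) •
      restrictLine w (SchwartzMap.smulLeftCLM ℂ (fun x : E3 => x j) B))

theorem coord_hasTemperateGrowth (j : Fin 3) : (fun x : E3 => x j).HasTemperateGrowth :=
  (EuclideanSpace.proj j : E3 →L[ℝ] ℝ).hasTemperateGrowth

theorem sum_coord_sq (w : S2) : ∑ j : Fin 3, ((w : E3) j) ^ 2 = 1 := by
  have := EuclideanSpace.norm_sq_eq (w : E3)
  simpa using this.symm

/-- The term σB(σw) is a restriction of Schwartz functions on ℝ³ because σ = Σ wⱼ(σwⱼ): it equals Σ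
wⱼ (xⱼB)(σw). The factors wⱼ depend continuously on the direction, as `IsProfile.mul_left` requires.
-/
theorem lineKernel_apply (A B : 𝓢(E3, ℂ)) (w : S2) (σ : ℝ) :
    lineKernel A B w σ = planeKernel A B (σ, w) := by
  have h2 : (fun x : E3 => ‖x‖ ^ 2).HasTemperateGrowth := by fun_prop
  have hs : ∑ j : Fin 3, (((w : E3) j : ℝ) : ℂ) ^ 2 = 1 := by
    have := congrArg (fun x : ℝ => (x : ℂ)) (sum_coord_sq w)
    push_cast at this
    exact this
  unfold lineKernel planeKernel
  rw [_root_.smul_apply, _root_.add_apply, _root_.smul_apply, _root_.sum_apply]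
  simp only [_root_.smul_apply, restrictLine_apply, SchwartzMap.smulLeftCLM_apply_apply h2,
    SchwartzMap.smulLeftCLM_apply_apply (coord_hasTemperateGrowth _), smul_eq_mul,
    Complex.real_smul, norm_smul, norm_eq_of_mem_sphere, mul_one, Real.norm_eq_abs, sq_abs,
    PiLp.smul_apply, Complex.ofReal_mul, Complex.ofReal_pow]
  rw [Finset.sum_congr rfl fun j _ => show (((w : E3) j : ℝ) : ℂ) * (σ * (((w : E3) j : ℝ) : ℂ) *
    B (σ • (w : E3))) = (((w : E3) j : ℝ) : ℂ) ^ 2 * (σ * B (σ • (w : E3))) by ring,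
    ← Finset.sum_mul, hs, one_mul]

/-- The plane wave profile of a free wave. -/
def waveProfile (A B : 𝓢(E3, ℂ)) (s : ℝ) (w : S2) : ℂ := 𝓕⁻ (lineKernel A B w) s

theorem isProfile_waveProfile (A B : 𝓢(E3, ℂ)) : IsProfile (waveProfile A B) := by
  have hc : ∀ j : Fin 3, Continuous fun w : S2 => (2⁻¹ : ℂ) * ((2 * Real.pi * Complex.I : ℂ)⁻¹ *
      (((w : E3) j : ℝ) : ℂ)) := fun j => by fun_prop
  have h := (((isProfile_restrictLine (SchwartzMap.smulLeftCLM ℂ (fun x : E3 => ‖x‖ ^ 2) A)).mul_left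
    (continuous_const (y := (2⁻¹ : ℂ)))).add
    ((((isProfile_restrictLine (SchwartzMap.smulLeftCLM ℂ (fun x : E3 => x 0) B)).mul_left (hc 0)).add
    ((isProfile_restrictLine (SchwartzMap.smulLeftCLM ℂ (fun x : E3 => x 1) B)).mul_left (hc 1))).add
    ((isProfile_restrictLine (SchwartzMap.smulLeftCLM ℂ (fun x : E3 => x 2) B)).mul_left (hc 2))))
  convert h using 1
  funext s w
  unfold waveProfile lineKernel
  simp only [Fin.sum_univ_three, FourierTransform.fourierInv_smul, FourierTransform.fourierInv_add,
    _root_.smul_apply, _root_.add_apply, smul_eq_mul]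
  ring

theorem exists_planeKernel_bound (A B : 𝓢(E3, ℂ)) :
    ∃ C, ∀ (σ : ℝ) (w : S2), ‖planeKernel A B (σ, w)‖ ≤ C * (1 + σ ^ 2)⁻¹ := by
  obtain ⟨a, ha0, ha⟩ := SchwartzMap.exists_one_add_sq_bound
    (SchwartzMap.smulLeftCLM ℂ (fun x : E3 => ‖x‖ ^ 2) A)
  choose b hb0 hb using fun j : Fin 3 => SchwartzMap.exists_one_add_sq_bound
    (SchwartzMap.smulLeftCLM ℂ (fun x : E3 => x j) B)
  refine ⟨‖(2⁻¹ : ℂ)‖ * (a + ‖(2 * Real.pi * Complex.I : ℂ)⁻¹‖ * ∑ j, b j), fun σ w => ?_⟩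
  have hns : ‖σ • (w : E3)‖ ^ 2 = σ ^ 2 := by
    rw [norm_smul, norm_eq_of_mem_sphere, mul_one, Real.norm_eq_abs, sq_abs]
  have hw : ∀ j, ‖(((w : E3) j : ℝ) : ℂ)‖ ≤ 1 := fun j => by
    rw [Complex.norm_real]
    simpa using PiLp.norm_apply_le (w : E3) j
  rw [← lineKernel_apply]
  unfold lineKernel
  rw [_root_.smul_apply, _root_.add_apply, _root_.smul_apply, _root_.sum_apply]
  simp only [_root_.smul_apply, restrictLine_apply, smul_eq_mul]
  rw [norm_mul, mul_assoc ‖(2⁻¹ : ℂ)‖, add_mul, mul_assoc ‖(2 * Real.pi * Complex.I : ℂ)⁻¹‖,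
    Finset.sum_mul]
  refine mul_le_mul_of_nonneg_left ((norm_add_le _ _).trans (add_le_add ?_ ?_)) (norm_nonneg _)
  · simpa [hns] using ha (σ • (w : E3))
  · rw [norm_mul]
    refine mul_le_mul_of_nonneg_left ((norm_sum_le _ _).trans (Finset.sum_le_sum fun j _ => ?_))
      (norm_nonneg _)
    rw [norm_mul]
    have h1 := hb j (σ • (w : E3))
    rw [hns] at h1
    exact (mul_le_of_le_one_left (norm_nonneg _) (hw j)).trans h1

/-- Plane wave decomposition. -/
theorem integral_eq_planeWaves (A B : 𝓢(E3, ℂ)) {g : E3 → ℂ} (hg : Integrable g) (t : ℝ) (z : E3)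
    (hgk : ∀ σ : ℝ, 0 < σ → ∀ w : S2, (σ ^ 2 : ℝ) • g (σ • (w : E3)) =
      planeKernel A B (σ, w) * Complex.exp (2 * Real.pi * σ * (t + inner ℝ z (w : E3) : ℝ) * Complex.I)
      + planeKernel A B (-σ, -w) *
        Complex.exp (-(2 * Real.pi * σ * (t - inner ℝ z (w : E3) : ℝ) * Complex.I))) :
    ∫ ξ, g ξ = ∫ w : S2, waveProfile A B (t + inner ℝ z (w : E3)) w ∂sphereMeasure := by
  obtain ⟨C, hC⟩ := exists_planeKernel_bound A B
  have hpc := continuous_planeKernel A B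
  set k : ℝ × E3 → ℂ := fun q => planeKernel A B q *
    Complex.exp (((2 * Real.pi * (q.1 * (t + inner ℝ z q.2)) : ℝ) : ℂ) * Complex.I) with hk
  have hkc : Continuous k := by
    rw [hk]
    fun_prop
  have hkC : ∀ (σ : ℝ) (w : S2), ‖k (σ, w)‖ ≤ C * (1 + σ ^ 2)⁻¹ := fun σ w => by
    rw [hk]
    simp only
    rw [norm_mul, Complex.norm_exp_ofReal_mul_I, mul_one]
    exact hC σ w
  rw [(integral_polar hg).2]
  have h1 : ∀ w : S2, ∫ σ in Set.Ioi (0 : ℝ), σ ^ 2 • g (σ • (w : E3)) =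
      ∫ σ in Set.Ioi (0 : ℝ), (k (σ, w) + k (-σ, -w)) := fun w => by
    refine setIntegral_congr_fun measurableSet_Ioi fun σ hσ => ?_
    rw [hgk σ hσ w, hk]
    simp only [inner_neg_right]
    congr 3
    · push_cast
      ring
    · push_cast
      ring
  simp only [h1]
  rw [integral_sphere_fold hkc hkC]
  refine integral_congr_ae (.of_forall fun w => ?_)
  simp only [waveProfile]
  rw [SchwartzMap.fourierInv_coe, Real.fourierInv_eq']
  refine integral_congr_ae (.of_forall fun σ => ?_)
  simp only [hk, lineKernel_apply, smul_eq_mul]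
  rw [mul_comm]
  congr 4
  simp [mul_comm]

theorem integrable_norm_sq_schwartz (A : 𝓢(E3, ℂ)) : Integrable fun ξ => ‖ξ‖ ^ 2 * ‖A ξ‖ ^ 2 := by
  obtain ⟨a, ha0, ha⟩ := SchwartzMap.exists_one_add_sq_bound A
  have hi : Integrable fun ξ => a * ‖A ξ‖ := (A.integrable.norm).const_mul a
  refine hi.mono' (Continuous.aestronglyMeasurable (by have := A.continuous; fun_prop))
    (.of_forall fun ξ => ?_)
  rw [Real.norm_of_nonneg (by positivity)]
  have h3 := ha ξ
  rw [← div_eq_mul_inv, le_div_iff₀ (by positivity)] at h3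
  nlinarith [norm_nonneg (A ξ), sq_nonneg ‖ξ‖]

/-- Plancherel on each line turns the profile into its kernel. Folding pairs the kernels at (σ, w)
and (-σ, -w), which are the sum and the difference of an A-term and a B-term; the parallelogram law
removes the cross terms, and polar coordinates reassemble the integral over ℝ³. -/
theorem integral_norm_sq_waveProfile (A B : 𝓢(E3, ℂ)) :
    ∫ w : S2, ∫ s : ℝ, ‖waveProfile A B s w‖ ^ 2 ∂volume ∂sphereMeasure =
      (8 * Real.pi ^ 2)⁻¹ * ∫ ξ, (4 * Real.pi ^ 2 * ‖ξ‖ ^ 2 * ‖A ξ‖ ^ 2 + ‖B ξ‖ ^ 2) := by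
  obtain ⟨C, hC⟩ := exists_planeKernel_bound A B
  have hpc := continuous_planeKernel A B
  have hplan : ∀ w : S2, ∫ s : ℝ, ‖waveProfile A B s w‖ ^ 2 =
      ∫ σ : ℝ, ‖planeKernel A B (σ, w)‖ ^ 2 := fun w => by
    have := SchwartzMap.integral_norm_sq_fourier (𝓕⁻ (lineKernel A B w))
    rw [FourierTransform.fourier_fourierInv_eq] at this
    simp only [lineKernel_apply] at this
    exact this.symm
  simp only [hplan]
  have hfold := integral_sphere_fold (k := fun q => ‖planeKernel A B q‖ ^ 2) (by fun_prop)
    (C := C * C) (fun σ w => by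
      have h0 := hC σ w
      have h1 : (1 + σ ^ 2)⁻¹ ≤ 1 := inv_le_one_of_one_le₀ (by nlinarith [sq_nonneg σ])
      have h2 : 0 ≤ (1 + σ ^ 2)⁻¹ := by positivity
      rw [norm_pow, norm_norm]
      have hC0 : 0 ≤ C * (1 + σ ^ 2)⁻¹ := (norm_nonneg _).trans h0
      have hCC : 0 ≤ C := by
        by_contra hlt
        push Not at hlt
        have : 0 < (1 + σ ^ 2)⁻¹ := by positivity
        nlinarith
      calc ‖planeKernel A B (σ, w)‖ ^ 2 ≤ (C * (1 + σ ^ 2)⁻¹) ^ 2 :=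
            pow_le_pow_left₀ (norm_nonneg _) h0 2
        _ = C * C * (1 + σ ^ 2)⁻¹ * (1 + σ ^ 2)⁻¹ := by ring
        _ ≤ C * C * (1 + σ ^ 2)⁻¹ * 1 := mul_le_mul_of_nonneg_left h1 (by positivity)
        _ = _ := by ring)
  rw [← hfold]
  have hA2 := integrable_norm_sq_schwartz A
  have hB2 : Integrable fun ξ => ‖B ξ‖ ^ 2 := (B.memLp 2).integrable_norm_pow (by norm_num)
  have hg : Integrable fun ξ => (8 * Real.pi ^ 2)⁻¹ *
      (4 * Real.pi ^ 2 * ‖ξ‖ ^ 2 * ‖A ξ‖ ^ 2 + ‖B ξ‖ ^ 2) := by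
    refine (Integrable.add ?_ hB2).const_mul _
    exact (hA2.const_mul (4 * Real.pi ^ 2)).congr (.of_forall fun ξ => by ring)
  rw [← integral_const_mul, (integral_polar hg).2]
  refine integral_congr_ae (.of_forall fun w => ?_)
  refine integral_congr_ae (.of_forall fun σ => ?_)
  have hp : (2 * Real.pi * Complex.I : ℂ) ≠ 0 := by simp [Real.pi_ne_zero]
  have e1 : planeKernel A B (-σ, -w) = 2⁻¹ * (σ ^ 2 * A (σ • (w : E3)) -
      (2 * Real.pi * Complex.I)⁻¹ * (σ * B (σ • (w : E3)))) := by
    simp [planeKernel, sub_eq_add_neg]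
  simp only [e1]
  unfold planeKernel
  have hpar := parallelogram_law_with_norm ℝ (2⁻¹ * ((σ : ℂ) ^ 2 * A (σ • (w : E3))))
    (2⁻¹ * ((2 * Real.pi * Complex.I)⁻¹ * (σ * B (σ • (w : E3)))))
  simp only [mul_add, mul_sub]
  have hpi : ‖(2 * Real.pi * Complex.I : ℂ)‖ = 2 * Real.pi := by
    simp [abs_of_pos Real.pi_pos]
  have n1 : ‖2⁻¹ * ((σ : ℂ) ^ 2 * A (σ • (w : E3)))‖ = 2⁻¹ * (σ ^ 2 * ‖A (σ • (w : E3))‖) := by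
    rw [norm_mul, norm_mul, norm_pow, Complex.norm_real]
    simp
  have n2 : ‖2⁻¹ * ((2 * Real.pi * Complex.I)⁻¹ * (σ * B (σ • (w : E3))))‖ =
      2⁻¹ * ((2 * Real.pi)⁻¹ * (|σ| * ‖B (σ • (w : E3))‖)) := by
    rw [norm_mul, norm_mul, norm_mul, norm_inv, norm_inv, hpi, Complex.norm_real]
    simp
  rw [n1, n2] at hpar
  have hns : ‖σ • (w : E3)‖ ^ 2 = σ ^ 2 := by
    rw [norm_smul, norm_eq_of_mem_sphere, mul_one, Real.norm_eq_abs, sq_abs]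
  rw [hns, smul_eq_mul]
  have hpi0 := Real.pi_ne_zero
  rw [hpar, mul_pow, mul_pow, mul_pow, mul_pow, mul_pow, sq_abs]
  field_simp
  ring

end PlaneWaves

section HalfWaves

/-! ### The Fourier transform of a wave -/

open FourierTransform

/-- `v` is smooth on space-time and vanishes for `‖z‖ > ρ`. -/
structure IsSpatiallySupported (ρ : ℝ) (v : ℝ × E3 → ℂ) : Prop where
  smooth : ContDiff ℝ ∞ v
  eq_zero : ∀ t z, ρ < ‖z‖ → v (t, z) = 0

variable {ρ : ℝ} {v : ℝ × E3 → ℂ}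

theorem IsSpatiallySupported.hasCompactSupport_slice (h : IsSpatiallySupported ρ v) (t : ℝ) :
    HasCompactSupport fun z => v (t, z) :=
  HasCompactSupport.of_support_subset_isCompact (isCompact_closedBall (0 : E3) ρ) fun z hz => by
    rw [mem_closedBall_zero_iff]
    by_contra hlt
    exact hz (h.eq_zero t z (not_le.1 hlt))

theorem IsSpatiallySupported.contDiff_slice (h : IsSpatiallySupported ρ v) (t : ℝ) :
    ContDiff ℝ ∞ fun z => v (t, z) :=
  h.smooth.comp (contDiff_const.prodMk contDiff_id)

/-- The time slice as a Schwartz function. -/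
def IsSpatiallySupported.slice (h : IsSpatiallySupported ρ v) (t : ℝ) : 𝓢(E3, ℂ) :=
  (h.hasCompactSupport_slice t).toSchwartzMap (h.contDiff_slice t)

theorem IsSpatiallySupported.coe_slice (h : IsSpatiallySupported ρ v) (t : ℝ) :
    (h.slice t : E3 → ℂ) = fun z => v (t, z) := rfl

/-- The time derivative of a function on space-time. -/
def timeDeriv (v : ℝ × E3 → ℂ) (p : ℝ × E3) : ℂ := fderiv ℝ v p (1, 0)

theorem IsSpatiallySupported.timeDeriv (h : IsSpatiallySupported ρ v) :
    IsSpatiallySupported ρ (timeDeriv v) where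
  smooth := (h.smooth.fderiv_right (m := ∞) (by simp)).clm_apply contDiff_const
  eq_zero t z hz := by
    have h1 := hasDerivAt_time (h.smooth.of_le (by simp)) t z
    have h2 : (fun τ => v (τ, z)) = fun _ => 0 := funext fun τ => h.eq_zero τ z hz
    rw [h2] at h1
    exact h1.unique (hasDerivAt_const t 0)

theorem IsSpatiallySupported.hasDerivAt_fourier (h : IsSpatiallySupported ρ v) (ξ : E3) (t : ℝ) :
    HasDerivAt (fun t => 𝓕 (fun z => v (t, z)) ξ) (𝓕 (fun z => RadiationField.timeDeriv v (t, z)) ξ) t := by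
  have hc := h.smooth.continuous
  have hc' := h.timeDeriv.smooth.continuous
  obtain ⟨C, hC⟩ := ((isCompact_Icc (a := t - 1) (b := t + 1)).prod
    (isCompact_closedBall (0 : E3) ρ)).exists_bound_of_continuousOn hc'.continuousOn
  simp only [Real.fourier_eq', smul_eq_mul]
  refine (hasDerivAt_integral_of_dominated_loc_of_deriv_le (s := Set.Icc (t - 1) (t + 1))
    (F' := fun t z => Complex.exp (((-2 * Real.pi * inner ℝ z ξ : ℝ) : ℂ) * Complex.I) *
      RadiationField.timeDeriv v (t, z))
    (bound := (Metric.closedBall (0 : E3) ρ).indicator fun _ => C)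
    (Icc_mem_nhds (by linarith) (by linarith)) ?_ ?_ ?_ ?_ ?_ ?_).2
  · exact .of_forall fun τ => Continuous.aestronglyMeasurable (by fun_prop)
  · refine Continuous.integrable_of_hasCompactSupport (by fun_prop) ?_
    exact (h.hasCompactSupport_slice t).mul_left
  · exact Continuous.aestronglyMeasurable (by fun_prop)
  · refine .of_forall fun z τ hτ => ?_
    rw [norm_mul, Complex.norm_exp_ofReal_mul_I, one_mul]
    by_cases hz : z ∈ Metric.closedBall (0 : E3) ρ
    · rw [Set.indicator_of_mem hz]
      exact hC (τ, z) ⟨hτ, hz⟩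
    · rw [Set.indicator_of_notMem hz, h.timeDeriv.eq_zero τ z (by simpa using hz), norm_zero]
  · rw [integrable_indicator_iff measurableSet_closedBall]
    exact integrableOn_const (measure_closedBall_lt_top.ne)
  · refine .of_forall fun z τ _ => ?_
    exact (hasDerivAt_time (h.smooth.of_le (by simp)) τ z).const_mul _

theorem IsSpatiallySupported.continuous_fourier (h : IsSpatiallySupported ρ v) (ξ : E3) :
    Continuous fun t => 𝓕 (fun z => v (t, z)) ξ :=
  continuous_iff_continuousAt.2 fun t => (h.hasDerivAt_fourier ξ t).continuousAt

theorem IsSpatiallySupported.fourier_waveOp (h : IsSpatiallySupported ρ v) (ξ : E3) (t : ℝ) :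
    𝓕 (fun z => waveOp v (t, z)) ξ =
      𝓕 (fun z => RadiationField.timeDeriv (RadiationField.timeDeriv v) (t, z)) ξ +
      (2 * Real.pi * ‖ξ‖ : ℂ) ^ 2 * 𝓕 (fun z => v (t, z)) ξ := by
  have e1 : (fun z => waveOp v (t, z)) =
      (h.timeDeriv.timeDeriv.slice t - Δ (h.slice t) : 𝓢(E3, ℂ)) := by
    funext z
    rw [_root_.sub_apply, SchwartzMap.laplacian_apply, h.coe_slice,
      laplacian_slice (h.smooth.of_le two_le_infty), h.timeDeriv.timeDeriv.coe_slice]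
    have h1 := hasDerivAt_time_two (h.smooth.of_le two_le_infty) t z
    have h2 := hasDerivAt_time (h.timeDeriv.smooth.of_le (by simp)) t z
    have h3 := h2.unique h1
    simp only [waveOp]
    rw [← h3]
    rfl
  rw [e1, ← SchwartzMap.fourier_coe, SchwartzMap.laplacian_eq_fourierMultiplierCLM, sub_eq_add_neg,
    ← neg_smul, FourierTransform.fourier_add, _root_.add_apply, FourierTransform.fourier_smul,
    SchwartzMap.fourierMultiplierCLM_apply, FourierTransform.fourier_fourierInv_eq, _root_.smul_apply,
    SchwartzMap.smulLeftCLM_apply_apply (by fun_prop), SchwartzMap.fourier_coe, SchwartzMap.fourier_coe,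
    h.coe_slice, h.timeDeriv.timeDeriv.coe_slice]
  simp only [Complex.real_smul]
  push_cast
  ring

/-- The Fourier transform of the wave, split into the two half waves (`ε = ±1`). -/
def halfWave (v : ℝ × E3 → ℂ) (ε : ℝ) (ξ : E3) (t : ℝ) : ℂ :=
  𝓕 (fun z => timeDeriv v (t, z)) ξ +
    Complex.I * (ε * (2 * Real.pi * ‖ξ‖) : ℝ) * 𝓕 (fun z => v (t, z)) ξ

/-- The oscillating factor `e^{-iε2π‖ξ‖t}`. -/
def phase (ε t : ℝ) (ξ : E3) : ℂ := Complex.exp ((-(ε * (2 * Real.pi * ‖ξ‖) * t) : ℝ) * Complex.I)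

theorem norm_phase (ε t : ℝ) (ξ : E3) : ‖phase ε t ξ‖ = 1 := Complex.norm_exp_ofReal_mul_I _

@[fun_prop]
theorem continuous_phase (ε : ℝ) : Continuous fun q : ℝ × E3 => phase ε q.1 q.2 := by
  unfold phase
  fun_prop

theorem phase_add (ε s t : ℝ) (ξ : E3) : phase ε (s + t) ξ = phase ε s ξ * phase ε t ξ := by
  unfold phase
  rw [← Complex.exp_add]
  congr 1
  push_cast
  ring

theorem phase_zero (ε : ℝ) (ξ : E3) : phase ε 0 ξ = 1 := by simp [phase]

theorem hasDerivAt_phase (ε t : ℝ) (ξ : E3) : HasDerivAt (fun t => phase ε t ξ)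
    (-(Complex.I * (ε * (2 * Real.pi * ‖ξ‖) : ℝ)) * phase ε t ξ) t := by
  unfold phase
  have h1 : HasDerivAt (fun t : ℝ => ((-(ε * (2 * Real.pi * ‖ξ‖) * t) : ℝ) : ℂ) * Complex.I)
      (((-(ε * (2 * Real.pi * ‖ξ‖) * 1) : ℝ) : ℂ) * Complex.I) t :=
    ((((hasDerivAt_id t).const_mul _).neg).ofReal_comp).mul_const _
  convert h1.cexp using 1
  push_cast
  ring

/-- Duhamel's formula for the half waves. -/
theorem IsSpatiallySupported.phase_mul_halfWave (h : IsSpatiallySupported ρ v) {f : ℝ × E3 → ℂ}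
    {ρ' : ℝ} (hf : IsSpatiallySupported ρ' f) {a b : ℝ} (hab : a ≤ b)
    (hw : ∀ t ∈ Set.Ioo a b, ∀ z, waveOp v (t, z) = f (t, z)) {ε : ℝ} (hε : ε ^ 2 = 1) (ξ : E3) :
    phase ε b ξ * halfWave v ε ξ b = phase ε a ξ * halfWave v ε ξ a +
      ∫ t in a..b, phase ε t ξ * 𝓕 (fun z => f (t, z)) ξ := by
  have hd : ∀ t, HasDerivAt (halfWave v ε ξ)
      (𝓕 (fun z => RadiationField.timeDeriv (RadiationField.timeDeriv v) (t, z)) ξ +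
      Complex.I * (ε * (2 * Real.pi * ‖ξ‖) : ℝ) *
        𝓕 (fun z => RadiationField.timeDeriv v (t, z)) ξ) t := fun t =>
    (h.timeDeriv.hasDerivAt_fourier ξ t).add ((h.hasDerivAt_fourier ξ t).const_mul _)
  -- The phase is an integrating factor: the first-order terms cancel and only the transform of the
  -- d'Alembertian survives.
  have hp : ∀ t, HasDerivAt (fun t => phase ε t ξ * halfWave v ε ξ t)
      (phase ε t ξ * 𝓕 (fun z => waveOp v (t, z)) ξ) t := fun t => by
    refine ((hasDerivAt_phase ε t ξ).mul (hd t)).congr_deriv ?_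
    rw [h.fourier_waveOp ξ t]
    have hε' : (ε : ℂ) ^ 2 = 1 := by exact_mod_cast hε
    unfold halfWave
    push_cast
    linear_combination (phase ε t ξ * (2 * Real.pi * ‖ξ‖) ^ 2 * 𝓕 (fun z => v (t, z)) ξ) *
      (hε' - ε ^ 2 * Complex.I_sq)
  have hcf := hf.continuous_fourier ξ
  have hcp : Continuous fun t => phase ε t ξ :=
    (continuous_phase ε).comp (f := fun t : ℝ => (t, ξ)) (by fun_prop)
  have key := intervalIntegral.integral_eq_sub_of_hasDerivAt_of_le hab
    (f := fun t => phase ε t ξ * halfWave v ε ξ t)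
    (f' := fun t => phase ε t ξ * 𝓕 (fun z => f (t, z)) ξ)
    (fun t _ => (hp t).continuousAt.continuousWithinAt) (fun t ht => by
      have := hp t
      rwa [show (fun z => waveOp v (t, z)) = fun z => f (t, z) from funext (hw t ht)] at this)
    ((hcp.mul hcf).intervalIntegrable _ _)
  rw [key]
  ring

/-- On a bounded time interval, a wave with compactly supported data agrees with a function of
compact support in space. -/
theorem IsSmoothWave.exists_isSpatiallySupported {φ ψ : E3 → ℂ} {f u : ℝ × E3 → ℂ}
    (h : IsSmoothWave φ ψ f u) {R : ℝ}
    (hφ : ∀ z, R < ‖z‖ → φ z = 0) (hψ : ∀ z, R < ‖z‖ → ψ z = 0)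
    (hf : ∀ t z, R < ‖z‖ → f (t, z) = 0) {M : ℝ} (hM : 0 < M) :
    ∃ (ρ : ℝ) (v : ℝ × E3 → ℂ), IsSpatiallySupported ρ v ∧
      (∀ t ∈ Set.Icc 0 M, ∀ z, v (t, z) = u (t, z)) ∧
      (∀ t ∈ Set.Ico 0 M, ∀ z, timeDeriv v (t, z) = timeDeriv u (t, z)) ∧
      ∀ t ∈ Set.Ioo 0 M, ∀ z, waveOp v (t, z) = f (t, z) := by
  set r := |R| + M with hr
  have hr0 : 0 < r := by positivity
  have hRr : R + M ≤ r := by linarith [le_abs_self R]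
  let χ : ContDiffBump (0 : E3) := ⟨r + 1, r + 2, by linarith, by linarith⟩
  set v : ℝ × E3 → ℂ := fun p => (χ p.2 : ℂ) * u p with hv
  have hvs : ContDiff ℝ ∞ v :=
    (Complex.ofRealCLM.contDiff.comp (χ.contDiff.comp contDiff_snd)).mul h.smooth
  have huz : ∀ t, 0 ≤ t → t ≤ M → ∀ z : E3, r < ‖z‖ → u (t, z) = 0 := fun t h0 hM z hz =>
    h.eq_zero hφ hψ hf h0 (by linarith)
  have huv : ∀ t, 0 ≤ t → t ≤ M → ∀ z, v (t, z) = u (t, z) := fun t h0 hM z => by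
    by_cases hz : ‖z‖ ≤ r
    · have : χ z = 1 := χ.one_of_mem_closedBall (by
        rw [mem_closedBall_zero_iff]
        exact hz.trans (by linarith [show χ.rIn = r + 1 from rfl]))
      simp [hv, this]
    · have := huz t h0 hM z (not_le.1 hz)
      simp [hv, this]
  -- At t = 0 the two functions are known to agree only at later times, so derivatives from the
  -- right are compared.
  have hdt : ∀ t ∈ Set.Ico 0 M, ∀ z, timeDeriv v (t, z) = timeDeriv u (t, z) := fun t ht z => by
    have h1 := (hasDerivAt_time (hvs.of_le (by simp)) t z).hasDerivWithinAt (s := Set.Ici t)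
    have h2 := (hasDerivAt_time (h.smooth.of_le (by simp)) t z).hasDerivWithinAt (s := Set.Ici t)
    have h3 := h2.congr_of_eventuallyEq (f₁ := fun τ => v (τ, z)) (by
      filter_upwards [self_mem_nhdsWithin, mem_nhdsWithin_of_mem_nhds (Iio_mem_nhds ht.2)] with τ h4 h5
      exact huv τ (ht.1.trans h4) (le_of_lt h5) z) (huv t ht.1 ht.2.le z)
    exact (uniqueDiffWithinAt_Ici t).eq_deriv _ h1 h3
  refine ⟨r + 2, v, ⟨hvs, fun t z hz => ?_⟩, fun t ht => huv t ht.1 ht.2, hdt, fun t ht z => ?_⟩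
  · have : χ z = 0 := by
      refine χ.zero_of_le_dist ?_
      rw [dist_zero_right]
      exact hz.le
    simp [hv, this]
  · have hev : v =ᶠ[𝓝 (t, z)] u := by
      have : Set.Ioo 0 M ×ˢ Set.univ ∈ 𝓝 (t, z) :=
        prod_mem_nhds (Ioo_mem_nhds ht.1 ht.2) univ_mem
      filter_upwards [this] with p hp
      exact huv p.1 hp.1.1.le hp.1.2.le p.2
    have h2 : waveOp v (t, z) = waveOp u (t, z) := by
      simp only [waveOp, hev.fderiv.fderiv_eq]
    rw [h2, ← waveOp_eq (h.smooth.of_le two_le_infty)]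
    exact h.wave t ht.1 z

end HalfWaves

section RadiationFieldNorm

/-! ### The norm of the radiation field -/

open FourierTransform

/-- The difference of the two half waves is 2i·2π|ξ| times the transform X of the wave. Solving for
X, the half wave ε = 1 at ξ = σw is a plane wave in direction w with frequency σ, and the half wave
ε = -1 is one in direction -w with frequency -σ. -/
theorem planeKernel_eq_of_halfWaves (A B : 𝓢(E3, ℂ)) {X : ℂ} {σ : ℝ} (hσ : 0 < σ) (w : S2) (z : E3)
    (t : ℝ)
    (hX : 2 * Complex.I * (2 * Real.pi * σ) * X =
      phase 1 (-t) (σ • (w : E3)) * (B (σ • (w : E3)) + Complex.I * (2 * Real.pi * σ) * A (σ • (w : E3)))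
      - phase (-1) (-t) (σ • (w : E3)) *
        (B (σ • (w : E3)) - Complex.I * (2 * Real.pi * σ) * A (σ • (w : E3)))) :
    (σ ^ 2 : ℝ) • (Complex.exp ((2 * Real.pi * inner ℝ (σ • (w : E3)) z : ℝ) * Complex.I) • X) =
      planeKernel A B (σ, w) * Complex.exp (2 * Real.pi * σ * (t + inner ℝ z (w : E3) : ℝ) * Complex.I)
      + planeKernel A B (-σ, -w) *
        Complex.exp (-(2 * Real.pi * σ * (t - inner ℝ z (w : E3) : ℝ) * Complex.I)) := by
  have hn : ‖σ • (w : E3)‖ = σ := by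
    rw [norm_smul, norm_eq_of_mem_sphere, mul_one, Real.norm_of_nonneg hσ.le]
  have e1 : Complex.exp (2 * Real.pi * σ * (t + inner ℝ z (w : E3) : ℝ) * Complex.I) =
      phase 1 (-t) (σ • (w : E3)) *
        Complex.exp ((2 * Real.pi * inner ℝ (σ • (w : E3)) z : ℝ) * Complex.I) := by
    rw [phase, ← Complex.exp_add, hn, real_inner_smul_left, real_inner_comm]
    congr 1
    push_cast
    ring
  have e2 : Complex.exp (-(2 * Real.pi * σ * (t - inner ℝ z (w : E3) : ℝ) * Complex.I)) =
      phase (-1) (-t) (σ • (w : E3)) *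
        Complex.exp ((2 * Real.pi * inner ℝ (σ • (w : E3)) z : ℝ) * Complex.I) := by
    rw [phase, ← Complex.exp_add, hn, real_inner_smul_left, real_inner_comm]
    congr 1
    push_cast
    ring
  have e3 : planeKernel A B (-σ, -w) = 2⁻¹ * (σ ^ 2 * A (σ • (w : E3)) -
      (2 * Real.pi * Complex.I)⁻¹ * (σ * B (σ • (w : E3)))) := by
    simp [planeKernel, sub_eq_add_neg]
  have hI : (Complex.I : ℂ) ≠ 0 := Complex.I_ne_zero
  have hpi : (Real.pi : ℂ) ≠ 0 := by exact_mod_cast Real.pi_ne_zero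
  have hσ' : (σ : ℂ) ≠ 0 := by exact_mod_cast hσ.ne'
  have hX' : X = (2 * Complex.I * (2 * Real.pi * σ))⁻¹ * (
      phase 1 (-t) (σ • (w : E3)) * (B (σ • (w : E3)) + Complex.I * (2 * Real.pi * σ) * A (σ • (w : E3)))
      - phase (-1) (-t) (σ • (w : E3)) *
        (B (σ • (w : E3)) - Complex.I * (2 * Real.pi * σ) * A (σ • (w : E3)))) := by
    rw [← hX, ← mul_assoc, inv_mul_cancel₀ (by simp [hpi, hσ']), one_mul]
  rw [e1, e2, e3, hX', planeKernel, Complex.real_smul, smul_eq_mul]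
  push_cast
  field_simp
  ring

/-- After the forcing has ceased, a wave with compactly supported data is a superposition of plane
waves. -/
theorem IsSmoothWave.exists_planeWaves {φ ψ : E3 → ℂ} {f u : ℝ × E3 → ℂ}
    (h : IsSmoothWave φ ψ f u) (hfs : ContDiff ℝ ∞ f) {R T : ℝ} (hT : 0 ≤ T)
    (hφ : ∀ z, R < ‖z‖ → φ z = 0) (hψ : ∀ z, R < ‖z‖ → ψ z = 0)
    (hf : ∀ t z, R < ‖z‖ → f (t, z) = 0) (hfT : ∀ t z, T ≤ t → f (t, z) = 0) :
    ∃ A B : 𝓢(E3, ℂ),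
      (∀ t, T ≤ t → ∀ z, u (t, z) =
        ∫ w : S2, waveProfile A B (t - T + inner ℝ z (w : E3)) w ∂sphereMeasure) ∧
      ∀ ε : ℝ, ε ^ 2 = 1 → ∀ ξ, phase ε T ξ *
          (B ξ + Complex.I * (ε * (2 * Real.pi * ‖ξ‖) : ℝ) * A ξ) =
        𝓕 ψ ξ + Complex.I * (ε * (2 * Real.pi * ‖ξ‖) : ℝ) * 𝓕 φ ξ +
          ∫ t in (0 : ℝ)..T, phase ε t ξ * 𝓕 (fun z => f (t, z)) ξ := by
  have hF : IsSpatiallySupported R f := ⟨hfs, hf⟩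
  obtain ⟨ρ, v, hv, hvu, hvu', hvw⟩ := h.exists_isSpatiallySupported hφ hψ hf
    (M := T + 1) (by linarith)
  have hTm : T ∈ Set.Ico 0 (T + 1) := ⟨hT, by linarith⟩
  refine ⟨𝓕 (hv.slice T), 𝓕 (hv.timeDeriv.slice T), fun t ht z => ?_, fun ε hε ξ => ?_⟩
  -- The data at time T are taken from a fixed truncation `v`, but following the wave up to time t
  -- needs a truncation `v'` adapted to t. Both agree with `u` at time T to first order in time.
  · obtain ⟨ρ', v', hv', hvu2, hvu2', hvw2⟩ := h.exists_isSpatiallySupported hφ hψ hf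
      (M := t + 1) (by linarith)
    have hTm' : T ∈ Set.Ico 0 (t + 1) := ⟨hT, by linarith⟩
    have htm : t ∈ Set.Icc 0 (t + 1) := ⟨by linarith, by linarith⟩
    -- Since the forcing vanishes after T, the half waves evolve there by a pure phase.
    have hhw : ∀ ε : ℝ, ε ^ 2 = 1 → ∀ ξ, halfWave v' ε ξ t = phase ε (-(t - T)) ξ *
        (𝓕 (hv.timeDeriv.slice T) ξ +
          Complex.I * (ε * (2 * Real.pi * ‖ξ‖) : ℝ) * 𝓕 (hv.slice T) ξ) := fun ε hε ξ => by
      have h1 := hv'.phase_mul_halfWave hF ht (fun τ hτ => hvw2 τ ⟨hT.trans_lt hτ.1, by linarith [hτ.2]⟩)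
        hε ξ
      have h0 : ∫ τ in T..t, phase ε τ ξ * 𝓕 (fun z => f (τ, z)) ξ = 0 := by
        rw [intervalIntegral.integral_congr (g := fun _ => (0 : ℂ)), intervalIntegral.integral_zero]
        intro τ hτ
        rw [Set.uIcc_of_le ht] at hτ
        have : (fun z => f (τ, z)) = fun _ => 0 := funext fun z => hfT τ z hτ.1
        simp only
        rw [this, Real.fourier_eq]
        simp
      rw [h0, add_zero] at h1
      have e1 : halfWave v' ε ξ T = 𝓕 (hv.timeDeriv.slice T) ξ +
          Complex.I * (ε * (2 * Real.pi * ‖ξ‖) : ℝ) * 𝓕 (hv.slice T) ξ := by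
        rw [halfWave, SchwartzMap.fourier_coe, SchwartzMap.fourier_coe, hv.coe_slice,
          hv.timeDeriv.coe_slice]
        have a1 : (fun z => v' (T, z)) = fun z => v (T, z) := funext fun z => by
          rw [hvu2 T ⟨hTm'.1, hTm'.2.le⟩, hvu T ⟨hTm.1, hTm.2.le⟩]
        have a2 : (fun z => timeDeriv v' (T, z)) = fun z => timeDeriv v (T, z) := funext fun z => by
          rw [hvu2' T hTm', hvu' T hTm]
        rw [a1, a2]
      rw [← e1]
      have e2 : phase ε t ξ * phase ε (-(t - T)) ξ = phase ε T ξ := by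
        rw [← phase_add]
        congr 1
        ring
      have e3 : phase ε t ξ ≠ 0 := Complex.exp_ne_zero _
      refine mul_left_cancel₀ e3 ?_
      rw [h1, ← e2, mul_assoc]
    have hinv : 𝓕⁻ (𝓕 (hv'.slice t)) z = u (t, z) := by
      rw [FourierTransform.fourierInv_fourier_eq, hv'.coe_slice]
      exact hvu2 t htm z
    rw [← hinv, SchwartzMap.fourierInv_coe, Real.fourierInv_eq']
    refine integral_eq_planeWaves _ _ ?_ (t - T) z fun σ hσ w => ?_
    · have hi := (𝓕 (hv'.slice t)).integrable (μ := volume)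
      refine hi.norm.mono' ?_ (.of_forall fun ξ => ?_)
      · have := (𝓕 (hv'.slice t)).continuous
        exact Continuous.aestronglyMeasurable (by fun_prop)
      · rw [norm_smul, Complex.norm_exp_ofReal_mul_I, one_mul]
    · refine planeKernel_eq_of_halfWaves _ _ hσ w z (t - T) ?_
      have hn : ‖σ • (w : E3)‖ = σ := by
        rw [norm_smul, norm_eq_of_mem_sphere, mul_one, Real.norm_of_nonneg hσ.le]
      have h1 := hhw 1 (by norm_num) (σ • (w : E3))
      have h2 := hhw (-1) (by norm_num) (σ • (w : E3))
      rw [halfWave, hn] at h1 h2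
      push_cast at h1 h2
      rw [SchwartzMap.fourier_coe (hv'.slice t), hv'.coe_slice]
      linear_combination h1 - h2
  · have h1 := hv.phase_mul_halfWave hF hT (fun τ hτ => hvw τ ⟨hτ.1, by linarith [hτ.2]⟩) hε ξ
    rw [phase_zero, one_mul] at h1
    have a1 : (fun z => v (0, z)) = φ := funext fun z => by
      rw [hvu 0 ⟨le_rfl, by linarith⟩, h.init]
    have a2 : (fun z => timeDeriv v (0, z)) = ψ := funext fun z => by
      rw [hvu' 0 ⟨le_rfl, by linarith⟩, ← h.init_deriv]
      exact (hasDerivAt_time (h.smooth.of_le (by simp)) 0 z).deriv.symm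
    rw [halfWave, halfWave, a1, a2] at h1
    rw [SchwartzMap.fourier_coe, SchwartzMap.fourier_coe, hv.coe_slice, hv.timeDeriv.coe_slice]
    exact h1

theorem IsProfile.integrable {h : ℝ → S2 → ℂ} (hh : IsProfile h) (w : S2) :
    Integrable fun s => h s w := by
  obtain ⟨C, hC⟩ := hh.bound
  exact (integrable_inv_one_add_sq.const_mul C).mono'
    (hh.cont.comp (f := fun s => (s, w)) (by fun_prop)).aestronglyMeasurable
    (.of_forall fun y => hC y w)

theorem hasDerivAt_integral_Ioi {k : ℝ → ℂ} (hk : Continuous k) (hi : Integrable k) (s : ℝ) :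
    HasDerivAt (fun s => ∫ y in Set.Ioi s, k y) (-k s) s := by
  have h1 : (fun s => ∫ y in Set.Ioi s, k y) =
      fun s => (∫ y, k y) - ((∫ y in Set.Iic 0, k y) + ∫ y in (0 : ℝ)..s, k y) := by
    funext s
    have h2 := intervalIntegral.integral_Iic_sub_Iic (a := 0) (b := s) hi.integrableOn hi.integrableOn
    have h3 := intervalIntegral.integral_Iic_add_Ioi (b := s) hi.integrableOn hi.integrableOn
    rw [← h2, ← h3]
    ring
  rw [h1]
  have h4 := hk.integral_hasStrictDerivAt 0 s
  simpa using (h4.hasDerivAt.const_add (∫ y in Set.Iic 0, k y)).const_sub (∫ y, k y)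

/-- The radiation field in terms of the plane wave profile. -/
theorem IsSmoothRadiationField.eq_waveProfile {u : ℝ × E3 → ℂ} {G : ℝ × S2 → ℂ}
    (hG : IsSmoothRadiationField u G) {A B : 𝓢(E3, ℂ)} {T : ℝ}
    (hu : ∀ t, T ≤ t → ∀ z, u (t, z) =
        ∫ w : S2, waveProfile A B (t - T + inner ℝ z (w : E3)) w ∂sphereMeasure) (s : ℝ) (θ : S2) :
    G (s, θ) = -(2 * Real.pi * waveProfile A B (s - T) (-θ)) := by
  have hp := isProfile_waveProfile A B
  obtain ⟨v₀, hv₀, hd⟩ := hG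
  obtain ⟨C, hC⟩ := hp.bound
  obtain ⟨m, hm, hm0, hmm⟩ := hp.modulus (-θ)
  -- At time s + r and position rθ the plane wave argument is (s - T) + r(1 - τ·w) with τ = -θ, so
  -- the profile concentrates at -θ.
  have hlim : ∀ s, v₀ s θ = 2 * Real.pi * ∫ y in Set.Ioi (s - T), waveProfile A B y (-θ) := by
    intro s
    refine tendsto_nhds_unique (hv₀ s θ) ?_
    refine (tendsto_integral_sphere_scaled (-θ) hp.cont hC hm hm0 hmm (s - T)).congr' ?_
    filter_upwards [eventually_ge_atTop (T - s)] with r hr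
    rw [hu (s + r) (by linarith)]
    congr 1
    refine integral_congr_ae (.of_forall fun w => ?_)
    simp only [Metric.sphere]
    congr 1
    rw [real_inner_smul_left, show ((-θ : S2) : E3) = -(θ : E3) from rfl, inner_neg_left]
    ring
  have hk : Continuous fun y => waveProfile A B y (-θ) :=
    hp.cont.comp (f := fun s => (s, -θ)) (by fun_prop)
  have h1 := (hasDerivAt_integral_Ioi hk (hp.integrable _) (s - T)).comp_sub_const s T
  have h2 : HasDerivAt (fun s => v₀ s θ) (2 * Real.pi * -waveProfile A B (s - T) (-θ)) s := by
    rw [show (fun s => v₀ s θ) = fun s => 2 * Real.pi * ∫ y in Set.Ioi (s - T),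
      waveProfile A B y (-θ) from funext hlim]
    exact h1.const_mul _
  rw [(hd s θ).unique h2]
  ring

theorem integrable_profile_sq {h : ℝ → S2 → ℂ} (hh : IsProfile h) :
    Integrable (fun q : ℝ × S2 => ‖h q.1 q.2‖ ^ 2) cylMeasure := by
  obtain ⟨C, hC⟩ := hh.bound
  have h1 : Integrable (fun q : ℝ × S2 => (C ^ 2 * (1 + q.1 ^ 2)⁻¹) * 1) cylMeasure :=
    (integrable_inv_one_add_sq.const_mul (C ^ 2)).mul_prod
      (integrable_const (1 : ℝ) : Integrable (fun _ : S2 => (1 : ℝ)) sphereMeasure)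
  have hc := hh.cont
  refine h1.mono' (Continuous.aestronglyMeasurable (by fun_prop)) (.of_forall fun q => ?_)
  rw [norm_pow, norm_norm, mul_one]
  have h0 := pow_le_pow_left₀ (norm_nonneg _) (hC q.1 q.2) 2
  have h1 : (1 + q.1 ^ 2)⁻¹ ≤ 1 := inv_le_one_of_one_le₀ (by nlinarith [sq_nonneg q.1])
  have h2 : 0 ≤ (1 + q.1 ^ 2)⁻¹ := by positivity
  calc _ ≤ (C * (1 + q.1 ^ 2)⁻¹) ^ 2 := h0
    _ = C ^ 2 * (1 + q.1 ^ 2)⁻¹ * (1 + q.1 ^ 2)⁻¹ := by ring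
    _ ≤ C ^ 2 * (1 + q.1 ^ 2)⁻¹ * 1 := mul_le_mul_of_nonneg_left h1 (by positivity)
    _ = _ := mul_one _

theorem integral_norm_sq_shifted_profile (A B : 𝓢(E3, ℂ)) (T : ℝ) {G : ℝ × S2 → ℂ}
    (hG : ∀ s θ, G (s, θ) = -(2 * Real.pi * waveProfile A B (s - T) (-θ))) :
    MemLp G 2 cylMeasure ∧ ∫ q, ‖G q‖ ^ 2 ∂cylMeasure =
      2⁻¹ * ∫ ξ, (4 * Real.pi ^ 2 * ‖ξ‖ ^ 2 * ‖A ξ‖ ^ 2 + ‖B ξ‖ ^ 2) := by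
  have hp := isProfile_waveProfile A B
  have hc := hp.cont
  have hcG : Continuous G := by
    rw [show G = fun q : ℝ × S2 => -(2 * Real.pi * waveProfile A B (q.1 - T) (-q.2)) from
      funext fun q => hG q.1 q.2]
    have : Continuous fun q : ℝ × S2 => waveProfile A B (q.1 - T) (-q.2) :=
      hc.comp (f := fun q : ℝ × S2 => (q.1 - T, -q.2)) (by fun_prop)
    fun_prop
  have hGn : ∀ q : ℝ × S2, ‖G q‖ ^ 2 = 4 * Real.pi ^ 2 * ‖waveProfile A B (q.1 - T) (-q.2)‖ ^ 2 :=
    fun q => by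
      rw [show G q = _ from hG q.1 q.2, norm_neg, norm_mul, mul_pow]
      congr 1
      rw [norm_mul, Complex.norm_real, Real.norm_of_nonneg Real.pi_pos.le]
      norm_num
      ring
  have hpres : MeasurePreserving (fun q : ℝ × S2 => (q.1 - T, -q.2)) cylMeasure cylMeasure := by
    exact (measurePreserving_sub_right volume T).prod
      (map_sphere_toSphere (LinearIsometryEquiv.neg ℝ (E := E3)))
  have hemb : MeasurableEmbedding (fun q : ℝ × S2 => (q.1 - T, -q.2)) :=
    ((Homeomorph.subRight T).prodCongr (Homeomorph.neg S2)).measurableEmbedding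
  have hsq := integrable_profile_sq hp
  have hsq' : Integrable (fun q : ℝ × S2 => ‖waveProfile A B (q.1 - T) (-q.2)‖ ^ 2) cylMeasure :=
    (hpres.integrable_comp_emb hemb).2 hsq
  refine ⟨(memLp_two_iff_integrable_sq_norm hcG.aestronglyMeasurable).2 ?_, ?_⟩
  · simp only [hGn]
    exact hsq'.const_mul _
  · simp only [hGn]
    rw [integral_const_mul,
      hpres.integral_comp hemb (fun q : ℝ × S2 => ‖waveProfile A B q.1 q.2‖ ^ 2),
      integral_prod_symm _ hsq, integral_norm_sq_waveProfile]
    have := Real.pi_pos.ne'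
    field_simp
    ring

/-- The Fourier transform of the data together with the forcing, transported to time `0`. -/
def halfWaveData (φ ψ : E3 → ℂ) (f : ℝ × E3 → ℂ) (ε : ℝ) (ξ : E3) : ℂ :=
  𝓕 ψ ξ + Complex.I * (ε * (2 * Real.pi * ‖ξ‖) : ℝ) * 𝓕 φ ξ +
    ∫ t in Set.Ioi (0 : ℝ), phase ε t ξ * 𝓕 (fun z => f (t, z)) ξ

theorem exists_norm_bound_of_hasCompactSupport {X : Type} [NormedAddCommGroup X] {g : X → ℂ}
    (hg : HasCompactSupport g) : ∃ R, ∀ x, R < ‖x‖ → g x = 0 := by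
  obtain ⟨R, hR⟩ := hg.isCompact.isBounded.subset_closedBall 0
  refine ⟨R, fun x hx => ?_⟩
  by_contra hne
  have := hR (subset_tsupport g hne)
  rw [mem_closedBall_zero_iff] at this
  linarith

/-- The `L²` norm of the radiation field. -/
theorem IsSmoothWave.integral_norm_sq_radiationField {φ ψ : E3 → ℂ} {f u : ℝ × E3 → ℂ}
    {G : ℝ × S2 → ℂ} (h : IsSmoothWave φ ψ f u) (hG : IsSmoothRadiationField u G)
    (hφ : HasCompactSupport φ) (hψ : HasCompactSupport ψ) (hfs : ContDiff ℝ ∞ f)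
    (hf : HasCompactSupport f) :
    MemLp G 2 cylMeasure ∧
      (∀ ε : ℝ, ε ^ 2 = 1 → Integrable fun ξ => ‖halfWaveData φ ψ f ε ξ‖ ^ 2) ∧
      ∫ q, ‖G q‖ ^ 2 ∂cylMeasure =
        4⁻¹ * ((∫ ξ, ‖halfWaveData φ ψ f 1 ξ‖ ^ 2) + ∫ ξ, ‖halfWaveData φ ψ f (-1) ξ‖ ^ 2) := by
  obtain ⟨R₁, h₁⟩ := exists_norm_bound_of_hasCompactSupport hφ
  obtain ⟨R₂, h₂⟩ := exists_norm_bound_of_hasCompactSupport hψ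
  obtain ⟨R₃, h₃⟩ := exists_norm_bound_of_hasCompactSupport hf
  set R := max R₁ (max R₂ R₃)
  have hR1 : R₁ ≤ R := le_max_left _ _
  have hR2 : R₂ ≤ R := (le_max_left _ _).trans (le_max_right _ _)
  have hR3 : R₃ ≤ R := (le_max_right _ _).trans (le_max_right _ _)
  set T := |R₃| + 1 with hTd
  have hT : 0 ≤ T := by positivity
  have hfT : ∀ t z, T ≤ t → f (t, z) = 0 := fun t z ht => h₃ _ (by
    refine lt_of_lt_of_le ?_ (norm_fst_le (t, z))
    simp only [Real.norm_eq_abs]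
    linarith [le_abs_self R₃, le_abs_self t])
  have hfR : ∀ t z, R < ‖z‖ → f (t, z) = 0 := fun t z hz => h₃ _
    ((hR3.trans_lt hz).trans_le (norm_snd_le (t, z)))
  obtain ⟨A, B, hu, hAB⟩ := h.exists_planeWaves hfs hT (fun z hz => h₁ z (hR1.trans_lt hz))
    (fun z hz => h₂ z (hR2.trans_lt hz)) hfR hfT
  obtain ⟨hm, hn⟩ := integral_norm_sq_shifted_profile A B T (fun s θ => hG.eq_waveProfile hu s θ)
  have hdata : ∀ ε : ℝ, ε ^ 2 = 1 → ∀ ξ, halfWaveData φ ψ f ε ξ = phase ε T ξ *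
      (B ξ + Complex.I * (ε * (2 * Real.pi * ‖ξ‖) : ℝ) * A ξ) := fun ε hε ξ => by
    rw [hAB ε hε ξ, halfWaveData, intervalIntegral.integral_of_le hT]
    congr 1
    refine setIntegral_eq_of_subset_of_forall_sdiff_eq_zero measurableSet_Ioi Set.Ioc_subset_Ioi_self
      fun t ht => ?_
    have ht' : T ≤ t := by
      by_contra hlt
      exact ht.2 ⟨ht.1, (not_le.1 hlt).le⟩
    have : (fun z => f (t, z)) = fun _ => 0 := funext fun z => hfT t z ht'
    rw [this, Real.fourier_eq]
    simp
  have hnorm : ∀ ε : ℝ, ε ^ 2 = 1 → ∀ ξ, ‖halfWaveData φ ψ f ε ξ‖ ^ 2 =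
      ‖B ξ + Complex.I * (ε * (2 * Real.pi * ‖ξ‖) : ℝ) * A ξ‖ ^ 2 := fun ε hε ξ => by
    rw [hdata ε hε, norm_mul, norm_phase, one_mul]
  have hA2 := integrable_norm_sq_schwartz A
  have hB2 : Integrable fun ξ => ‖B ξ‖ ^ 2 := (B.memLp 2).integrable_norm_pow (by norm_num)
  have hint : ∀ ε : ℝ, ε ^ 2 = 1 → Integrable fun ξ => ‖halfWaveData φ ψ f ε ξ‖ ^ 2 := by
    intro ε hε
    simp only [hnorm ε hε]
    have hA' : MemLp (fun ξ => Complex.I * (ε * (2 * Real.pi * ‖ξ‖) : ℝ) * A ξ) 2 := by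
      have hAc := A.continuous
      refine (memLp_two_iff_integrable_sq_norm
        (Continuous.aestronglyMeasurable (by fun_prop))).2 ?_
      refine (hA2.const_mul (4 * Real.pi ^ 2)).congr (.of_forall fun ξ => ?_)
      simp only [norm_mul, Complex.norm_I, one_mul, Complex.norm_real, mul_pow, Real.norm_eq_abs,
        sq_abs, hε]
      ring
    exact ((B.memLp 2).add hA').integrable_norm_pow (by norm_num)
  refine ⟨hm, hint, ?_⟩
  rw [hn, ← integral_add (hint 1 (by norm_num)) (hint (-1) (by norm_num)), ← integral_const_mul,
    ← integral_const_mul]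
  refine integral_congr_ae (.of_forall fun ξ => ?_)
  simp only
  rw [hnorm 1 (by norm_num), hnorm (-1) (by norm_num)]
  -- The energy density at time T is half the sum of the squared half waves, and by `hdata` these
  -- differ from `halfWaveData` by a phase only.
  have hpar := parallelogram_law_with_norm ℝ (B ξ)
    (Complex.I * ((1 * (2 * Real.pi * ‖ξ‖) : ℝ) : ℂ) * A ξ)
  have hneg : B ξ + Complex.I * (((-1) * (2 * Real.pi * ‖ξ‖) : ℝ) : ℂ) * A ξ =
      B ξ - Complex.I * ((1 * (2 * Real.pi * ‖ξ‖) : ℝ) : ℂ) * A ξ := by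
    push_cast
    ring
  rw [hneg]
  have hnA : ‖Complex.I * ((1 * (2 * Real.pi * ‖ξ‖) : ℝ) : ℂ) * A ξ‖ =
      2 * Real.pi * ‖ξ‖ * ‖A ξ‖ := by
    rw [norm_mul, norm_mul, Complex.norm_I, one_mul, one_mul, Complex.norm_real,
      Real.norm_of_nonneg (by positivity)]
  rw [hnA] at hpar
  linear_combination (-(4⁻¹ : ℝ)) * hpar

end RadiationFieldNorm

section Multipliers

/-! ### Fourier multipliers and weak derivatives -/

open FourierTransform

/-! ### Bounded multipliers on L². -/

section Multiplier

variable {m : E3 → ℂ} {C : ℝ}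

theorem memLp_mul_of_bound (hm : Measurable m) (hC : ∀ x, ‖m x‖ ≤ C) (v : L2) :
    MemLp (fun x => m x * v x) 2 := by
  refine ((Lp.memLp v).const_mul (C : ℂ)).mono (hm.aestronglyMeasurable.mul (Lp.aestronglyMeasurable v))
    (.of_forall fun x => ?_)
  rw [norm_mul, norm_mul, Complex.norm_real]
  exact mul_le_mul_of_nonneg_right ((hC x).trans (le_abs_self C)) (norm_nonneg _)

/-- Multiplication by a bounded function on `L²`. -/
def mulCLM (hm : Measurable m) (hC : ∀ x, ‖m x‖ ≤ C) : L2 →L[ℂ] L2 :=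
  LinearMap.mkContinuous
    { toFun := fun v => (memLp_mul_of_bound hm hC v).toLp
      map_add' := fun v w => by
        rw [← MemLp.toLp_add]
        refine MemLp.toLp_congr _ _ ?_
        filter_upwards [Lp.coeFn_add v w] with x hx
        simp only [hx, Pi.add_apply]
        ring
      map_smul' := fun c v => by
        rw [RingHom.id_apply, ← MemLp.toLp_const_smul]
        refine MemLp.toLp_congr _ _ ?_
        filter_upwards [Lp.coeFn_smul c v] with x hx
        simp only [hx, Pi.smul_apply, smul_eq_mul]
        ring } C fun v => by
      refine Lp.norm_le_mul_norm_of_ae_le_mul ?_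
      filter_upwards [(memLp_mul_of_bound hm hC v).coeFn_toLp] with x hx
      simp only [LinearMap.coe_mk, AddHom.coe_mk]
      rw [hx, norm_mul]
      exact mul_le_mul_of_nonneg_right (hC x) (norm_nonneg _)

theorem coeFn_mulCLM (hm : Measurable m) (hC : ∀ x, ‖m x‖ ≤ C) (v : L2) :
    mulCLM hm hC v =ᵐ[volume] fun x => m x * v x :=
  (memLp_mul_of_bound hm hC v).coeFn_toLp

theorem mulCLM_comm {m' : E3 → ℂ} {C' : ℝ} (hm : Measurable m) (hC : ∀ x, ‖m x‖ ≤ C)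
    (hm' : Measurable m') (hC' : ∀ x, ‖m' x‖ ≤ C') (v : L2) :
    mulCLM hm hC (mulCLM hm' hC' v) = mulCLM hm' hC' (mulCLM hm hC v) := by
  refine Lp.ext ?_
  filter_upwards [coeFn_mulCLM hm hC (mulCLM hm' hC' v), coeFn_mulCLM hm' hC' (mulCLM hm hC v),
    coeFn_mulCLM hm hC v, coeFn_mulCLM hm' hC' v] with x h1 h2 h3 h4
  rw [h1, h2, h3, h4]
  ring

end Multiplier

theorem L2.norm_sq_eq_integral (v : L2) : ‖v‖ ^ 2 = ∫ x, ‖v x‖ ^ 2 := by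
  have h1 := @L2.inner_def E3 ℂ ℂ _ _ volume _ _ v v
  rw [inner_self_eq_norm_sq_to_K] at h1
  have h2 : (∫ x, inner ℂ (v x) (v x)) = ((∫ x, ‖v x‖ ^ 2 : ℝ) : ℂ) := by
    rw [← integral_complex_ofReal]
    refine integral_congr_ae (.of_forall fun x => ?_)
    simp only
    rw [inner_self_eq_norm_sq_to_K]
    push_cast
    rfl
  rw [h2] at h1
  apply Complex.ofReal_injective
  rw [← h1]
  push_cast
  rfl

/-! ### Weak derivatives as Fourier symbols. -/

section WeakDerivatives

/-- The Fourier symbol of `∂^α`. -/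
def symbol {n : ℕ} (α : Fin n → Fin 3) (ξ : E3) : ℂ :=
  ∏ j, (2 * Real.pi * Complex.I * ((inner ℝ ξ (basisVec (α j)) : ℝ) : ℂ))

theorem symbol_succ {n : ℕ} (α : Fin (n + 1) → Fin 3) (ξ : E3) :
    symbol α ξ = 2 * Real.pi * Complex.I * ((inner ℝ ξ (basisVec (α 0)) : ℝ) : ℂ) *
      symbol (fun j => α j.succ) ξ := by
  simp [symbol, Fin.prod_univ_succ]

theorem inner_hasTemperateGrowth (m : E3) :
    (fun ξ : E3 => ((inner ℝ ξ m : ℝ) : ℂ)).HasTemperateGrowth := by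
  fun_prop

theorem symbol_hasTemperateGrowth {n : ℕ} (α : Fin n → Fin 3) : (symbol α).HasTemperateGrowth := by
  induction n with
  | zero =>
    rw [show symbol α = fun _ => 1 from funext fun ξ => by simp [symbol]]
    exact Function.HasTemperateGrowth.const _
  | succ n ih =>
    rw [show symbol α = fun ξ => (2 * Real.pi * Complex.I * ((inner ℝ ξ (basisVec (α 0)) : ℝ) : ℂ)) *
      symbol (fun j => α j.succ) ξ from funext fun ξ => symbol_succ α ξ]
    exact ((Function.HasTemperateGrowth.const (2 * Real.pi * Complex.I)).mul
      (inner_hasTemperateGrowth (basisVec (α 0)))).mul (ih _)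

theorem fourier_iteratedLineDerivOp {n : ℕ} (α : Fin n → Fin 3) (T : 𝓢'(E3, ℂ)) :
    𝓕 (∂^{fun j => basisVec (α j)} T) =
      TemperedDistribution.smulLeftCLM ℂ (symbol α) (𝓕 T) := by
  induction n with
  | zero =>
    rw [show symbol α = fun _ => 1 from funext fun ξ => by simp [symbol],
      TemperedDistribution.smulLeftCLM_const, one_smul]
    rfl
  | succ n ih =>
    rw [LineDeriv.iteratedLineDerivOp_succ_left, TemperedDistribution.fourier_lineDerivOp_eq]
    rw [show (Fin.tail fun j => basisVec (α j)) = fun j : Fin n => basisVec (α j.succ) from rfl,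
      ih fun j => α j.succ,
      TemperedDistribution.smulLeftCLM_smulLeftCLM_apply (symbol_hasTemperateGrowth _)
        (inner_hasTemperateGrowth _)]
    rw [show symbol α = (2 * Real.pi * Complex.I : ℂ) • (symbol (fun j : Fin n => α j.succ) *
      fun ξ : E3 => ((inner ℝ ξ (basisVec (α 0)) : ℝ) : ℂ)) from funext fun ξ => by
        rw [symbol_succ]
        simp
        ring]
    rw [TemperedDistribution.smulLeftCLM_smul
      ((symbol_hasTemperateGrowth _).mul (inner_hasTemperateGrowth _))]
    rfl

theorem smulLeftCLM_eq_iff {s : E3 → ℂ} (hs : s.HasTemperateGrowth) (v w : L2) :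
    TemperedDistribution.smulLeftCLM ℂ s (v : 𝓢'(E3, ℂ)) = (w : 𝓢'(E3, ℂ)) ↔
      w =ᵐ[volume] fun ξ => s ξ * v ξ := by
  have hsc : Continuous s := hs.1.continuous
  constructor
  · intro h
    have hlw : LocallyIntegrable w := (Lp.memLp w).locallyIntegrable (by norm_num)
    have hlv : LocallyIntegrable v := (Lp.memLp v).locallyIntegrable (by norm_num)
    have hlsv : LocallyIntegrable fun ξ => s ξ * v ξ := by
      rw [← locallyIntegrableOn_univ] at hlv ⊢
      exact hlv.continuousOn_mul hsc.continuousOn isOpen_univ.isLocallyClosed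
    refine ae_eq_of_integral_contDiff_smul_eq hlw hlsv fun g hg hgc => ?_
    have hgc' : HasCompactSupport fun x => (g x : ℂ) := hgc.comp_left (g := Complex.ofReal) rfl
    have hg' : ContDiff ℝ ∞ fun x => (g x : ℂ) := Complex.ofRealCLM.contDiff.comp hg
    have h1 := congrArg (fun T : 𝓢'(E3, ℂ) => T (hgc'.toSchwartzMap hg')) h
    simp only [TemperedDistribution.smulLeftCLM_apply_apply, Lp.toTemperedDistribution_apply,
      SchwartzMap.smulLeftCLM_apply_apply hs] at h1
    have e1 : ∀ x, (hgc'.toSchwartzMap hg') x = (g x : ℂ) := fun x => rfl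
    simp only [e1, smul_eq_mul] at h1
    simp only [Complex.real_smul]
    rw [← h1]
    refine integral_congr_ae (.of_forall fun x => ?_)
    simp only
    ring
  · intro h
    ext u
    simp only [TemperedDistribution.smulLeftCLM_apply_apply, Lp.toTemperedDistribution_apply,
      SchwartzMap.smulLeftCLM_apply_apply hs, smul_eq_mul]
    refine integral_congr_ae ?_
    filter_upwards [h] with ξ hξ
    rw [hξ]
    ring

theorem isWeakDeriv_iff_fourier {n : ℕ} (α : Fin n → Fin 3) (ψ g : L2) :
    IsWeakDeriv α ψ g ↔ (𝓕 g : L2) =ᵐ[volume] fun ξ => symbol α ξ * (𝓕 ψ : L2) ξ := by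
  rw [← smulLeftCLM_eq_iff (symbol_hasTemperateGrowth α), IsWeakDeriv,
    ← Lp.fourier_toTemperedDistribution_eq, ← Lp.fourier_toTemperedDistribution_eq,
    ← fourier_iteratedLineDerivOp]
  constructor
  · intro h
    rw [h]
  · intro h
    have h' := congrArg (fun T : 𝓢'(E3, ℂ) => (𝓕⁻ T : 𝓢'(E3, ℂ))) h
    simpa only [FourierTransform.fourierInv_fourier_eq] using h'

theorem toTemperedDistribution_injective {p : ℝ≥0∞} [Fact (1 ≤ p)] {v w : Lp ℂ p (volume : Measure E3)}
    (h : (v : 𝓢'(E3, ℂ)) = (w : 𝓢'(E3, ℂ))) : v = w :=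
  LinearMap.ker_eq_bot.1 (Lp.ker_toTemperedDistributionCLM_eq_bot (F := ℂ) (μ := (volume : Measure E3))
    (p := p)) h

theorem weakPartial_eq {φ : HDot1} {i : Fin 3} {g : L2}
    (h : ∂_{basisVec i} ((φ : L6) : 𝓢'(E3, ℂ)) = (g : 𝓢'(E3, ℂ))) : weakPartial φ i = g :=
  toTemperedDistribution_injective ((weakPartial_spec φ i).symm.trans h)

theorem weakPartial_sub (φ φ' : HDot1) (i : Fin 3) :
    weakPartial (φ - φ') i = weakPartial φ i - weakPartial φ' i := by
  refine weakPartial_eq ?_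
  rw [Submodule.coe_sub, ← Lp.toTemperedDistributionCLM_apply ((φ : L6) - (φ' : L6)),
    ← Lp.toTemperedDistributionCLM_apply (weakPartial φ i - weakPartial φ' i), map_sub, map_sub,
    ← LineDeriv.lineDerivOpCLM_apply (R := ℂ), map_sub]
  simp only [LineDeriv.lineDerivOpCLM_apply, Lp.toTemperedDistributionCLM_apply, weakPartial_spec]

/-- An element of Ḣ¹ lies only in L⁶, but its innermost derivative is in L². Peeling it off first
makes the L² Fourier criterion `isWeakDeriv_iff_fourier` available for the remaining ones. -/
theorem isWeakDeriv_hDot1_iff {n : ℕ} (α : Fin (n + 1) → Fin 3) (φ : HDot1) (g : L2) :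
    IsWeakDeriv α (φ : L6) g ↔
      IsWeakDeriv (fun j : Fin n => α j.castSucc) (weakPartial φ (α (Fin.last n))) g := by
  unfold IsWeakDeriv
  rw [LineDeriv.iteratedLineDerivOp_succ_right, weakPartial_spec]
  rfl

end WeakDerivatives

/-! ### The half-wave group and the time integral of the forcing. -/

section Propagator

theorem measurable_phase (ε t : ℝ) : Measurable (phase ε t) :=
  ((continuous_phase ε).comp (f := fun ξ : E3 => (t, ξ)) (by fun_prop)).measurable

/-- Multiplication by `e^{-iε2π‖ξ‖t}` on `L²`. -/
def phaseOp (ε t : ℝ) : L2 →L[ℂ] L2 :=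
  mulCLM (measurable_phase ε t) (C := 1) fun ξ => (norm_phase ε t ξ).le

theorem coeFn_phaseOp (ε t : ℝ) (v : L2) : phaseOp ε t v =ᵐ[volume] fun ξ => phase ε t ξ * v ξ :=
  coeFn_mulCLM _ _ v

theorem norm_phaseOp (ε t : ℝ) (v : L2) : ‖phaseOp ε t v‖ = ‖v‖ := by
  refine le_antisymm (Lp.norm_le_norm_of_ae_le ?_) (Lp.norm_le_norm_of_ae_le ?_) <;>
  · filter_upwards [coeFn_phaseOp ε t v] with ξ hξ
    rw [hξ, norm_mul, norm_phase, one_mul]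

/-- Strong continuity, by dominated convergence with majorant 4|v|². -/
theorem continuous_phaseOp (ε : ℝ) (v : L2) : Continuous fun t => phaseOp ε t v := by
  rw [continuous_iff_continuousAt]
  intro s
  have h1 : ∀ t, ‖phaseOp ε t v - phaseOp ε s v‖ ^ 2 =
      ∫ ξ, ‖phase ε t ξ - phase ε s ξ‖ ^ 2 * ‖v ξ‖ ^ 2 := fun t => by
    rw [L2.norm_sq_eq_integral]
    refine integral_congr_ae ?_
    filter_upwards [Lp.coeFn_sub (phaseOp ε t v) (phaseOp ε s v), coeFn_phaseOp ε t v,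
      coeFn_phaseOp ε s v] with ξ h1 h2 h3
    rw [h1, Pi.sub_apply, h2, h3, ← sub_mul, norm_mul, mul_pow]
  have hv : Integrable fun ξ => ‖v ξ‖ ^ 2 := (Lp.memLp v).integrable_norm_pow (by norm_num)
  have h2 : Tendsto (fun t => ∫ ξ, ‖phase ε t ξ - phase ε s ξ‖ ^ 2 * ‖v ξ‖ ^ 2) (𝓝 s)
      (𝓝 (∫ ξ, ‖phase ε s ξ - phase ε s ξ‖ ^ 2 * ‖v ξ‖ ^ 2)) := by
    refine tendsto_integral_filter_of_dominated_convergence (fun ξ => 4 * ‖v ξ‖ ^ 2) ?_ ?_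
      (hv.const_mul 4) ?_
    · refine .of_forall fun t => AEStronglyMeasurable.mul ?_ hv.aestronglyMeasurable
      exact ((((measurable_phase ε t).sub (measurable_phase ε s)).norm).pow_const 2).aestronglyMeasurable
    · refine .of_forall fun t => .of_forall fun ξ => ?_
      rw [Real.norm_of_nonneg (by positivity)]
      refine mul_le_mul_of_nonneg_right ?_ (by positivity)
      have := norm_sub_le (phase ε t ξ) (phase ε s ξ)
      rw [norm_phase, norm_phase] at this
      nlinarith [norm_nonneg (phase ε t ξ - phase ε s ξ)]
    · refine .of_forall fun ξ => ?_
      have hc : Continuous fun t => ‖phase ε t ξ - phase ε s ξ‖ ^ 2 * ‖v ξ‖ ^ 2 := by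
        have := (continuous_phase ε).comp (f := fun t : ℝ => (t, ξ)) (by fun_prop)
        simp only [Function.comp_def] at this
        fun_prop
      exact hc.tendsto s
  simp only [sub_self, norm_zero, ne_eq, OfNat.ofNat_ne_zero, not_false_eq_true, zero_pow, zero_mul,
    integral_zero] at h2
  refine tendsto_iff_norm_sub_tendsto_zero.2 ?_
  simp only [← h1] at h2
  have h3 := h2.sqrt
  simpa [Real.sqrt_sq] using h3

/-- Joint continuity gives the measurability of t ↦ `phaseOp ε t (𝓕 (f t))` for merely measurable
`f`. It follows from strong continuity because the operators are isometries. -/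
theorem continuous_phaseOp_uncurry (ε : ℝ) : Continuous fun q : ℝ × L2 => phaseOp ε q.1 q.2 := by
  rw [continuous_iff_continuousAt]
  rintro ⟨s, v⟩
  refine tendsto_iff_norm_sub_tendsto_zero.2 ?_
  have h1 : Tendsto (fun q : ℝ × L2 => ‖q.2 - v‖ + ‖phaseOp ε q.1 v - phaseOp ε s v‖) (𝓝 (s, v))
      (𝓝 (‖v - v‖ + ‖phaseOp ε s v - phaseOp ε s v‖)) := by
    have hc : Continuous fun q : ℝ × L2 => phaseOp ε q.1 v :=
      (continuous_phaseOp ε v).comp continuous_fst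
    exact Continuous.tendsto (by fun_prop) (s, v)
  simp only [sub_self, norm_zero, add_zero] at h1
  refine squeeze_zero (fun _ => norm_nonneg _) (fun q => ?_) h1
  calc ‖phaseOp ε q.1 q.2 - phaseOp ε s v‖ =
        ‖phaseOp ε q.1 (q.2 - v) + (phaseOp ε q.1 v - phaseOp ε s v)‖ := by
          rw [map_sub]
          congr 1
          abel
    _ ≤ _ := (norm_add_le _ _).trans (by rw [norm_phaseOp])

theorem integrable_phaseOp_fourier (ε : ℝ) (f : L1L2) :
    Integrable fun t => phaseOp ε t (𝓕 (f t) : L2) := by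
  have hf : Integrable f := L1.integrable_coeFn f
  refine hf.norm.mono' ?_ (.of_forall fun t => le_of_eq ?_)
  · have hc : Continuous fun q : ℝ × L2 => phaseOp ε q.1 (𝓕 q.2 : L2) :=
      (continuous_phaseOp_uncurry ε).comp (continuous_fst.prodMk
        ((FourierTransform.continuous_fourier (E := L2) (F := L2)).comp continuous_snd))
    have hm : AEStronglyMeasurable (fun t : ℝ => (t, f t)) volume :=
      (measurable_id.aestronglyMeasurable).prodMk hf.aestronglyMeasurable
    have h2 := hc.comp_aestronglyMeasurable hm
    simpa only [Function.comp_def] using h2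
  · rw [norm_phaseOp, Lp.norm_fourier_eq]

/-- The contribution of the forcing to the half wave `ε`. -/
def forcing (ε : ℝ) (f : L1L2) : L2 := ∫ t in Set.Ioi (0 : ℝ), phaseOp ε t (𝓕 (f t) : L2)

theorem forcing_sub (ε : ℝ) (f g : L1L2) : forcing ε (f - g) = forcing ε f - forcing ε g := by
  unfold forcing
  rw [← integral_sub (integrable_phaseOp_fourier ε f).integrableOn
    (integrable_phaseOp_fourier ε g).integrableOn]
  refine setIntegral_congr_ae measurableSet_Ioi ?_
  filter_upwards [Lp.coeFn_sub f g] with t ht _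
  rw [ht, Pi.sub_apply, ← map_sub]
  congr 1
  exact (Lp.fourierTransformₗᵢ E3 ℂ).map_sub _ _

theorem norm_forcing_le (ε : ℝ) (f : L1L2) : ‖forcing ε f‖ ≤ ‖f‖ := by
  have hf : Integrable f := L1.integrable_coeFn f
  calc ‖forcing ε f‖ ≤ ∫ t in Set.Ioi (0 : ℝ), ‖f t‖ := by
        refine (norm_integral_le_integral_norm _).trans (le_of_eq ?_)
        simp only [norm_phaseOp, Lp.norm_fourier_eq]
    _ ≤ ∫ t, ‖f t‖ := setIntegral_le_integral hf.norm (.of_forall fun t => norm_nonneg _)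
    _ = ‖f‖ := (L1.norm_eq_integral_norm f).symm

theorem tendsto_forcing (ε : ℝ) {fn : ℕ → L1L2} {f : L1L2} (h : Tendsto fn atTop (𝓝 f)) :
    Tendsto (fun n => forcing ε (fn n)) atTop (𝓝 (forcing ε f)) := by
  rw [tendsto_iff_norm_sub_tendsto_zero] at h ⊢
  refine squeeze_zero (fun _ => norm_nonneg _) (fun n => ?_) h
  rw [← forcing_sub]
  exact norm_forcing_le ε _

/-- The forcing term commutes with weak derivatives. -/
theorem forcing_ae_eq_symbol_mul (ε : ℝ) {n : ℕ} (α : Fin n → Fin 3) {f g : L1L2}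
    (h : ∀ᵐ t, IsWeakDeriv α (f t) (g t)) :
    forcing ε g =ᵐ[volume] fun ξ => symbol α ξ * forcing ε f ξ := by
  have hsm : Measurable (symbol α) := (symbol_hasTemperateGrowth α).1.continuous.measurable
  have hpos : ∀ ξ, (0 : ℝ) < 1 + ‖symbol α ξ‖ := fun ξ => by positivity
  -- The symbol is unbounded, hence no operator on L². After division by 1 + |symbol| both sides are
  -- bounded multipliers, which commute with the Bochner integral and with the phase; the nonzero
  -- weight is cancelled pointwise at the end.
  set w : E3 → ℂ := fun ξ => ((1 + ‖symbol α ξ‖ : ℝ) : ℂ)⁻¹ with hw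
  have hwn : ∀ ξ, ‖w ξ‖ = (1 + ‖symbol α ξ‖)⁻¹ := fun ξ => by
    rw [hw, norm_inv, Complex.norm_real, Real.norm_of_nonneg (hpos ξ).le]
  have hwm : Measurable w := by fun_prop
  have hwC : ∀ ξ, ‖w ξ‖ ≤ 1 := fun ξ => by
    rw [hwn]
    exact inv_le_one_of_one_le₀ (by linarith [norm_nonneg (symbol α ξ)])
  have hpm : Measurable fun ξ => w ξ * symbol α ξ := hwm.mul hsm
  have hpC : ∀ ξ, ‖w ξ * symbol α ξ‖ ≤ 1 := fun ξ => by
    rw [norm_mul, hwn, inv_mul_le_iff₀ (hpos ξ)]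
    linarith
  have key : mulCLM hwm hwC (forcing ε g) = mulCLM hpm hpC (forcing ε f) := by
    unfold forcing
    rw [← ContinuousLinearMap.integral_comp_comm _ (integrable_phaseOp_fourier ε g).integrableOn,
      ← ContinuousLinearMap.integral_comp_comm _ (integrable_phaseOp_fourier ε f).integrableOn]
    refine setIntegral_congr_ae measurableSet_Ioi ?_
    filter_upwards [h] with t ht _
    unfold phaseOp
    rw [mulCLM_comm hwm hwC, mulCLM_comm hpm hpC]
    congr 1
    refine Lp.ext ?_
    filter_upwards [coeFn_mulCLM hwm hwC (𝓕 (g t)), coeFn_mulCLM hpm hpC (𝓕 (f t)),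
      (isWeakDeriv_iff_fourier α (f t) (g t)).1 ht] with ξ h1 h2 h3
    rw [h1, h2, h3]
    ring
  filter_upwards [coeFn_mulCLM hwm hwC (forcing ε g), coeFn_mulCLM hpm hpC (forcing ε f)] with ξ h1 h2
  rw [key, h2] at h1
  have hw0 : w ξ ≠ 0 := inv_ne_zero (by exact_mod_cast (hpos ξ).ne')
  refine mul_left_cancel₀ hw0 ?_
  rw [← h1]
  ring

end Propagator

end Multipliers

section TestFields

/-! ### Radiation fields of test data -/

open FourierTransform

/-! ### Bochner integrals in L² as pointwise integrals. -/

section BochnerPointwise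

/-- The Bochner integral of an `L²`-valued function agrees with the pointwise integral. -/
theorem integral_L2_ae_eq {ν : Measure ℝ} [SigmaFinite ν] {K : ℝ → L2} {k : ℝ × E3 → ℂ} {D : ℝ → ℝ}
    (hK : Integrable K ν) (hk : Continuous k) (hD : Integrable D ν)
    (hkD : ∀ t ξ, ‖k (t, ξ)‖ ≤ D t) (hKk : ∀ᵐ t ∂ν, K t =ᵐ[volume] fun ξ => k (t, ξ)) :
    (∫ t, K t ∂ν : L2) =ᵐ[volume] fun ξ => ∫ t, k (t, ξ) ∂ν := by
  have hprod : ∀ s : Set E3, volume s < ⊤ →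
      Integrable (fun q : ℝ × E3 => k q) (ν.prod (volume.restrict s)) := fun s hs => by
    have : IsFiniteMeasure (volume.restrict s) := ⟨by simpa using hs⟩
    have h1 : Integrable (fun q : ℝ × E3 => D q.1 * 1) (ν.prod (volume.restrict s)) :=
      hD.mul_prod (integrable_const (1 : ℝ))
    exact h1.mono' hk.aestronglyMeasurable (.of_forall fun q => by
      rw [mul_one]
      exact hkD q.1 q.2)
  -- Integration over a set of finite measure is the inner product with its indicator, which passes
  -- through the Bochner integral; on the pointwise side Fubini does the same.
  refine ae_eq_of_forall_setIntegral_eq_of_sigmaFinite (fun s hs hsf => ?_) (fun s hs hsf => ?_)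
    fun s hs hsf => ?_
  · have : IsFiniteMeasure (volume.restrict s) := ⟨by simpa using hsf⟩
    exact ((Lp.memLp (∫ t, K t ∂ν)).restrict s).integrable (by norm_num)
  · exact (hprod s hsf).integral_prod_right
  · rw [← integral_integral_swap (f := fun t ξ => k (t, ξ)) (hprod s hsf),
      ← L2.inner_indicatorConstLp_one (𝕜 := ℂ) hs hsf.ne, ← integral_inner hK]
    refine integral_congr_ae ?_
    filter_upwards [hKk] with t ht
    rw [L2.inner_indicatorConstLp_one (𝕜 := ℂ) hs hsf.ne]
    exact setIntegral_congr_ae hs (ht.mono fun ξ h _ => h)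

theorem IsSpatiallySupported.continuous_fourier_uncurry {ρ : ℝ} {v : ℝ × E3 → ℂ}
    (h : IsSpatiallySupported ρ v) :
    Continuous fun q : ℝ × E3 => 𝓕 (fun z => v (q.1, z)) q.2 := by
  have hc := h.smooth.continuous
  simp only [Real.fourier_eq', smul_eq_mul]
  have h1 : ∀ q : ℝ × E3, ∫ z, Complex.exp (((-2 * Real.pi * inner ℝ z q.2 : ℝ) : ℂ) * Complex.I) *
      v (q.1, z) = ∫ z in Metric.closedBall (0 : E3) ρ,
        Complex.exp (((-2 * Real.pi * inner ℝ z q.2 : ℝ) : ℂ) * Complex.I) * v (q.1, z) := fun q => by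
    refine (setIntegral_eq_integral_of_forall_compl_eq_zero fun z hz => ?_).symm
    rw [h.eq_zero q.1 z (by simpa using hz), mul_zero]
  simp only [h1]
  exact continuous_parametric_integral_of_continuous (by fun_prop) (isCompact_closedBall _ _)

theorem forcing_ae_eq (ε : ℝ) {f : L1L2} {f' : ℝ × E3 → ℂ} (hf' : ContDiff ℝ ∞ f')
    (hc : HasCompactSupport f') (hff : ∀ᵐ t : ℝ, (f t : E3 → ℂ) =ᵐ[volume] fun z => f' (t, z)) :
    forcing ε f =ᵐ[volume] fun ξ => ∫ t in Set.Ioi (0 : ℝ), phase ε t ξ * 𝓕 (fun z => f' (t, z)) ξ := by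
  obtain ⟨R, hR⟩ := exists_norm_bound_of_hasCompactSupport hc
  have hF : IsSpatiallySupported R f' := ⟨hf', fun t z hz => hR _ (hz.trans_le (norm_snd_le (t, z)))⟩
  have hi : Integrable f' := hf'.continuous.integrable_of_hasCompactSupport hc
  have hD : Integrable fun t => ∫ z, ‖f' (t, z)‖ := by
    rw [Measure.volume_eq_prod] at hi
    exact hi.norm.integral_prod_left
  refine integral_L2_ae_eq (k := fun q => phase ε q.1 q.2 * 𝓕 (fun z => f' (q.1, z)) q.2)
    (integrable_phaseOp_fourier ε f).integrableOn ((continuous_phase ε).mul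
    hF.continuous_fourier_uncurry) hD.integrableOn (fun t ξ => ?_) (ae_restrict_of_ae ?_)
  · rw [norm_mul, norm_phase, one_mul]
    exact VectorFourier.norm_fourierIntegral_le_integral_norm _ _ _ _ _
  · filter_upwards [hff] with t ht
    have h1 : f t = (hF.slice t).toLp 2 := Lp.ext (by
      filter_upwards [ht, (hF.slice t).coeFn_toLp 2 volume] with z h1 h2
      rw [h1, h2]
      rfl)
    rw [h1, SchwartzMap.toLp_fourier_eq]
    filter_upwards [coeFn_phaseOp ε t ((𝓕 (hF.slice t)).toLp 2),
      (𝓕 (hF.slice t)).coeFn_toLp 2 volume] with ξ h1 h2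
    rw [h1, h2, SchwartzMap.fourier_coe, hF.coe_slice]

end BochnerPointwise

/-! ### The norm identity in terms of L² classes. -/

section TestData

theorem lineDerivOp_toLp (S : 𝓢(E3, ℂ)) (p : ℝ≥0∞) [Fact (1 ≤ p)] (m : E3) :
    ∂_{m} ((S.toLp p : Lp ℂ p (volume : Measure E3)) : 𝓢'(E3, ℂ)) =
      ((∂_{m} S).toLp 2 : L2) := by
  rw [Lp.toTemperedDistribution_toLp_eq, Lp.toTemperedDistribution_toLp_eq,
    TemperedDistribution.lineDerivOp_toTemperedDistributionCLM_eq]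

theorem toLp_mem_hDot1 (S : 𝓢(E3, ℂ)) : (S.toLp 6 : L6) ∈ HDot1 := by
  intro i
  refine ⟨(∂_{basisVec i} S).toLp 2, ?_⟩
  exact lineDerivOp_toLp S 6 (basisVec i)

/-- A Schwartz function as an element of `Ḣ¹`. -/
def hDot1OfSchwartz (S : 𝓢(E3, ℂ)) : HDot1 := ⟨_, toLp_mem_hDot1 S⟩

theorem weakPartial_hDot1OfSchwartz (S : 𝓢(E3, ℂ)) (i : Fin 3) :
    weakPartial (hDot1OfSchwartz S) i = (∂_{basisVec i} S).toLp 2 :=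
  weakPartial_eq (lineDerivOp_toLp S 6 _)

/-- The symbol `ξⱼ/‖ξ‖`. -/
def rieszSymbol (j : Fin 3) (ξ : E3) : ℂ := ((ξ j / ‖ξ‖ : ℝ) : ℂ)

theorem norm_rieszSymbol_le (j : Fin 3) (ξ : E3) : ‖rieszSymbol j ξ‖ ≤ 1 := by
  rw [rieszSymbol, Complex.norm_real, norm_div, norm_norm]
  exact div_le_one_of_le₀ (PiLp.norm_apply_le ξ j) (norm_nonneg _)

theorem measurable_rieszSymbol (j : Fin 3) : Measurable (rieszSymbol j) := by
  unfold rieszSymbol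
  fun_prop

/-- Multiplication by `ξⱼ/‖ξ‖`. -/
def riesz (j : Fin 3) : L2 →L[ℂ] L2 := mulCLM (measurable_rieszSymbol j) (norm_rieszSymbol_le j)

theorem coeFn_riesz (j : Fin 3) (v : L2) : riesz j v =ᵐ[volume] fun ξ => rieszSymbol j ξ * v ξ :=
  coeFn_mulCLM _ _ v

theorem sum_rieszSymbol_sq {ξ : E3} (hξ : ξ ≠ 0) : ∑ j, rieszSymbol j ξ ^ 2 = 1 := by
  have h1 : ∑ j, (ξ j / ‖ξ‖) ^ 2 = 1 := by
    simp only [div_pow]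
    rw [← Finset.sum_div, EuclideanSpace.norm_sq_eq]
    simp only [Real.norm_eq_abs, sq_abs]
    refine div_self ?_
    have := EuclideanSpace.norm_sq_eq ξ
    simp only [Real.norm_eq_abs, sq_abs] at this
    rw [← this]
    positivity
  have := congrArg (fun x : ℝ => (x : ℂ)) h1
  push_cast at this
  simpa [rieszSymbol] using this

/-- `i‖∇‖φ` on the Fourier side. -/
def gradPotential (φ : HDot1) : L2 := ∑ j, riesz j (𝓕 (weakPartial φ j) : L2)

theorem coeFn_fourier_weakPartial (S : 𝓢(E3, ℂ)) (j : Fin 3) :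
    (𝓕 (weakPartial (hDot1OfSchwartz S) j) : L2) =ᵐ[volume]
      fun ξ => 2 * Real.pi * Complex.I * ((ξ j : ℝ) : ℂ) * 𝓕 S ξ := by
  rw [weakPartial_hDot1OfSchwartz, SchwartzMap.toLp_fourier_eq]
  filter_upwards [(𝓕 (∂_{basisVec j} S)).coeFn_toLp 2 volume] with ξ h1
  rw [h1, SchwartzMap.fourier_lineDerivOp_eq, _root_.smul_apply,
    SchwartzMap.smulLeftCLM_apply_apply (by fun_prop)]
  simp only [smul_eq_mul, Complex.real_smul, basisVec, EuclideanSpace.inner_single_right]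
  simp
  ring

/-- Summing ξⱼ/|ξ| · 2πiξⱼ𝓕φ over j gives 2πi|ξ|𝓕φ. Building this quantity from the gradient keeps
it an L² function for every element of Ḣ¹, whose own Fourier transform is only a distribution. -/
theorem coeFn_gradPotential (S : 𝓢(E3, ℂ)) :
    gradPotential (hDot1OfSchwartz S) =ᵐ[volume]
      fun ξ => Complex.I * (2 * Real.pi * ‖ξ‖ : ℝ) * 𝓕 S ξ := by
  have hne : ∀ᵐ ξ : E3, ξ ≠ 0 := by simp [ae_iff]
  have h1 : ∀ᵐ ξ, ∀ j, (riesz j (𝓕 (weakPartial (hDot1OfSchwartz S) j) : L2)) ξ =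
      rieszSymbol j ξ * (2 * Real.pi * Complex.I * ((ξ j : ℝ) : ℂ) * 𝓕 S ξ) := by
    rw [ae_all_iff]
    intro j
    filter_upwards [coeFn_riesz j (𝓕 (weakPartial (hDot1OfSchwartz S) j)),
      coeFn_fourier_weakPartial S j] with ξ h1 h2
    rw [h1, h2]
  unfold gradPotential
  filter_upwards [Lp.coeFn_finsetSum Finset.univ
    fun j => riesz j (𝓕 (weakPartial (hDot1OfSchwartz S) j) : L2), h1, hne] with ξ h2 h1 h3
  have hn : ((‖ξ‖ : ℝ) : ℂ) ≠ 0 := by exact_mod_cast norm_ne_zero_iff.2 h3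
  have h4 : ∀ j, ((ξ j : ℝ) : ℂ) = rieszSymbol j ξ * ‖ξ‖ := fun j => by
    rw [rieszSymbol]
    push_cast
    field_simp
  rw [h2, Finset.sum_apply]
  simp only [h1]
  have h5 := sum_rieszSymbol_sq h3
  calc ∑ j, rieszSymbol j ξ * (2 * Real.pi * Complex.I * ((ξ j : ℝ) : ℂ) * 𝓕 S ξ) =
        (∑ j, rieszSymbol j ξ ^ 2) * (2 * Real.pi * Complex.I * ‖ξ‖ * 𝓕 S ξ) := by
          rw [Finset.sum_mul]
          refine Finset.sum_congr rfl fun j _ => ?_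
          rw [h4 j]
          ring
    _ = _ := by
          rw [h5]
          push_cast
          ring

/-- On the Fourier side a gradient is a scalar multiple of ξ, so its component along ξ/|ξ|
determines it. This recovers ∇φ from the scalar that enters the norm identity. -/
theorem riesz_gradPotential (S : 𝓢(E3, ℂ)) (j : Fin 3) :
    riesz j (gradPotential (hDot1OfSchwartz S)) = (𝓕 (weakPartial (hDot1OfSchwartz S) j) : L2) := by
  have hne : ∀ᵐ ξ : E3, ξ ≠ 0 := by simp [ae_iff]
  refine Lp.ext ?_
  filter_upwards [coeFn_riesz j (gradPotential (hDot1OfSchwartz S)), coeFn_gradPotential S,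
    coeFn_fourier_weakPartial S j, hne] with ξ h1 h2 h3 h4
  have hn : ((‖ξ‖ : ℝ) : ℂ) ≠ 0 := by exact_mod_cast norm_ne_zero_iff.2 h4
  rw [h1, h2, h3, rieszSymbol]
  push_cast
  field_simp

/-- The boundary data of the radiation field on the Fourier side. -/
def radiationData (ε : ℝ) (φ : HDot1) (ψ : L2) (f : L1L2) : L2 :=
  (𝓕 ψ : L2) + (ε : ℂ) • gradPotential φ + forcing ε f

theorem radiationData_ae_eq (ε : ℝ) (S S' : 𝓢(E3, ℂ)) {f : L1L2} {f' : ℝ × E3 → ℂ}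
    (hf' : ContDiff ℝ ∞ f') (hc : HasCompactSupport f')
    (hff : ∀ᵐ t : ℝ, (f t : E3 → ℂ) =ᵐ[volume] fun z => f' (t, z)) :
    radiationData ε (hDot1OfSchwartz S) (S'.toLp 2) f =ᵐ[volume] halfWaveData S S' f' ε := by
  unfold radiationData
  rw [SchwartzMap.toLp_fourier_eq]
  filter_upwards [Lp.coeFn_add ((𝓕 S').toLp 2 volume + (ε : ℂ) • gradPotential (hDot1OfSchwartz S))
    (forcing ε f), Lp.coeFn_add ((𝓕 S').toLp 2 volume) ((ε : ℂ) • gradPotential (hDot1OfSchwartz S)),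
    Lp.coeFn_smul (ε : ℂ) (gradPotential (hDot1OfSchwartz S)), coeFn_gradPotential S,
    forcing_ae_eq ε hf' hc hff, (𝓕 S').coeFn_toLp 2 volume] with ξ h1 h2 h3 h4 h5 h6
  rw [h1, Pi.add_apply, h2, Pi.add_apply, h3, Pi.smul_apply, h4, h5, h6, halfWaveData,
    SchwartzMap.fourier_coe, SchwartzMap.fourier_coe, smul_eq_mul]
  push_cast
  ring

/-- This is the only form in which the wave equation is used from here on to analyse radiation
fields: test data are Schwartz functions, and the norm of the field is an explicit continuous
function of the data. -/
theorem IsTestRadiationField.exists_schwartz {φ : HDot1} {ψ : L2} {f : L1L2} {G : L2Cyl}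
    (h : IsTestRadiationField φ ψ f G) :
    (∃ S : 𝓢(E3, ℂ), φ = hDot1OfSchwartz S) ∧
      4 * ‖G‖ ^ 2 = ‖radiationData 1 φ ψ f‖ ^ 2 + ‖radiationData (-1) φ ψ f‖ ^ 2 := by
  obtain ⟨φ', ψ', f', u, G', ⟨hφ, hφc⟩, ⟨hψ, hψc⟩, ⟨hf, hfc⟩, hφφ, hψψ, hff, hGG, hu, hG⟩ := h
  set S := hφc.toSchwartzMap hφ
  set S' := hψc.toSchwartzMap hψ
  have e1 : φ = hDot1OfSchwartz S := Subtype.ext (Lp.ext (by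
    filter_upwards [hφφ, S.coeFn_toLp 6 volume] with x h1 h2
    rw [h1]
    exact h2.symm))
  have e2 : ψ = S'.toLp 2 := Lp.ext (by
    filter_upwards [hψψ, S'.coeFn_toLp 2 volume] with x h1 h2
    rw [h1]
    exact h2.symm)
  refine ⟨⟨S, e1⟩, ?_⟩
  obtain ⟨hm, hint, hnorm⟩ := hu.integral_norm_sq_radiationField hG hφc hψc hf hfc
  have hGn : ‖G‖ ^ 2 = ∫ q, ‖G' q‖ ^ 2 ∂cylMeasure := by
    have h1 := @L2.inner_def (ℝ × S2) ℂ ℂ _ _ cylMeasure _ _ G G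
    rw [inner_self_eq_norm_sq_to_K] at h1
    apply Complex.ofReal_injective
    rw [← integral_complex_ofReal]
    refine Eq.trans ?_ (h1.trans (integral_congr_ae ?_))
    · push_cast
      rfl
    · filter_upwards [hGG] with q hq
      rw [inner_self_eq_norm_sq_to_K, hq]
      push_cast
      rfl
  have hZ : ∀ ε : ℝ, ‖radiationData ε φ ψ f‖ ^ 2 = ∫ ξ, ‖halfWaveData φ' ψ' f' ε ξ‖ ^ 2 := fun ε => by
    rw [L2.norm_sq_eq_integral]
    refine integral_congr_ae ?_
    rw [e1, e2]
    filter_upwards [radiationData_ae_eq ε S S' hf hfc hff] with ξ h1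
    rw [h1]
    rfl
  rw [hGn, hnorm, hZ, hZ]
  ring

end TestData

end TestFields

section SobolevSpace

/-! ### The homogeneous Sobolev space -/

open FourierTransform
open scoped Convolution

section HomogeneousSobolev

theorem integral_fderiv_smul_eq_zero {v : L6}
    (hv : ∀ i : Fin 3, ∂_{basisVec i} (v : 𝓢'(E3, ℂ)) = 0) {η : E3 → ℝ} (hη : ContDiff ℝ ∞ η)
    (hηc : HasCompactSupport η) (x : E3) (i : Fin 3) :
    ∫ t, fderiv ℝ η (x - t) (basisVec i) • v t = 0 := by
  set u : E3 → ℂ := fun t => (η (x - t) : ℂ) with hu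
  have hus : ContDiff ℝ ∞ u :=
    Complex.ofRealCLM.contDiff.comp (hη.comp (contDiff_const.sub contDiff_id))
  have huc : HasCompactSupport u := by
    have h1 : HasCompactSupport fun t => η (x - t) :=
      hηc.comp_homeomorph (Homeomorph.subLeft x)
    exact h1.comp_left (g := Complex.ofReal) rfl
  have h1 := congrArg (fun T : 𝓢'(E3, ℂ) => T (huc.toSchwartzMap hus)) (hv i)
  have h0 : (0 : 𝓢'(E3, ℂ)) (huc.toSchwartzMap hus) = 0 := rfl
  simp only [TemperedDistribution.lineDerivOp_apply_apply, h0] at h1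
  rw [Lp.toTemperedDistribution_apply] at h1
  rw [← h1]
  refine integral_congr_ae (.of_forall fun t => ?_)
  simp only
  rw [_root_.neg_apply, SchwartzMap.lineDerivOp_apply_eq_fderiv,
    show ((huc.toSchwartzMap hus : 𝓢(E3, ℂ)) : E3 → ℂ) = u from rfl]
  have h2 : HasFDerivAt u (Complex.ofRealCLM.comp
      ((fderiv ℝ η (x - t)).comp (-ContinuousLinearMap.id ℝ E3))) t := by
    refine Complex.ofRealCLM.hasFDerivAt.comp t ?_
    refine ((hη.differentiable (by simp)) (x - t)).hasFDerivAt.comp t ?_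
    exact (hasFDerivAt_id t).const_sub x
  rw [h2.fderiv]
  simp

/-- The norm on `Ḣ¹` is definite. -/
theorem eq_zero_of_lineDerivOp_eq_zero {v : L6}
    (hv : ∀ i : Fin 3, ∂_{basisVec i} (v : 𝓢'(E3, ℂ)) = 0) : v = 0 := by
  have hloc : LocallyIntegrable v := (Lp.memLp v).locallyIntegrable (by norm_num)
  let χ : ℕ → ContDiffBump (0 : E3) := fun n =>
    ⟨((n : ℝ) + 1)⁻¹, 2 * ((n : ℝ) + 1)⁻¹, by positivity, by
      have : (0 : ℝ) < ((n : ℝ) + 1)⁻¹ := by positivity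
      linarith⟩
  set L := (ContinuousLinearMap.lsmul ℝ ℝ : ℝ →L[ℝ] ℂ →L[ℝ] ℂ)
  -- Mollifications of `v` are smooth with zero gradient, hence constant; letting the mollifier
  -- shrink, `v` is almost everywhere constant.
  have hconst : ∀ n x, (((χ n).normed volume) ⋆[L, volume] v) x =
      (((χ n).normed volume) ⋆[L, volume] v) 0 := fun n x => by
    set η := (χ n).normed volume
    have hη : ContDiff ℝ ∞ η := (χ n).contDiff_normed
    have hηc : HasCompactSupport η := (χ n).hasCompactSupport_normed
    have hη1 : ContDiff ℝ 1 η := hη.of_le (by simp)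
    rw [← convolution_flip]
    have hd := fun y => hηc.hasFDerivAt_convolution_right L.flip hloc hη1 y
    refine is_const_of_fderiv_eq_zero (𝕜 := ℝ) (fun y => (hd y).differentiableAt) (fun y => ?_) x 0
    rw [(hd y).fderiv]
    ext m
    rw [sum_basisVec m, map_sum, _root_.zero_apply]
    refine Finset.sum_eq_zero fun i _ => ?_
    rw [map_smul, convolution_precompR_apply _ hloc (hηc.fderiv (𝕜 := ℝ))
      (hη1.continuous_fderiv (by simp)), convolution_def]
    have h0 := integral_fderiv_smul_eq_zero hv hη hηc y i
    rw [show ∫ t, L.flip (v t) (fderiv ℝ η (y - t) (basisVec i)) =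
      ∫ t, fderiv ℝ η (y - t) (basisVec i) • v t from rfl, h0, smul_zero]
  obtain hlim := ContDiffBump.ae_convolution_tendsto_right_of_locallyIntegrable (φ := χ) (l := atTop)
    (K := 2) (μ := (volume : Measure E3)) (g := v) (by
      have h1 : Tendsto (fun n : ℕ => 2 * ((n : ℝ) + 1)⁻¹) atTop (𝓝 (2 * 0)) :=
        Tendsto.const_mul 2 (tendsto_inv_atTop_zero.comp
          (tendsto_atTop_add_const_right _ 1 tendsto_natCast_atTop_atTop))
      rw [mul_zero] at h1
      exact h1) (.of_forall fun n => le_rfl) hloc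
  have hcst : ∃ c : ℂ, v =ᵐ[volume] fun _ => c := by
    obtain ⟨x₀, hx₀⟩ := hlim.exists
    refine ⟨v x₀, ?_⟩
    filter_upwards [hlim] with x hx
    exact tendsto_nhds_unique (hx.congr fun n => hconst n x) (hx₀.congr fun n => hconst n x₀)
  obtain ⟨c, hc⟩ := hcst
  -- On a space of infinite measure the only constant in L⁶ is zero; this is where the normalization
  -- by L⁶ enters.
  have hmem : MemLp (fun _ : E3 => c) 6 volume := (memLp_congr_ae hc).1 (Lp.memLp v)
  rw [memLp_const_iff (by norm_num) (by norm_num)] at hmem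
  have hc0 : c = 0 := hmem.resolve_right (by simp)
  refine Lp.ext ?_
  filter_upwards [hc, Lp.coeFn_zero ℂ 6 (volume : Measure E3)] with x h1 h2
  rw [h1, h2, hc0]
  rfl

theorem hDot1_ext {φ φ' : HDot1} (h : ∀ i, weakPartial φ i = weakPartial φ' i) : φ = φ' := by
  have h1 : ((φ - φ' : HDot1) : L6) = 0 := eq_zero_of_lineDerivOp_eq_zero fun i => by
    rw [weakPartial_spec, weakPartial_sub, h i, sub_self,
      ← Lp.toTemperedDistributionCLM_apply (0 : L2), map_zero]
  exact sub_eq_zero.1 (Subtype.ext h1)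

/-- The Gagliardo-Nirenberg-Sobolev inequality for `Ḣ¹`. -/
theorem exists_norm_toLp_le : ∃ C : ℝ, 0 ≤ C ∧ ∀ S : 𝓢(E3, ℂ), HasCompactSupport S →
    ‖(S.toLp 6 : L6)‖ ≤ C * ∑ i, ‖weakPartial (hDot1OfSchwartz S) i‖ := by
  set K := SNormLESNormFDerivOfEqConst ℂ (volume : Measure E3) 2
  refine ⟨K, K.coe_nonneg, fun S hS => ?_⟩
  have h1 := eLpNorm_le_eLpNorm_fderiv_of_eq (F := ℂ) (volume : Measure E3) (u := S) (p := 2) (p' := 6)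
    (S.smooth 1) hS (by norm_num) (by simp) (by norm_num)
  have hpart : ∀ i, eLpNorm (fun x => fderiv ℝ S x (basisVec i)) 2 volume =
      ENNReal.ofReal ‖weakPartial (hDot1OfSchwartz S) i‖ := fun i => by
    rw [weakPartial_hDot1OfSchwartz, Lp.norm_def, ENNReal.ofReal_toReal (Lp.eLpNorm_ne_top _)]
    refine eLpNorm_congr_ae ?_
    filter_upwards [(∂_{basisVec i} S).coeFn_toLp 2 volume] with x hx
    rw [hx, SchwartzMap.lineDerivOp_apply_eq_fderiv]
  have h2 : eLpNorm (fderiv ℝ S) 2 volume ≤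
      ∑ i, ENNReal.ofReal ‖weakPartial (hDot1OfSchwartz S) i‖ := by
    simp only [← hpart]
    have hm : ∀ i, AEStronglyMeasurable (fun x => ‖fderiv ℝ S x (basisVec i)‖) volume := fun i => by
      have : Continuous (fderiv ℝ S) := (S.smooth 1).continuous_fderiv (by simp)
      exact Continuous.aestronglyMeasurable (by fun_prop)
    calc eLpNorm (fderiv ℝ S) 2 volume ≤
          eLpNorm (∑ i, fun x => ‖fderiv ℝ S x (basisVec i)‖) 2 volume := by
            refine eLpNorm_mono_real fun x => ?_
            rw [Finset.sum_apply]
            refine ContinuousLinearMap.opNorm_le_bound _ (by positivity) fun y => ?_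
            conv_lhs => rw [sum_basisVec y, map_sum]
            rw [Finset.sum_mul]
            refine (norm_sum_le _ _).trans (Finset.sum_le_sum fun i _ => ?_)
            rw [map_smul, norm_smul, mul_comm]
            exact mul_le_mul_of_nonneg_left (PiLp.norm_apply_le y i) (norm_nonneg _)
      _ ≤ ∑ i, eLpNorm (fun x => ‖fderiv ℝ S x (basisVec i)‖) 2 volume :=
            eLpNorm_sum_le (fun i _ => hm i) (by norm_num)
      _ = _ := by simp only [eLpNorm_norm]
  have h3 : eLpNorm S 6 volume ≤ ENNReal.ofReal (K * ∑ i, ‖weakPartial (hDot1OfSchwartz S) i‖) := by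
    rw [ENNReal.ofReal_mul K.coe_nonneg, ENNReal.ofReal_sum_of_nonneg fun i _ => norm_nonneg _,
      ENNReal.ofReal_coe_nnreal]
    exact_mod_cast h1.trans (mul_le_mul_right h2 _)
  rw [Lp.norm_def, eLpNorm_congr_ae (S.coeFn_toLp 6 volume)]
  exact ENNReal.toReal_le_of_le_ofReal (by positivity) h3

theorem hDot1OfSchwartz_sub (S S' : 𝓢(E3, ℂ)) :
    hDot1OfSchwartz (S - S') = hDot1OfSchwartz S - hDot1OfSchwartz S' := by
  refine Subtype.ext (Lp.ext ?_)
  rw [Submodule.coe_sub]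
  filter_upwards [(S - S').coeFn_toLp 6 volume, Lp.coeFn_sub (hDot1OfSchwartz S : L6)
    (hDot1OfSchwartz S' : L6), S.coeFn_toLp 6 volume, S'.coeFn_toLp 6 volume] with x h1 h2 h3 h4
  rw [h2, Pi.sub_apply]
  exact h1.trans (congrArg₂ (· - ·) h3.symm h4.symm)

/-- Completeness of `Ḣ¹`, for sequences of test functions. -/
theorem exists_hDot1_limit {S : ℕ → 𝓢(E3, ℂ)} (hS : ∀ n, HasCompactSupport (S n)) {g : Fin 3 → L2}
    (hg : ∀ i, Tendsto (fun n => weakPartial (hDot1OfSchwartz (S n)) i) atTop (𝓝 (g i))) :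
    ∃ φ : HDot1, (∀ i, weakPartial φ i = g i) ∧
      Tendsto (fun n => (hDot1OfSchwartz (S n) : L6)) atTop (𝓝 (φ : L6)) := by
  obtain ⟨C, hC, hgns⟩ := exists_norm_toLp_le
  -- The Sobolev inequality for differences turns Cauchy gradients into a Cauchy sequence in L⁶.
  have hcauchy : CauchySeq fun n => (hDot1OfSchwartz (S n) : L6) := by
    rw [cauchySeq_iff_tendsto_dist_atTop_0]
    have h1 : Tendsto (fun q : ℕ × ℕ => C * ∑ i, dist (weakPartial (hDot1OfSchwartz (S q.1)) i)
        (weakPartial (hDot1OfSchwartz (S q.2)) i)) atTop (𝓝 (C * ∑ i : Fin 3, 0)) :=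
      (tendsto_finsetSum _ fun i _ =>
        cauchySeq_iff_tendsto_dist_atTop_0.1 (hg i).cauchySeq).const_mul C
    simp only [Finset.sum_const_zero, mul_zero] at h1
    refine squeeze_zero (fun _ => dist_nonneg) (fun q => ?_) h1
    have h2 := hgns (S q.1 - S q.2) ((hS q.1).sub (hS q.2))
    simp only [hDot1OfSchwartz_sub, weakPartial_sub] at h2
    simp only [dist_eq_norm]
    refine le_trans (le_of_eq ?_) h2
    have := congrArg (fun x : HDot1 => ‖(x : L6)‖) (hDot1OfSchwartz_sub (S q.1) (S q.2))
    exact this.symm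
  obtain ⟨v, hv⟩ := cauchySeq_tendsto_of_complete hcauchy
  have hd : ∀ i, ∂_{basisVec i} (v : 𝓢'(E3, ℂ)) = (g i : 𝓢'(E3, ℂ)) := fun i => by
    have h1 : Tendsto (fun n => LineDeriv.lineDerivOpCLM ℂ 𝓢'(E3, ℂ) (basisVec i)
        (Lp.toTemperedDistributionCLM ℂ volume 6 (hDot1OfSchwartz (S n) : L6))) atTop
        (𝓝 (LineDeriv.lineDerivOpCLM ℂ 𝓢'(E3, ℂ) (basisVec i)
          (Lp.toTemperedDistributionCLM ℂ volume 6 v))) :=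
      (((LineDeriv.lineDerivOpCLM ℂ 𝓢'(E3, ℂ) (basisVec i)).continuous.comp
        (Lp.toTemperedDistributionCLM ℂ (volume : Measure E3) 6).continuous).tendsto v).comp hv
    have h2 : Tendsto (fun n => Lp.toTemperedDistributionCLM ℂ volume 2
        (weakPartial (hDot1OfSchwartz (S n)) i)) atTop
        (𝓝 (Lp.toTemperedDistributionCLM ℂ volume 2 (g i))) :=
      ((Lp.toTemperedDistributionCLM ℂ (volume : Measure E3) 2).continuous.tendsto (g i)).comp (hg i)
    simp only [LineDeriv.lineDerivOpCLM_apply, Lp.toTemperedDistributionCLM_apply,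
      weakPartial_spec] at h1 h2
    exact tendsto_nhds_unique h1 h2
  exact ⟨⟨v, fun i => ⟨g i, hd i⟩⟩, fun i => weakPartial_eq (hd i), hv⟩

theorem tendsto_energy_iff {φ : HDot1} {ψ : L2} {φn : ℕ → HDot1} {ψn : ℕ → L2} :
    Tendsto (fun n => energy (φn n - φ) (ψn n - ψ)) atTop (𝓝 0) ↔
      (∀ i, Tendsto (fun n => weakPartial (φn n) i) atTop (𝓝 (weakPartial φ i))) ∧
        Tendsto ψn atTop (𝓝 ψ) := by
  unfold energy
  simp only [weakPartial_sub]
  constructor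
  · intro h
    refine ⟨fun i => ?_, ?_⟩
    · refine tendsto_iff_norm_sub_tendsto_zero.2
        (squeeze_zero (fun _ => norm_nonneg _) (fun n => Real.le_sqrt_of_sq_le ?_) h)
      have := Finset.single_le_sum (f := fun i => ‖weakPartial (φn n) i - weakPartial φ i‖ ^ 2)
        (fun i _ => by positivity) (Finset.mem_univ i)
      nlinarith [sq_nonneg ‖ψn n - ψ‖]
    · refine tendsto_iff_norm_sub_tendsto_zero.2
        (squeeze_zero (fun _ => norm_nonneg _) (fun n => Real.le_sqrt_of_sq_le ?_) h)
      have : 0 ≤ ∑ i, ‖weakPartial (φn n) i - weakPartial φ i‖ ^ 2 :=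
        Finset.sum_nonneg fun i _ => by positivity
      linarith
  · rintro ⟨h1, h2⟩
    have h3 : Tendsto (fun n => √(∑ i, ‖weakPartial (φn n) i - weakPartial φ i‖ ^ 2 +
        ‖ψn n - ψ‖ ^ 2)) atTop (𝓝 (√(∑ i : Fin 3, (0 : ℝ) ^ 2 + 0 ^ 2))) :=
      ((tendsto_finsetSum _ fun i _ =>
        (tendsto_iff_norm_sub_tendsto_zero.1 (h1 i)).pow 2).add
        ((tendsto_iff_norm_sub_tendsto_zero.1 h2).pow 2)).sqrt
    simpa using h3

theorem continuous_fourier_L2 : Continuous fun v : L2 => (𝓕 v : L2) :=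
  FourierTransform.continuous_fourier (E := L2) (F := L2)

theorem tendsto_gradPotential {φ : HDot1} {φn : ℕ → HDot1}
    (h : ∀ i, Tendsto (fun n => weakPartial (φn n) i) atTop (𝓝 (weakPartial φ i))) :
    Tendsto (fun n => gradPotential (φn n)) atTop (𝓝 (gradPotential φ)) :=
  tendsto_finsetSum _ fun j _ => ((riesz j).continuous.tendsto _).comp
    ((continuous_fourier_L2.tendsto _).comp (h j))

end HomogeneousSobolev

end SobolevSpace

section TestDensity

/-! ### Density of test functions -/

section Density

/-- Invariance under the linear isometries of `ℝ³`. -/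
def IsRotationInvariant (w : E3 → ℂ) : Prop := ∀ (L : E3 ≃ₗᵢ[ℝ] E3) z, w (L z) = w z

/-- Classes of test functions on `ℝ³`, rotation invariant ones if `r` holds. -/
def testData (r : Prop) : Submodule ℂ L2 where
  carrier := {v | ∃ w : E3 → ℂ, ContDiff ℝ ∞ w ∧ HasCompactSupport w ∧ (r → IsRotationInvariant w) ∧
    v =ᵐ[volume] w}
  add_mem' := by
    rintro a b ⟨w, h1, h2, h3, h4⟩ ⟨w', h1', h2', h3', h4'⟩
    refine ⟨w + w', h1.add h1', h2.add h2', fun hr L z => ?_, (Lp.coeFn_add a b).trans (h4.add h4')⟩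
    simp only [Pi.add_apply, h3 hr L z, h3' hr L z]
  zero_mem' := ⟨0, contDiff_const, HasCompactSupport.zero, fun _ _ _ => rfl, Lp.coeFn_zero _ _ _⟩
  smul_mem' := by
    rintro c a ⟨w, h1, h2, h3, h4⟩
    refine ⟨c • w, h1.const_smul c, h2.smul_left (f := fun _ => c), fun hr L z => ?_,
      (Lp.coeFn_smul c a).trans (h4.const_smul c)⟩
    simp only [Pi.smul_apply, h3 hr L z]

/-- Classes of test functions on `ℝ × ℝ³`, rotation invariant in space if `r` holds. -/
def testForcing (r : Prop) : Submodule ℂ L1L2 where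
  carrier := {f | ∃ F : ℝ × E3 → ℂ, ContDiff ℝ ∞ F ∧ HasCompactSupport F ∧
    (r → ∀ t, IsRotationInvariant fun z => F (t, z)) ∧ ∀ᵐ t, f t =ᵐ[volume] fun z => F (t, z)}
  add_mem' := by
    rintro a b ⟨w, h1, h2, h3, h4⟩ ⟨w', h1', h2', h3', h4'⟩
    refine ⟨w + w', h1.add h1', h2.add h2', fun hr t L z => ?_, ?_⟩
    · simp only [Pi.add_apply, h3 hr t L z, h3' hr t L z]
    · filter_upwards [Lp.coeFn_add a b, h4, h4'] with t e1 e2 e3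
      rw [e1]
      exact (Lp.coeFn_add _ _).trans (e2.add e3)
  zero_mem' := by
    refine ⟨0, contDiff_const, HasCompactSupport.zero, fun _ _ _ _ => rfl, ?_⟩
    filter_upwards [Lp.coeFn_zero L2 1 (volume : Measure ℝ)] with t e1
    rw [e1]
    exact Lp.coeFn_zero _ _ _
  smul_mem' := by
    rintro c a ⟨w, h1, h2, h3, h4⟩
    refine ⟨c • w, h1.const_smul c, h2.smul_left (f := fun _ => c), fun hr t L z => ?_, ?_⟩
    · simp only [Pi.smul_apply, h3 hr t L z]
    · filter_upwards [Lp.coeFn_smul c a, h4] with t e1 e2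
      rw [e1]
      exact (Lp.coeFn_smul _ _).trans (e2.const_smul c)

/-- `t ↦ a(t) v` as a bilinear map. -/
def tensorCLM : L2 →L[ℂ] Lp ℂ 1 (volume : Measure ℝ) →L[ℂ] L1L2 :=
  ContinuousLinearMap.compLpL₂ 1 volume (ContinuousLinearMap.lsmul ℂ ℂ : ℂ →L[ℂ] L2 →L[ℂ] L2).flip

theorem coeFn_tensorCLM (v : L2) (a : Lp ℂ 1 (volume : Measure ℝ)) :
    ∀ᵐ t, tensorCLM v a t = a t • v :=
  ((ContinuousLinearMap.lsmul ℂ ℂ : ℂ →L[ℂ] L2 →L[ℂ] L2).flip v).coeFn_compLp a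

/-- Two closures are taken in turn: first `a` is approximated with `v` a fixed test function, then
`v` with `a` fixed. -/
theorem tensorCLM_mem {r : Prop} {v : L2} (hv : v ∈ (testData r).topologicalClosure)
    (a : Lp ℂ 1 (volume : Measure ℝ)) : tensorCLM v a ∈ (testForcing r).topologicalClosure := by
  have hcl := (testForcing r).isClosed_topologicalClosure
  have h1 : ∀ v ∈ testData r, ∀ a, tensorCLM v a ∈ (testForcing r).topologicalClosure := by
    rintro v ⟨w, hw, hwc, hwr, hvw⟩ a
    have hd := (Lp.dense_hasCompactSupport_contDiff (F := ℂ) (μ := (volume : Measure ℝ)) (p := 1)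
      (by norm_num)) a
    refine closure_minimal ?_ (hcl.preimage (tensorCLM v).continuous) hd
    rintro b ⟨g, hbg, hgc, hg⟩
    refine (testForcing r).le_topologicalClosure ⟨fun q => g q.1 * w q.2,
      (hg.comp contDiff_fst).mul (hw.comp contDiff_snd), ?_, fun hr t L z => ?_, ?_⟩
    · refine HasCompactSupport.of_support_subset_isCompact (hgc.isCompact.prod hwc.isCompact) ?_
      intro q hq
      exact ⟨subset_tsupport g (left_ne_zero_of_mul hq), subset_tsupport w (right_ne_zero_of_mul hq)⟩
    · simp only [hwr hr L z]
    · filter_upwards [coeFn_tensorCLM v b, hbg] with t e1 e2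
      rw [e1, e2]
      exact (Lp.coeFn_smul _ _).trans (hvw.const_smul (g t))
  refine closure_minimal (t := {v | tensorCLM v a ∈ (testForcing r).topologicalClosure})
    (fun v hv => h1 v hv a) (hcl.preimage (tensorCLM.flip a).continuous) hv

/-- Density of test functions in `L¹(ℝ; L²)`. -/
theorem mem_closure_testForcing {r : Prop} {f : L1L2}
    (hf : ∀ᵐ t, f t ∈ (testData r).topologicalClosure) : f ∈ (testForcing r).topologicalClosure := by
  set V := (testData r).topologicalClosure with hV
  have hcl := (testForcing r).isClosed_topologicalClosure
  have hcomplete : CompleteSpace V := (testData r).isClosed_topologicalClosure.completeSpace_coe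
  -- Working in `Lp V 1` makes the simple functions in the induction take values in V, so that each
  -- of them is a sum of tensors covered by `tensorCLM_mem`.
  have key : ∀ g : Lp V 1 (volume : Measure ℝ),
      V.subtypeL.compLpL 1 volume g ∈ (testForcing r).topologicalClosure := by
    refine Lp.induction (by norm_num) _ (fun c s hs hμs => ?_) (fun g g' hg hg' _ h1 h2 => ?_)
      (hcl.preimage (V.subtypeL.compLpL 1 volume).continuous)
    · have h1 := tensorCLM_mem c.2 (indicatorConstLp 1 hs hμs.ne (1 : ℂ))
      convert h1 using 1
      refine Lp.ext ?_
      filter_upwards [coeFn_tensorCLM (c : L2) (indicatorConstLp 1 hs hμs.ne (1 : ℂ)),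
        V.subtypeL.coeFn_compLpL (p := 1) (indicatorConstLp 1 hs hμs.ne c),
        indicatorConstLp_coeFn (p := 1) (hs := hs) (hμs := hμs.ne) (c := c),
        indicatorConstLp_coeFn (p := 1) (hs := hs) (hμs := hμs.ne) (c := (1 : ℂ))] with t e1 e2 e3 e4
      rw [Lp.simpleFunc.coe_indicatorConst, e1, e2, e3, e4]
      by_cases ht : t ∈ s <;> simp [ht]
    · rw [map_add]
      exact Submodule.add_mem _ h1 h2
  -- `f` already has values in V almost everywhere; the projection only turns it into a V-valued
  -- class, and the inclusion returns `f`.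
  have h2 := key (V.orthogonalProjectionOnto.compLpL 1 volume f)
  convert h2 using 1
  refine Lp.ext ?_
  filter_upwards [V.subtypeL.coeFn_compLpL (p := 1) (V.orthogonalProjectionOnto.compLpL 1 volume f),
    V.orthogonalProjectionOnto.coeFn_compLpL (p := 1) f, hf] with t e1 e2 e3
  rw [e1, e2]
  exact (congrArg Subtype.val
    (Submodule.orthogonalProjectionOnto_mem_subspace_eq_self (⟨f t, e3⟩ : V))).symm

theorem mem_closure_testData (v : L2) : v ∈ (testData False).topologicalClosure := by
  have hd := (Lp.dense_hasCompactSupport_contDiff (F := ℂ) (μ := (volume : Measure E3)) (p := 2)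
      (by norm_num)) v
  refine closure_mono ?_ hd
  rintro b ⟨g, hbg, hgc, hg⟩
  exact ⟨g, hg, hgc, fun h => h.elim, hbg⟩

/-- The profile in `IsRadial` need not be measurable. By Fubini in polar coordinates, almost every
ray carries a restriction of `v` that agrees with it almost everywhere, and this restriction is a
measurable replacement. -/
theorem IsRadial.exists_direction {v : L2} (hv : IsRadial v) :
    ∃ w : S2, ∀ᵐ z, v z = v (‖z‖ • (w : E3)) := by
  obtain ⟨h, hh⟩ := hv
  have hvm : Measurable v := (Lp.stronglyMeasurable v).measurable
  set ρ₀ := sphereMeasure.prod (volume.restrict (Set.Ioi (0 : ℝ))) with hρ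
  have hc : Continuous fun q : S2 × ℝ => q.2 • (q.1 : E3) := by fun_prop
  have hpos : ∀ᵐ q ∂ρ₀, 0 < q.2 :=
    Measure.quasiMeasurePreserving_snd.ae (ae_restrict_mem measurableSet_Ioi)
  have hnorm : ∀ q : S2 × ℝ, 0 < q.2 → ‖q.2 • (q.1 : E3)‖ = q.2 := fun q hq => by
    rw [norm_smul, norm_eq_of_mem_sphere, mul_one, Real.norm_of_nonneg hq.le]
  have hac : ρ₀ ≪ ρ₀.withDensity fun q => ENNReal.ofReal (q.2 ^ 2) := by
    refine withDensity_absolutelyContinuous' (by fun_prop) ?_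
    filter_upwards [hpos] with q hq
    simp [hq.ne']
  have hac' : ρ₀.withDensity (fun q => ENNReal.ofReal (q.2 ^ 2)) ≪ ρ₀ :=
    withDensity_absolutelyContinuous _ _
  have h1 : ∀ᵐ q ∂ρ₀, v (q.2 • (q.1 : E3)) = h q.2 := by
    have h2 : ∀ᵐ q ∂ρ₀.withDensity fun q => ENNReal.ofReal (q.2 ^ 2),
        v (q.2 • (q.1 : E3)) = h ‖q.2 • (q.1 : E3)‖ := by
      refine ae_of_ae_map (f := fun q : S2 × ℝ => q.2 • (q.1 : E3)) hc.aemeasurable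
        (p := fun z => v z = h ‖z‖) ?_
      rw [hρ, map_polar]
      exact hh
    filter_upwards [hac.ae_le h2, hpos] with q e1 e2
    rw [e1, hnorm q e2]
  have h3 := Measure.ae_ae_of_ae_prod h1
  have hne : (ae sphereMeasure).NeBot := by
    rw [ae_neBot]
    intro h0
    have := sphereMeasure_real_univ
    rw [h0] at this
    simp [Real.pi_ne_zero] at this
  obtain ⟨w, hw⟩ := h3.exists
  refine ⟨w, ?_⟩
  have h4 : ∀ᵐ q ∂ρ₀, v (q.2 • (w : E3)) = h q.2 := Measure.quasiMeasurePreserving_snd.ae hw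
  have h5 : ∀ᵐ q ∂ρ₀, v (q.2 • (q.1 : E3)) = v (‖q.2 • (q.1 : E3)‖ • (w : E3)) := by
    filter_upwards [h1, h4, hpos] with q e1 e2 e3
    rw [e1, hnorm q e3, e2]
  have h6 := (ae_map_iff (f := fun q : S2 × ℝ => q.2 • (q.1 : E3)) hc.aemeasurable
    (p := fun z => v z = v (‖z‖ • (w : E3)))
    (measurableSet_eq_fun hvm (hvm.comp (by fun_prop)))).2 (hac'.ae_le h5)
  rw [hρ, map_polar] at h6
  exact h6

/-- Write v = k(|z|²) and approximate `k` by test functions in L² of the image of Lebesgue measure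
under |z|². Using |z|² instead of |z| makes the approximants smooth at the origin. -/
theorem IsRadial.mem_closure_testData {v : L2} (hv : IsRadial v) :
    v ∈ (testData True).topologicalClosure := by
  obtain ⟨w, hw⟩ := hv.exists_direction
  have hvm : Measurable v := (Lp.stronglyMeasurable v).measurable
  set k : ℝ → ℂ := fun x => v (√x • (w : E3)) with hk
  have hkm : Measurable k := hvm.comp (by fun_prop)
  have hvk : ∀ᵐ z, v z = k (‖z‖ ^ 2) := by
    filter_upwards [hw] with z hz
    rw [hk]
    simp only
    rw [Real.sqrt_sq (norm_nonneg z)]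
    exact hz
  have hs : Measurable fun z : E3 => ‖z‖ ^ 2 := by fun_prop
  set ν := Measure.map (fun z : E3 => ‖z‖ ^ 2) volume with hν
  have hfin : IsFiniteMeasureOnCompacts ν := ⟨fun K hK => by
    obtain ⟨R, hR⟩ := hK.isBounded.subset_closedBall 0
    rw [hν, Measure.map_apply hs hK.measurableSet]
    refine (measure_mono (fun z hz => ?_)).trans_lt
      (measure_closedBall_lt_top (x := (0 : E3)) (r := R + 1))
    have := hR hz
    rw [mem_closedBall_zero_iff, Real.norm_of_nonneg (by positivity)] at this
    rw [mem_closedBall_zero_iff]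
    nlinarith [sq_nonneg (‖z‖ - 1), norm_nonneg z]⟩
  have hkν : MemLp k 2 ν := by
    rw [hν, memLp_map_measure_iff hkm.aestronglyMeasurable hs.aemeasurable]
    exact (memLp_congr_ae (show (v : E3 → ℂ) =ᵐ[volume] k ∘ fun z => ‖z‖ ^ 2 from hvk)).1 (Lp.memLp v)
  refine Metric.mem_closure_iff.2 fun ε hε => ?_
  obtain ⟨k₁, hk₁c, hk₁, hle⟩ := hkν.exist_eLpNorm_sub_le (by norm_num) (by norm_num) (half_pos hε)
  set g : E3 → ℂ := fun z => k₁ (‖z‖ ^ 2) with hg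
  have hgs : ContDiff ℝ ∞ g := hk₁.comp (contDiff_norm_sq ℝ)
  have hgc : HasCompactSupport g := by
    obtain ⟨R, hR⟩ := exists_norm_bound_of_hasCompactSupport hk₁c
    refine HasCompactSupport.of_support_subset_isCompact (isCompact_closedBall (0 : E3) (R + 1))
      fun z hz => ?_
    rw [mem_closedBall_zero_iff]
    by_contra hlt
    push Not at hlt
    refine hz (hR _ ?_)
    rw [Real.norm_of_nonneg (by positivity)]
    nlinarith [sq_nonneg (‖z‖ - 1), norm_nonneg z]
  have hgm : MemLp g 2 volume := hgs.continuous.memLp_of_hasCompactSupport hgc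
  refine ⟨hgm.toLp g, ⟨g, hgs, hgc, fun _ L z => ?_, hgm.coeFn_toLp⟩, ?_⟩
  · rw [hg]
    simp only [LinearIsometryEquiv.norm_map]
  · rw [Lp.dist_def]
    have h1 : eLpNorm (v - hgm.toLp g : E3 → ℂ) 2 volume = eLpNorm (k - k₁) 2 ν := by
      rw [hν, eLpNorm_map_measure (hkm.aestronglyMeasurable.sub
        hk₁.continuous.aestronglyMeasurable) hs.aemeasurable]
      refine eLpNorm_congr_ae ?_
      filter_upwards [hvk, hgm.coeFn_toLp] with z e1 e2
      simp only [Pi.sub_apply, Function.comp_apply]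
      rw [e1, e2]
    rw [h1]
    exact (ENNReal.toReal_le_of_le_ofReal (by positivity) hle).trans_lt (by linarith)

/-- A limit in `Lᵖ` of rotation invariant functions is radial. -/
theorem isRadial_of_tendsto {p : ℝ≥0∞} [Fact (1 ≤ p)] {vn : ℕ → Lp ℂ p (volume : Measure E3)}
    {v : Lp ℂ p (volume : Measure E3)} (h : Tendsto vn atTop (𝓝 v)) {wn : ℕ → E3 → ℂ}
    (hw : ∀ n, IsRotationInvariant (wn n)) (hvw : ∀ n, vn n =ᵐ[volume] wn n) : IsRadial v := by
  obtain ⟨ns, -, hns⟩ := (tendstoInMeasure_of_tendsto_Lp h).exists_seq_tendsto_ae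
  -- The profile is read off one ray, along a subsequence that converges almost everywhere.
  refine ⟨fun s => limUnder atTop fun n => wn (ns n) (s • basisVec 0), ?_⟩
  filter_upwards [hns, ae_all_iff.2 hvw] with z hz hzw
  have hnorm : ‖‖z‖ • basisVec 0‖ = ‖z‖ := by simp [basisVec, norm_smul]
  have h1 : ∀ n, wn n (‖z‖ • basisVec 0) = wn n z := fun n => by
    -- Two vectors of equal norm are exchanged by the reflection in the hyperplane orthogonal to
    -- their difference.
    conv_lhs => rw [← Submodule.reflection_sub hnorm.symm]
    exact hw n _ z
  simp only [h1, ← hzw]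
  exact hz.limUnder_eq.symm

end Density

end TestDensity

section MainResult

/-! ### Data without radiation -/

open FourierTransform

/-! ### Characterization of data with vanishing radiation field. -/

section ZeroRadiation

theorem fourier_L2_injective {v w : L2} (h : (𝓕 v : L2) = 𝓕 w) : v = w :=
  (Lp.fourierTransformₗᵢ E3 ℂ).injective h

theorem IsTestRadiationField.riesz_gradPotential {φ : HDot1} {ψ : L2} {f : L1L2} {G : L2Cyl}
    (h : IsTestRadiationField φ ψ f G) (j : Fin 3) :
    riesz j (gradPotential φ) = (𝓕 (weakPartial φ j) : L2) := by
  obtain ⟨⟨S, rfl⟩, -⟩ := h.exists_schwartz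
  exact RadiationField.riesz_gradPotential S j

theorem tendsto_radiationData (ε : ℝ) {φ : HDot1} {ψ : L2} {f : L1L2} {φn : ℕ → HDot1}
    {ψn : ℕ → L2} {fn : ℕ → L1L2}
    (hφ : ∀ i, Tendsto (fun n => weakPartial (φn n) i) atTop (𝓝 (weakPartial φ i)))
    (hψ : Tendsto ψn atTop (𝓝 ψ)) (hf : Tendsto fn atTop (𝓝 f)) :
    Tendsto (fun n => radiationData ε (φn n) (ψn n) (fn n)) atTop (𝓝 (radiationData ε φ ψ f)) :=
  (((continuous_fourier_L2.tendsto ψ).comp hψ).add ((tendsto_gradPotential hφ).const_smul _)).add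
    (tendsto_forcing ε hf)

theorem IsApproximation.tendsto_norm_sq {φ : HDot1} {ψ : L2} {f : L1L2} {φn : ℕ → HDot1}
    {ψn : ℕ → L2} {fn : ℕ → L1L2} {Gn : ℕ → L2Cyl} (h : IsApproximation φ ψ f φn ψn fn Gn) :
    Tendsto (fun n => 4 * ‖Gn n‖ ^ 2) atTop
      (𝓝 (‖radiationData 1 φ ψ f‖ ^ 2 + ‖radiationData (-1) φ ψ f‖ ^ 2)) := by
  obtain ⟨hφ, hψ⟩ := tendsto_energy_iff.1 h.tendsto_data
  simp only [fun n => (h.test n).exists_schwartz.2]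
  exact ((tendsto_radiationData 1 hφ hψ h.tendsto_force).norm.pow 2).add
    ((tendsto_radiationData (-1) hφ hψ h.tendsto_force).norm.pow 2)

/-- A single approximation with vanishing fields forces Z₁ = Z₋₁ = 0 in the limit, and then the norm
identity sends the fields of every other approximation to zero. -/
theorem isRadiationField_zero_of_approximation {φ : HDot1} {ψ : L2} {f : L1L2} {φn : ℕ → HDot1}
    {ψn : ℕ → L2} {fn : ℕ → L1L2} (h : IsApproximation φ ψ f φn ψn fn fun _ => 0) :
    IsRadiationField φ ψ f 0 := by
  refine ⟨⟨φn, ψn, fn, fun _ => 0, h⟩, fun φn' ψn' fn' Gn' h' => ?_⟩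
  have h1 : ‖radiationData 1 φ ψ f‖ ^ 2 + ‖radiationData (-1) φ ψ f‖ ^ 2 = 0 := by
    have := h.tendsto_norm_sq
    simp only [norm_zero, ne_eq, OfNat.ofNat_ne_zero, not_false_eq_true, zero_pow, mul_zero] at this
    exact tendsto_nhds_unique this tendsto_const_nhds
  have h2 := h'.tendsto_norm_sq
  rw [h1] at h2
  have h3 : Tendsto (fun n => √(4 * ‖Gn' n‖ ^ 2)) atTop (𝓝 (√0)) := h2.sqrt
  rw [Real.sqrt_zero] at h3
  refine tendsto_zero_iff_norm_tendsto_zero.2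
    (squeeze_zero (fun _ => norm_nonneg _) (fun n => Real.le_sqrt_of_sq_le ?_) h3)
  nlinarith [sq_nonneg ‖Gn' n‖]

theorem IsRadiationField.radiationData_eq_zero {φ : HDot1} {ψ : L2} {f : L1L2}
    (h : IsRadiationField φ ψ f 0) : radiationData 1 φ ψ f = 0 ∧ radiationData (-1) φ ψ f = 0 := by
  obtain ⟨⟨φn, ψn, fn, Gn, ha⟩, hG⟩ := h
  have h1 := ((hG _ _ _ _ ha).norm.pow 2).const_mul 4
  have h2 := tendsto_nhds_unique ha.tendsto_norm_sq h1
  simp only [norm_zero, ne_eq, OfNat.ofNat_ne_zero, not_false_eq_true, zero_pow, mul_zero] at h2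
  have h3 := (add_eq_zero_iff_of_nonneg (sq_nonneg _) (sq_nonneg _)).1 h2
  exact ⟨norm_eq_zero.1 (pow_eq_zero_iff two_ne_zero |>.1 h3.1),
    norm_eq_zero.1 (pow_eq_zero_iff two_ne_zero |>.1 h3.2)⟩

/-- Passage to the limit from test data. Since `IsRadiationField` includes an approximating
sequence, density of test functions in Ḣ¹ is not needed. -/
theorem IsRadiationField.riesz_gradPotential {φ : HDot1} {ψ : L2} {f : L1L2} {G : L2Cyl}
    (h : IsRadiationField φ ψ f G) (j : Fin 3) :
    riesz j (gradPotential φ) = (𝓕 (weakPartial φ j) : L2) := by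
  obtain ⟨⟨φn, ψn, fn, Gn, ha⟩, -⟩ := h
  obtain ⟨hφ, -⟩ := tendsto_energy_iff.1 ha.tendsto_data
  have h1 := ((riesz j).continuous.tendsto _).comp (tendsto_gradPotential hφ)
  have h2 := (continuous_fourier_L2.tendsto _).comp (hφ j)
  refine tendsto_nhds_unique h1 (h2.congr fun n => ?_)
  exact ((ha.test n).riesz_gradPotential j).symm

theorem fourier_eq_of_radiationData {φ : HDot1} {ψ : L2} {f : L1L2}
    (h : radiationData 1 φ ψ f = 0 ∧ radiationData (-1) φ ψ f = 0) :
    (𝓕 ψ : L2) = (-2⁻¹ : ℂ) • (forcing 1 f + forcing (-1) f) := by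
  obtain ⟨h1, h2⟩ := h
  unfold radiationData at h1 h2
  push_cast at h1 h2
  have h3 := congrArg₂ (· + ·) h1 h2
  have h4 : (2 : ℂ) • (𝓕 ψ : L2) = -(forcing 1 f + forcing (-1) f) := by
    rw [eq_neg_iff_add_eq_zero, ← add_zero (0 : L2), ← h3]
    module
  rw [neg_smul, ← smul_neg, ← h4, smul_smul]
  norm_num

theorem gradPotential_eq_of_radiationData {φ : HDot1} {ψ : L2} {f : L1L2}
    (h : radiationData 1 φ ψ f = 0 ∧ radiationData (-1) φ ψ f = 0) :
    gradPotential φ = (-2⁻¹ : ℂ) • (forcing 1 f - forcing (-1) f) := by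
  obtain ⟨h1, h2⟩ := h
  unfold radiationData at h1 h2
  push_cast at h1 h2
  have h3 := congrArg₂ (· - ·) h1 h2
  have h4 : (2 : ℂ) • gradPotential φ = -(forcing 1 f - forcing (-1) f) := by
    rw [eq_neg_iff_add_eq_zero, ← sub_zero (0 : L2), ← h3]
    module
  rw [neg_smul, ← smul_neg, ← h4, smul_smul]
  norm_num

/-- Both 𝓕ψ and `gradPotential φ` are given by the forcing alone; the latter determines ∇φ, and ∇φ
determines φ by `hDot1_ext`. -/
theorem IsRadiationField.zero_unique {φ φ' : HDot1} {ψ ψ' : L2} {f : L1L2}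
    (h : IsRadiationField φ ψ f 0) (h' : IsRadiationField φ' ψ' f 0) : φ = φ' ∧ ψ = ψ' := by
  refine ⟨hDot1_ext fun i => fourier_L2_injective ?_, fourier_L2_injective ?_⟩
  · rw [← h.riesz_gradPotential i, ← h'.riesz_gradPotential i,
      gradPotential_eq_of_radiationData h.radiationData_eq_zero,
      gradPotential_eq_of_radiationData h'.radiationData_eq_zero]
  · rw [fourier_eq_of_radiationData h.radiationData_eq_zero,
      fourier_eq_of_radiationData h'.radiationData_eq_zero]

theorem sum_norm_sq_riesz (v : L2) : ∑ j, ‖riesz j v‖ ^ 2 = ‖v‖ ^ 2 := by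
  have hne : ∀ᵐ ξ : E3, ξ ≠ 0 := by simp [ae_iff]
  simp only [L2.norm_sq_eq_integral]
  rw [← integral_finsetSum _ fun j _ => (Lp.memLp (riesz j v)).integrable_norm_pow (by norm_num)]
  refine integral_congr_ae ?_
  filter_upwards [ae_all_iff.2 fun j => coeFn_riesz j v, hne] with ξ h1 h2
  simp only [h1, norm_mul, mul_pow]
  rw [← Finset.sum_mul]
  have h3 : ∑ j, ‖rieszSymbol j ξ‖ ^ 2 = 1 := by
    have h4 := sum_rieszSymbol_sq h2
    apply Complex.ofReal_injective
    rw [Complex.ofReal_one, ← h4]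
    push_cast
    refine Finset.sum_congr rfl fun j _ => ?_
    rw [rieszSymbol, Complex.norm_real, ← Complex.ofReal_pow, ← Complex.ofReal_pow, Real.norm_eq_abs,
      sq_abs]
  rw [h3, one_mul]

/-- The parallelogram law gives E² = ½(‖F₁‖² + ‖F₋₁‖²), and each F_ε has norm at most ‖f‖. -/
theorem IsRadiationField.energy_le {φ : HDot1} {ψ : L2} {f : L1L2}
    (h : IsRadiationField φ ψ f 0) : energy φ ψ ≤ ‖f‖ := by
  have h1 : ∑ i, ‖weakPartial φ i‖ ^ 2 = ‖gradPotential φ‖ ^ 2 := by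
    rw [← sum_norm_sq_riesz]
    simp only [h.riesz_gradPotential, Lp.norm_fourier_eq]
  unfold energy
  refine Real.sqrt_le_iff.2 ⟨norm_nonneg _, ?_⟩
  rw [h1, ← Lp.norm_fourier_eq ψ, gradPotential_eq_of_radiationData h.radiationData_eq_zero,
    fourier_eq_of_radiationData h.radiationData_eq_zero, norm_smul, norm_smul]
  have hpar := parallelogram_law_with_norm ℂ (forcing 1 f) (forcing (-1) f)
  have hb1 := pow_le_pow_left₀ (norm_nonneg _) (norm_forcing_le 1 f) 2
  have hb2 := pow_le_pow_left₀ (norm_nonneg _) (norm_forcing_le (-1) f) 2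
  have h2 : ‖(-2⁻¹ : ℂ)‖ = 2⁻¹ := by norm_num
  rw [h2]
  nlinarith

end ZeroRadiation

/-! ### Existence by approximation with compactly supported waves. -/

section Existence

/-- Compactly supported solutions for test forcings. -/
theorem exists_test_solution {r : Prop} {f : L1L2} (hf : f ∈ testForcing r) :
    ∃ S S' : 𝓢(E3, ℂ), HasCompactSupport S ∧
      IsTestRadiationField (hDot1OfSchwartz S) (S'.toLp 2) f 0 ∧
      (r → IsRotationInvariant S ∧ IsRotationInvariant S') := by
  obtain ⟨F, hF, hFc, hFr, hfF⟩ := hf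
  obtain ⟨u, hu, huc, huw, hur⟩ := exists_compactSupport_wave hF hFc
  obtain ⟨R, hR⟩ := exists_norm_bound_of_hasCompactSupport huc
  have hs : IsSpatiallySupported R u := ⟨hu, fun t z hz => hR _ (hz.trans_le (norm_snd_le (t, z)))⟩
  refine ⟨hs.slice 0, hs.timeDeriv.slice 0, hs.hasCompactSupport_slice 0, ?_, fun hr => ⟨fun L z => ?_,
    fun L z => ?_⟩⟩
  · refine ⟨_, _, F, u, 0, ⟨hs.contDiff_slice 0, hs.hasCompactSupport_slice 0⟩,
      ⟨hs.timeDeriv.contDiff_slice 0, hs.timeDeriv.hasCompactSupport_slice 0⟩, ⟨hF, hFc⟩,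
      (hs.slice 0).coeFn_toLp 6 volume, (hs.timeDeriv.slice 0).coeFn_toLp 2 volume, hfF,
      Lp.coeFn_zero _ _ _, ⟨hu, fun t ht z => ?_, fun z => rfl, fun z => ?_⟩, fun _ _ => 0,
      fun s θ => ?_, fun s θ => hasDerivAt_const _ _⟩
    · rw [waveOp_eq (hu.of_le two_le_infty)]
      exact huw t z ht
    · exact (hasDerivAt_time (hu.of_le (by simp)) 0 z).deriv
    -- Along each ray the compactly supported wave is eventually zero, so its radiation field
    -- vanishes identically.
    · refine tendsto_const_nhds.congr' ?_
      filter_upwards [eventually_gt_atTop (max R 0)] with t ht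
      rw [hs.eq_zero, mul_zero]
      rw [norm_smul, norm_eq_of_mem_sphere, mul_one,
        Real.norm_of_nonneg ((le_max_right R 0).trans ht.le)]
      exact (le_max_left R 0).trans_lt ht
  · exact hur L (fun t z => hFr hr t L z) 0 z
  · have h1 := hasDerivAt_time (hu.of_le (by simp)) 0 (L z)
    have h2 := hasDerivAt_time (hu.of_le (by simp)) 0 z
    simp only [fun t => hur L (fun t z => hFr hr t L z) t z] at h1
    exact h1.unique h2

/-- Each test forcing has data without radiation, and the formulas for 𝓕ψ and `gradPotential` show
that these data converge when the forcings do. The proposition `r` carries rotation invariance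
along, so that the general and the radial case share one proof. -/
theorem exists_isRadiationField_zero {r : Prop} {f : L1L2}
    (hf : f ∈ (testForcing r).topologicalClosure) :
    ∃ (φ : HDot1) (ψ : L2), IsRadiationField φ ψ f 0 ∧
      (r → IsRadial ((φ : L6) : E3 → ℂ) ∧ IsRadial ψ) := by
  obtain ⟨fn, hfn, hlim⟩ := mem_closure_iff_seq_limit.1 hf
  choose S S' hS htest hrad using fun n => exists_test_solution (hfn n)
  -- The field is zero, so by the norm identity both squares vanish.
  have hdata : ∀ n, radiationData 1 (hDot1OfSchwartz (S n)) ((S' n).toLp 2) (fn n) = 0 ∧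
      radiationData (-1) (hDot1OfSchwartz (S n)) ((S' n).toLp 2) (fn n) = 0 := fun n => by
    have h2 := (htest n).exists_schwartz.2
    simp only [norm_zero, ne_eq, OfNat.ofNat_ne_zero, not_false_eq_true, zero_pow, mul_zero] at h2
    have h3 := (add_eq_zero_iff_of_nonneg (sq_nonneg _) (sq_nonneg _)).1 h2.symm
    exact ⟨norm_eq_zero.1 (pow_eq_zero_iff two_ne_zero |>.1 h3.1),
      norm_eq_zero.1 (pow_eq_zero_iff two_ne_zero |>.1 h3.2)⟩
  have hcont : Continuous fun v : L2 => (𝓕⁻ v : L2) :=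
    FourierTransform.continuous_fourierInv (E := L2) (F := L2)
  have h1 := tendsto_forcing 1 hlim
  have h2 := tendsto_forcing (-1) hlim
  have hψ : Tendsto (fun n => ((S' n).toLp 2 : L2)) atTop
      (𝓝 (𝓕⁻ ((-2⁻¹ : ℂ) • (forcing 1 f + forcing (-1) f)) : L2)) := by
    refine ((hcont.tendsto _).comp ((h1.add h2).const_smul (-2⁻¹ : ℂ))).congr fun n => ?_
    simp only [Function.comp_apply]
    rw [← fourier_eq_of_radiationData (hdata n), FourierTransform.fourierInv_fourier_eq]
  have hφ : ∀ i, Tendsto (fun n => weakPartial (hDot1OfSchwartz (S n)) i) atTop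
      (𝓝 (𝓕⁻ (riesz i ((-2⁻¹ : ℂ) • (forcing 1 f - forcing (-1) f))) : L2)) := fun i => by
    refine ((hcont.tendsto _).comp (((riesz i).continuous.tendsto _).comp
      ((h1.sub h2).const_smul (-2⁻¹ : ℂ)))).congr fun n => ?_
    simp only [Function.comp_apply]
    rw [← gradPotential_eq_of_radiationData (hdata n), (htest n).riesz_gradPotential,
      FourierTransform.fourierInv_fourier_eq]
  obtain ⟨φ, hφg, hφ6⟩ := exists_hDot1_limit hS hφ
  refine ⟨φ, _, isRadiationField_zero_of_approximation
    ⟨htest, tendsto_energy_iff.2 ⟨fun i => ?_, hψ⟩, hlim⟩, fun hr => ⟨?_, ?_⟩⟩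
  · rw [hφg i]
    exact hφ i
  · exact isRadial_of_tendsto hφ6 (fun n => (hrad n hr).1) fun n => (S n).coeFn_toLp 6 volume
  · exact isRadial_of_tendsto hψ (fun n => (hrad n hr).2) fun n => (S' n).coeFn_toLp 2 volume

end Existence

/-! ### Regularity of the data from regularity of the forcing. -/

section Regularity

variable {φ : HDot1} {ψ : L2} {f : L1L2} {k : ℕ}

/-- Applying ∂^α to ψ amounts to replacing f by ∂^α f in the formula for 𝓕ψ, by
`forcing_ae_eq_symbol_mul`. -/
theorem IsRadiationField.memH (h : IsRadiationField φ ψ f 0) (hf : MemL1H k f) : MemH k ψ := by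
  intro n hn α
  obtain ⟨g, hg⟩ := hf n hn α
  refine ⟨(𝓕⁻ ((-2⁻¹ : ℂ) • (forcing 1 g + forcing (-1) g)) : L2), ?_⟩
  rw [isWeakDeriv_iff_fourier, FourierTransform.fourier_fourierInv_eq,
    fourier_eq_of_radiationData h.radiationData_eq_zero]
  filter_upwards [forcing_ae_eq_symbol_mul 1 α hg, forcing_ae_eq_symbol_mul (-1) α hg,
    Lp.coeFn_smul (-2⁻¹ : ℂ) (forcing 1 g + forcing (-1) g), Lp.coeFn_add (forcing 1 g) (forcing (-1) g),
    Lp.coeFn_smul (-2⁻¹ : ℂ) (forcing 1 f + forcing (-1) f),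
    Lp.coeFn_add (forcing 1 f) (forcing (-1) f)] with ξ h1 h2 h3 h4 h5 h6
  rw [h3, h5, Pi.smul_apply, Pi.smul_apply, h4, h6, Pi.add_apply, Pi.add_apply, h1, h2, smul_eq_mul,
    smul_eq_mul]
  ring

/-- One derivative of φ is free, being a bounded Riesz multiplier applied to the forcing terms; the
other n - 1 ≤ k derivatives fall on f. -/
theorem IsRadiationField.memHTilde (h : IsRadiationField φ ψ f 0) (hf : MemL1H k f) :
    MemHTilde (k + 1) φ := by
  intro n h1n hn α
  obtain ⟨m, rfl⟩ : ∃ m, n = m + 1 := ⟨n - 1, by omega⟩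
  obtain ⟨g, hg⟩ := hf m (by omega) fun j => α j.castSucc
  refine ⟨(𝓕⁻ (riesz (α (Fin.last m)) ((-2⁻¹ : ℂ) • (forcing 1 g - forcing (-1) g))) : L2), ?_⟩
  rw [isWeakDeriv_hDot1_iff, isWeakDeriv_iff_fourier, FourierTransform.fourier_fourierInv_eq,
    ← h.riesz_gradPotential, gradPotential_eq_of_radiationData h.radiationData_eq_zero]
  filter_upwards [forcing_ae_eq_symbol_mul 1 _ hg, forcing_ae_eq_symbol_mul (-1) _ hg,
    Lp.coeFn_smul (-2⁻¹ : ℂ) (forcing 1 g - forcing (-1) g), Lp.coeFn_sub (forcing 1 g) (forcing (-1) g),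
    Lp.coeFn_smul (-2⁻¹ : ℂ) (forcing 1 f - forcing (-1) f),
    Lp.coeFn_sub (forcing 1 f) (forcing (-1) f),
    coeFn_riesz (α (Fin.last m)) ((-2⁻¹ : ℂ) • (forcing 1 g - forcing (-1) g)),
    coeFn_riesz (α (Fin.last m)) ((-2⁻¹ : ℂ) • (forcing 1 f - forcing (-1) f))]
    with ξ h1 h2 h3 h4 h5 h6 h7 h8
  rw [h7, h8, h3, h5, Pi.smul_apply, Pi.smul_apply, h4, h6, Pi.sub_apply, Pi.sub_apply, h1, h2,
    smul_eq_mul, smul_eq_mul]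
  ring

end Regularity

end MainResult

end RadiationField

end

/-! ### The proposition. -/

theorem mainTheorem10 :
    (∀ f : RadiationField.L1L2,
      (∃! p : RadiationField.HDot1 × RadiationField.L2,
        RadiationField.IsRadiationField p.1 p.2 f 0) ∧
      ∀ (φ : RadiationField.HDot1) (ψ : RadiationField.L2),
        RadiationField.IsRadiationField φ ψ f 0 → RadiationField.energy φ ψ ≤ ‖f‖) ∧
    (∀ (k : ℕ) (f : RadiationField.L1L2),
      RadiationField.MemL1H k f → (∀ᵐ t : ℝ, RadiationField.IsRadial (f t)) →
      ∃! p : RadiationField.HDot1 × RadiationField.L2,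
        (RadiationField.MemHTilde (k + 1) p.1 ∧
          RadiationField.IsRadial ((p.1 : RadiationField.L6) : RadiationField.E3 → ℂ)) ∧
        (RadiationField.MemH k p.2 ∧ RadiationField.IsRadial p.2) ∧
        RadiationField.IsRadiationField p.1 p.2 f 0) := by
  refine ⟨fun f => ⟨?_, fun φ ψ h => h.energy_le⟩, fun k f hk hf => ?_⟩
  · obtain ⟨φ, ψ, h, -⟩ := RadiationField.exists_isRadiationField_zero (r := False)
      (RadiationField.mem_closure_testForcing (f := f)
        (.of_forall fun t => RadiationField.mem_closure_testData (f t)))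
    refine ⟨(φ, ψ), h, fun q hq => ?_⟩
    obtain ⟨h1, h2⟩ := hq.zero_unique h
    exact Prod.ext h1 h2
  -- Regularity and radial symmetry are properties of the one solution that exists; uniqueness is
  -- that of the general case.
  · obtain ⟨φ, ψ, h, hr⟩ := RadiationField.exists_isRadiationField_zero (r := True)
      (RadiationField.mem_closure_testForcing (f := f)
        (hf.mono fun t ht => ht.mem_closure_testData))
    refine ⟨(φ, ψ), ⟨⟨h.memHTilde hk, (hr trivial).1⟩, ⟨h.memH hk, (hr trivial).2⟩, h⟩, fun q hq => ?_⟩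
    obtain ⟨h1, h2⟩ := hq.2.2.zero_unique h
    exact Prod.ext h1 h2
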